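/- Conventions. A PPT algorithm is a probabilistic polynomial-time algorithm with output in $\{0,1\}^*$; all probabilities are also over its coins. $U(\Pi,1^s)$ is the output of the single-tape Turing machine $M$ on input $w$, where the bit string $\Pi$ describes the pair $(M,w)$, when $M(w)$ is emulated by a fixed universal machine $U$ for $s$ steps of $M$ (no output if $\Pi$ describes no pair or $M(w)$ has not halted). For $t:\mathbb N\to\mathbb N$, $K^t(x)=\min\{|\Pi| : U(\Pi,1^{t(|x|)})=x\}$. For a function $F$ on bit strings and $\alpha:\mathbb N\to\mathbb R$, $F$ is $\alpha$-hard-on-average if for every PPT algorithm $H$, for all sufficiently large $n$, $\Pr[x\leftarrow\{0,1\}^n : H(x)=F(x)]<1-\alpha(n)$. A polynomial-time computable $f:\{0,1\}^*\to\{0,1\}^*$ is a one-way function if for every PPT algorithm $A$ there is a negligible $\mu$ with $\Pr[x\leftarrow\{0,1\}^n : A(1^n,f(x))\in f^{-1}(f(x))]\le\mu(n)$ for all $n\in\mathbb N$; it is a weak one-way function if there is a positive polynomial $q$ such that for every PPT algorithm $A$ this probability is less than $1-\frac1{q(n)}$ for all sufficiently large $n$. Theorem. Let $t$ and $p$ be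 polynomials with $t(n)>0$, $p(n)>0$ for all $n\ge1$, where $t$ takes integer values at the integers $n\ge1$, and suppose that $K^t$ (with values written in binary) is $\frac1{p(\cdot)}$-hard-on-average. Then: 1. Let $c$ be any constant with $K^t(x)\le|x|+c$ for all $x\in\{0,1\}^*$ (such a $c$ exists), and put $k(n)=\lceil\log_2(n+c)\rceil$ and $m(n)=k(n)+n+c$. For $\ell\|\Pi'\in\{0,1\}^{m(n)}$ with $|\ell|=k(n)$ and $|\Pi'|=n+c$, let $f_n(\ell\|\Pi')=\ell\,\|\,U(\Pi,1^{t(n)})$, where $\ell$ is read as a number in $\{1,\dots,2^{k(n)}\}$, $\Pi$ is the $\ell$-bit prefix of $\Pi'$ (all of $\Pi'$ if $\ell>|\Pi'|$), and a missing output of $U$ is read as the empty string. Then $f_n(x)$ can be computed from $1^n$ and $x$ in polynomial time, and the family $f_n:\{0,1\}^{m(n)}\to\{0,1\}^*$ is weakly one-way: there is a positive polynomial $s$ such that for every PPT algorithm $A$, for all sufficiently large $n$, $$\Pr\left[x\leftarrow\{0,1\}^{m(n)} : A(1^{m(n)},f_n(x))=x'\text{ with } x'\in\{0,1\}^{m(n)},\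 f_n(x')=f_n(x)\right]<1-\frac1{s(n)}.$$ 2. There exists a weak one-way function $f:\{0,1\}^*\to\{0,1\}^*$. 3. There exists a one-way function $f:\{0,1\}^*\to\{0,1\}^*$. -/

import Mathlib

namespace KOWF

/-! ## Single-tape Turing machines and their descriptions -/

/-- One transition of a single-tape Turing machine: in state `q`, reading `a`, write `b`,
move in direction `dir` (`0` is left, `1` is right, anything else is stay), enter state `q'`. -/
structure Rule where
  q : ℕ
  a : ℕ
  q' : ℕ
  b : ℕ
  dir : ℕ

/-- A single-tape Turing machine is a finite transition table, whose first applicable entry is used.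
States are natural numbers with start state `0`; tape symbols are natural numbers, where `0` is the
blank, `1` and `2` are the bits `0` and `1`, and the others are work symbols. The machine halts
when no entry applies. -/
abbrev Machine := List Rule

/-- Configuration with a two-way infinite tape: `left` (nearest cell first), the scanned cell
`head`, and `right`; all cells not listed are blank. -/
structure Cfg where
  state : ℕ
  left : List ℕ
  head : ℕ
  right : List ℕ

def bitSymbol (b : Bool) : ℕ := if b then 2 else 1

/-- The input is written on the tape with the head on its first symbol. -/
def Cfg.init (w : List Bool) : Cfg :=
  ⟨0, [], (w.map bitSymbol).headD 0, (w.map bitSymbol).tail⟩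

/-- The output is the maximal block of bits that starts at the head. -/
def Cfg.output (c : Cfg) : List Bool :=
  ((c.head :: c.right).takeWhile fun s => s = 1 ∨ s = 2).map fun s => decide (s = 2)

/-- Writing a symbol, moving, and changing the state. -/
def Cfg.apply (c : Cfg) (r : Rule) : Cfg :=
  if r.dir = 0 then ⟨r.q', c.left.tail, c.left.headD 0, r.b :: c.right⟩
  else if r.dir = 1 then ⟨r.q', r.b :: c.left, c.right.headD 0, c.right.tail⟩
  else ⟨r.q', c.left, r.b, c.right⟩

/-- One step; `none` if the machine has halted. -/
def step (M : Machine) (c : Cfg) : Option Cfg :=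
  (M.find? fun r => r.q = c.state ∧ r.a = c.head).map c.apply

/-- `some` of the output of `M(w)` if `M` halts on `w` within `t` steps, otherwise `none`. -/
def runFor (M : Machine) (w : List Bool) (t : ℕ) : Option (List Bool) :=
  let c := (fun c => (step M c).getD c)^[t] (Cfg.init w)
  if (step M c).isNone then some c.output else none

/-- The unary self-delimiting code `1ᵏ0` of a natural number. -/
def unary (k : ℕ) : List Bool := List.replicate k true ++ [false]

def readUnary : List Bool → Option (ℕ × List Bool)
  | [] => none
  | false :: l => some (0, l)
  | true :: l => (readUnary l).map fun p => (p.1 + 1, p.2)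

def encodeRule (r : Rule) : List Bool :=
  unary r.q ++ unary r.a ++ unary r.q' ++ unary r.b ++ unary r.dir

def readRule (l : List Bool) : Option (Rule × List Bool) := do
  let (q, l) ← readUnary l
  let (a, l) ← readUnary l
  let (q', l) ← readUnary l
  let (b, l) ← readUnary l
  let (d, l) ← readUnary l
  return (⟨q, a, q', b, d⟩, l)

def readRules : ℕ → List Bool → Option (Machine × List Bool)
  | 0, l => some ([], l)
  | k + 1, l => do
    let (r, l) ← readRule l
    let (M, l) ← readRules k l
    return (r :: M, l)

/-- The description of the pair `(M, w)`: the number of entries of the table of `M`, the entries,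
and then `w` verbatim. -/
def encodeDesc (M : Machine) (w : List Bool) : List Bool :=
  unary M.length ++ M.flatMap encodeRule ++ w

/-- The pair `(M, w)` that a bit string describes, if any. -/
def decodeDesc (l : List Bool) : Option (Machine × List Bool) :=
  (readUnary l).bind fun p => readRules p.1 p.2

theorem readUnary_unary (k : ℕ) (l : List Bool) : readUnary (unary k ++ l) = some (k, l) := by
  induction k with
  | zero => rfl
  | succ k ih =>
    have h : unary (k + 1) ++ l = true :: (unary k ++ l) := rfl
    rw [h, readUnary, ih]
    rfl

theorem readRule_encodeRule (r : Rule) (l : List Bool) :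
    readRule (encodeRule r ++ l) = some (r, l) := by
  simp [readRule, encodeRule, readUnary_unary, List.append_assoc]

theorem readRules_flatMap (M : Machine) (l : List Bool) :
    readRules M.length (M.flatMap encodeRule ++ l) = some (M, l) := by
  induction M with
  | nil => rfl
  | cons r M ih => simp [readRules, readRule_encodeRule, List.append_assoc, ih]

/-- Every pair of a machine and an input has a description. -/
theorem decodeDesc_encodeDesc (M : Machine) (w : List Bool) :
    decodeDesc (encodeDesc M w) = some (M, w) := by
  simp [decodeDesc, encodeDesc, readUnary_unary, List.append_assoc, readRules_flatMap]

/-- The universal machine: `U D t` is the output of `M(w)` run for `t` steps, where `D` describes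
`(M, w)`; it is `none` if `D` describes no pair or if `M(w)` does not halt within `t` steps. -/
def U (D : List Bool) (t : ℕ) : Option (List Bool) :=
  (decodeDesc D).bind fun p => runFor p.1 p.2 t

/-- `t`-time-bounded Kolmogorov complexity. -/
noncomputable def Kt (t : ℕ → ℕ) (x : List Bool) : ℕ :=
  sInf {k | ∃ D : List Bool, D.length = k ∧ U D (t x.length) = some x}

/-- The machine with empty table outputs its input. -/
theorem U_false_cons (x : List Bool) (t : ℕ) : U (false :: x) t = some x := by
  have hstep : ∀ c, step [] c = none := fun c => rfl
  have hit : (fun c => (step [] c).getD c)^[t] (Cfg.init x) = Cfg.init x := by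
    have : (fun c => (step [] c).getD c) = id := by funext c; simp [hstep]
    rw [this, Function.iterate_id]; rfl
  have hout : (Cfg.init x).output = x := by
    cases x with
    | nil => rfl
    | cons b x =>
      have h : ∀ s ∈ (b :: x).map bitSymbol, decide (s = 1 ∨ s = 2) = true := by
        intro s hs
        obtain ⟨b, -, rfl⟩ := List.mem_map.1 hs
        cases b <;> rfl
      have e : (Cfg.init (b :: x)).output =
          (((b :: x).map bitSymbol).takeWhile fun s => s = 1 ∨ s = 2).map
            fun s => decide (s = 2) := rfl
      rw [e, List.takeWhile_eq_self_iff.2 h, List.map_map]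
      have : ((fun s => decide (s = 2)) ∘ bitSymbol) = id := by funext b; cases b <;> rfl
      rw [this, List.map_id]
  have e : U (false :: x) t =
      if (step [] ((fun c => (step [] c).getD c)^[t] (Cfg.init x))).isNone then
        some ((fun c => (step [] c).getD c)^[t] (Cfg.init x)).output else none := rfl
  rw [e, hit, hout]
  rfl

/-- The set whose minimum is `Kt t x` is never empty, and `Kt t x ≤ |x| + 1`. -/
theorem Kt_le (t : ℕ → ℕ) (x : List Bool) : Kt t x ≤ x.length + 1 :=
  Nat.sInf_le ⟨false :: x, rfl, U_false_cons x _⟩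

/-! ## Polynomial-time and probabilistic polynomial-time algorithms -/

/-- `f : {0,1}* → {0,1}*` is computable in polynomial time. -/
def PolyTime (f : List Bool → List Bool) : Prop :=
  Nonempty (Turing.TM2ComputableInPolyTime (id : List Bool → List Bool)
    (id : List Bool → List Bool) f)

/-- An input together with a random tape, as one word in which the two parts are marked. -/
def withTape (p : List Bool × List Bool) : List (Bool ⊕ Bool) :=
  p.1.map Sum.inl ++ p.2.map Sum.inr

/-- A probabilistic polynomial-time algorithm: a polynomial-time machine that is given, besides its
input `x`, a tape with `coins(|x|)` random bits, for a polynomial `coins`. -/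
structure PPT where
  coins : Polynomial ℕ
  run : List Bool × List Bool → List Bool
  polyTime : Nonempty (Turing.TM2ComputableInPolyTime withTape (id : List Bool → List Bool) run)

/-- The average of `g` over the uniform distribution on `{0,1}ⁿ`. -/
noncomputable def avg (n : ℕ) (g : List Bool → ℝ) : ℝ :=
  (∑ x : Fin n → Bool, g (List.ofFn x)) / 2 ^ n

open Classical in
/-- The probability, over the random tape, that `A(x) ∈ S`. -/
noncomputable def PPT.prob (A : PPT) (x : List Bool) (S : Set (List Bool)) : ℝ :=
  avg (A.coins.eval x.length) fun r => if A.run (x, r) ∈ S then 1 else 0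

/-- `f` is `α`-hard-on-average. -/
def IsHardOnAverage (α : ℕ → ℝ) (f : List Bool → List Bool) : Prop :=
  ∀ H : PPT, ∀ᶠ n in Filter.atTop, avg n (fun x => H.prob x {f x}) < 1 - α n

/-! ## One-way functions -/

/-- The pair `(1ⁿ, y)` as a bit string. -/
def withSecurity (n : ℕ) (y : List Bool) : List Bool := unary n ++ y

/-- `Pr[x ← {0,1}ⁿ; y = f(x) : A(1ⁿ, y) ∈ f⁻¹(f(x))]`. -/
noncomputable def invProb (f : List Bool → List Bool) (A : PPT) (n : ℕ) : ℝ :=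
  avg n fun x => A.prob (withSecurity n (f x)) (f ⁻¹' {f x})

/-- `f` is a one-way function. -/
def IsOWF (f : List Bool → List Bool) : Prop :=
  PolyTime f ∧ ∀ A : PPT, ∃ μ : ℕ → ℝ,
    Asymptotics.SuperpolynomialDecay Filter.atTop (fun n : ℕ => (n : ℝ)) μ ∧
    ∀ n, invProb f A n ≤ μ n

/-- `f` is a weak one-way function: for some positive polynomial `s`, it is a `1/s`-weak one. -/
def IsWeakOWF (f : List Bool → List Bool) : Prop :=
  PolyTime f ∧ ∃ s : Polynomial ℕ, (∀ n, 0 < s.eval n) ∧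
    ∀ A : PPT, ∀ᶠ n in Filter.atTop, invProb f A n < 1 - 1 / ((s.eval n : ℕ) : ℝ)

/-- Weak one-wayness of a family of functions `f n : {0,1}^(m n) → {0,1}*`: it is uniformly
computable in polynomial time, and for some positive polynomial `s` every PPT algorithm, given
`1^(m n)` and `f n x` for uniform `x`, finds a preimage in the domain of `f n` with probability
less than `1 - 1/s(n)` for all sufficiently large `n`. -/
def IsWeakOWFFamily (m : ℕ → ℕ) (f : ℕ → List Bool → List Bool) : Prop :=
  (∃ g : List Bool → List Bool, PolyTime g ∧ ∀ n x, x.length = m n → g (unary n ++ x) = f n x) ∧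
  ∃ s : Polynomial ℕ, (∀ n, 0 < s.eval n) ∧
    ∀ A : PPT, ∀ᶠ n in Filter.atTop,
      avg (m n) (fun x => A.prob (withSecurity (m n) (f n x))
        {x' | x'.length = m n ∧ f n x' = f n x}) < 1 - 1 / ((s.eval n : ℕ) : ℝ)

/-! ## The candidate weak one-way function -/

/-- Length `⌈log₂(n+c)⌉ + n + c` of the inputs `ℓ || Π'`. -/
def ktLength (c n : ℕ) : ℕ := Nat.clog 2 (n + c) + (n + c)

/-- The number in `{1, …, 2ᵏ}` that a string of `k` bits (least significant first) stands for. -/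
def indexOf (l : List Bool) : ℕ := Nat.ofDigits 2 (l.map Bool.toNat) + 1

/-- `ℓ || Π' ↦ ℓ || U(Π, 1^(t(n)))`, where `Π` is the `ℓ`-bit prefix of `Π'`, and the output of
`U` is read as the empty string when there is none. -/
def ktFun (t : ℕ → ℕ) (c n : ℕ) (x : List Bool) : List Bool :=
  let k := Nat.clog 2 (n + c)
  let l := x.take k
  let D := (x.drop k).take (indexOf l)
  l ++ (U D (t n)).getD []

end KOWF

open KOWF

/-! An inverter `A` of the family yields an algorithm for `K^t`. On `x` of length `n`, ask `A` for a
preimage of `ℓ‖x` for every `ℓ ≤ n + c`, check each answer by evaluating `f_n`, and output the least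
`ℓ` that passes. A checked answer contains a description of `x` of length at most `ℓ`, so no `ℓ <
K^t(x)` passes (`Kt_le_of_ktFun_eq`), and the output is right as soon as `A` succeeds on `K^t(x)‖x`.
That query has a preimage, a shortest description of `x` padded to length `n + c`
(`exists_preimage`), and different `x` have different preimages. Hence `2^n` times the failure
probability of the algorithm is at most `2^(m(n))` times that of `A` (`one_sub_prob_ktSolver_le`).
The loss `2^(k(n)+c)` is linear in `n`, so an inverter that fails too rarely contradicts the
hardness of `K^t`.

For a single function, the domain lengths with `c = 1` grow by at most 2 at a time, so every length
`N` exceeds one of them by 0 or 1; `ktSingle` ignores the surplus bit and also outputs the length of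
its input (`isWeakOWF_ktSingle`).

The one-way function is Yao's direct product of `m = 2·n·s(n)` copies of a `1/s`-weak one. If `B`
inverts the product with probability `ε`, call `x` bad when planting `f(x)` at any position leaves
`B` a success probability below `ε/(2m)`. Positions with bad blocks contribute at most `ε/2` to the
success of `B`, and all blocks are good with probability `(1 - Pr[bad])^m`, which is negligible if
`Pr[bad] > 1/(2s)` (`avg_le_of_blocks`). So most `x` are good, and repeated planting inverts `f` too
often (`invProb_product_le`).

Polynomial time means a multi-stack machine, so every algorithm above must be realised by one.
`PTime.comp`, `PTime.pair`, `PTime.loop` and `PTime.transduce` build such machines once and for all.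
On top of them, data are coded as binary trees, and `PF` is a calculus of polynomial-time functions
between coded types with bounded folds. Its main products are the emulation of the universal machine
(`PF.U`) and the evaluation of `t` (`pf_of_polynomial`). -/

namespace KOWF

open Turing Turing.TM2 Function

/-! ### Runs of stack machines with explicit step counts -/

section Steps

variable {K : Type} [DecidableEq K] {Γ : K → Type} {Λ σ : Type}

/-- `Steps m n c c'`: the machine `m` goes from `c` to `c'` in exactly `n` steps. -/
def Steps (m : Λ → Stmt Γ Λ σ) (n : ℕ) (c c' : TM2.Cfg Γ Λ σ) : Prop :=
  (flip bind (TM2.step m))^[n] (some c) = some c'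

/-- `Within m n c c'`: the machine `m` goes from `c` to `c'` in at most `n` steps. -/
def Within (m : Λ → Stmt Γ Λ σ) (n : ℕ) (c c' : TM2.Cfg Γ Λ σ) : Prop :=
  ∃ k ≤ n, Steps m k c c'

theorem Steps.trans {m : Λ → Stmt Γ Λ σ} {a b : ℕ} {c₁ c₂ c₃ : TM2.Cfg Γ Λ σ}
    (h₁ : Steps m a c₁ c₂) (h₂ : Steps m b c₂ c₃) : Steps m (b + a) c₁ c₃ := by
  unfold Steps at *
  rw [iterate_add_apply, h₁, h₂]

theorem iterate_bind_none {m : Λ → Stmt Γ Λ σ} (n : ℕ) :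
    (flip bind (TM2.step m))^[n] none = none := by
  induction n with
  | zero => rfl
  | succ n ih => rw [iterate_succ_apply]; exact ih

theorem Steps.succ_iff {m : Λ → Stmt Γ Λ σ} {n : ℕ} {l : Λ} {v : σ} {S : ∀ k, List (Γ k)}
    {c : TM2.Cfg Γ Λ σ} :
    Steps m (n + 1) ⟨some l, v, S⟩ c ↔ Steps m n (stepAux (m l) v S) c := by
  unfold Steps
  rw [iterate_succ_apply]
  rfl

/-- Steps are counted exactly and a halted configuration has no successor, so halting can only
happen at the last step of a run. -/
theorem Steps.none_succ {m : Λ → Stmt Γ Λ σ} {n : ℕ} {v : σ} {S : ∀ k, List (Γ k)}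
    {c : TM2.Cfg Γ Λ σ} : ¬ Steps m (n + 1) ⟨none, v, S⟩ c := by
  unfold Steps
  rw [iterate_succ_apply]
  change (flip bind (TM2.step m))^[n] none ≠ _
  rw [iterate_bind_none]
  simp

theorem Within.refl {m : Λ → Stmt Γ Λ σ} (c : TM2.Cfg Γ Λ σ) : Within m 0 c c :=
  ⟨0, le_rfl, rfl⟩

theorem Within.trans {m : Λ → Stmt Γ Λ σ} {a b : ℕ} {c₁ c₂ c₃ : TM2.Cfg Γ Λ σ}
    (h₁ : Within m a c₁ c₂) (h₂ : Within m b c₂ c₃) : Within m (a + b) c₁ c₃ := by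
  obtain ⟨k, hk, h⟩ := h₁
  obtain ⟨k', hk', h'⟩ := h₂
  exact ⟨k' + k, by omega, h.trans h'⟩

theorem Within.mono {m : Λ → Stmt Γ Λ σ} {a b : ℕ} {c₁ c₂ : TM2.Cfg Γ Λ σ}
    (h₁ : Within m a c₁ c₂) (h : a ≤ b) : Within m b c₁ c₂ := by
  obtain ⟨k, hk, h'⟩ := h₁
  exact ⟨k, by omega, h'⟩

theorem Within.one {m : Λ → Stmt Γ Λ σ} (l : Λ) (v : σ) (S : ∀ k, List (Γ k)) :
    Within m 1 ⟨some l, v, S⟩ (stepAux (m l) v S) := ⟨1, le_rfl, rfl⟩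

theorem Within.step {m : Λ → Stmt Γ Λ σ} {l : Λ} {v : σ} {S : ∀ k, List (Γ k)}
    {n : ℕ} {c : TM2.Cfg Γ Λ σ} (h : Within m n (stepAux (m l) v S) c) :
    Within m (n + 1) ⟨some l, v, S⟩ c := by
  rw [add_comm]
  exact (Within.one l v S).trans h

/-! ### Growth of the stacks -/

/-- The number of `push` instructions in a statement. -/
def pushes : Stmt Γ Λ σ → ℕ
  | .push _ _ q => pushes q + 1
  | .peek _ _ q => pushes q
  | .pop _ _ q => pushes q
  | .load _ q => pushes q
  | .branch _ q₁ q₂ => pushes q₁ + pushes q₂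
  | .goto _ => 0
  | .halt => 0

/-- One step executes a whole statement, but it meets each `push` of the syntax tree at most once.
-/
theorem length_stepAux_le (q : Stmt Γ Λ σ) (v : σ) (S : ∀ k, List (Γ k)) (k : K) :
    ((stepAux q v S).stk k).length ≤ (S k).length + pushes q := by
  induction q generalizing v S with
  | push k' f q ih =>
    refine (ih _ _).trans ?_
    simp only [pushes]
    by_cases h : k = k'
    · subst h; simp; omega
    · simp [h]
  | peek k' f q ih => exact ih _ _
  | pop k' f q ih =>
    refine (ih _ _).trans ?_
    simp only [pushes]
    by_cases h : k = k'
    · subst h; simp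
    · simp [h]
  | load f q ih => exact ih _ _
  | branch f q₁ q₂ ih₁ ih₂ =>
    simp only [stepAux, pushes]
    cases f v
    · exact (ih₂ _ _).trans (by omega)
    · exact (ih₁ _ _).trans (by omega)
  | goto f => simp [stepAux]
  | halt => simp [stepAux]

/-- This turns a time bound into a bound on the output, which composition needs. -/
theorem Steps.length_le {m : Λ → Stmt Γ Λ σ} {c : ℕ} (hc : ∀ l, pushes (m l) ≤ c) {n : ℕ}
    {c₁ c₂ : TM2.Cfg Γ Λ σ} (h : Steps m n c₁ c₂) (k : K) :
    (c₂.stk k).length ≤ (c₁.stk k).length + c * n := by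
  induction n generalizing c₁ with
  | zero =>
    obtain rfl : c₁ = c₂ := by simpa [Steps] using h
    simp
  | succ n ih =>
    obtain ⟨l, v, S⟩ := c₁
    cases l with
    | none => exact absurd h Steps.none_succ
    | some l =>
      have h₁ := ih (Steps.succ_iff.1 h)
      have h₂ := length_stepAux_le (m l) v S k
      have h₃ := hc l
      simp only at *
      rw [Nat.mul_succ]
      omega

end Steps

/-! ### Embedding one machine into another -/

section Lift

variable {K K' : Type} [DecidableEq K] [DecidableEq K'] {Γ' : K' → Type} {Λ Λ' σ σ' : Type}

/-- A statement of a machine as a statement of a bigger one, with `e` in place of `halt`. -/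
def liftStmt (ι : K → K') (get : σ' → σ) (put : σ' → σ → σ') (φ : Λ → Λ')
    (e : Stmt Γ' Λ' σ') : Stmt (fun k => Γ' (ι k)) Λ σ → Stmt Γ' Λ' σ'
  | .push k f q => .push (ι k) (fun s => f (get s)) (liftStmt ι get put φ e q)
  | .peek k f q => .peek (ι k) (fun s a => put s (f (get s) a)) (liftStmt ι get put φ e q)
  | .pop k f q => .pop (ι k) (fun s a => put s (f (get s) a)) (liftStmt ι get put φ e q)
  | .load f q => .load (fun s => put s (f (get s))) (liftStmt ι get put φ e q)
  | .branch f q₁ q₂ => .branch (fun s => f (get s)) (liftStmt ι get put φ e q₁)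
      (liftStmt ι get put φ e q₂)
  | .goto f => .goto (fun s => φ (f (get s)))
  | .halt => e

variable {ι : K → K'} {get : σ' → σ} {put : σ' → σ → σ'} {φ : Λ → Λ'} {e : Stmt Γ' Λ' σ'}
  {eσ : σ → σ'} {emb : (∀ k, List (Γ' (ι k))) → ∀ k, List (Γ' k)}

/-- The maps `eσ` and `emb` insert the state and the stacks of the small machine while all other
data stay frozen; `hput` and `hupd` say that its writes respect this. The continuation `e` runs
within the step that would have halted. -/
theorem stepAux_liftStmt (hget : ∀ v, get (eσ v) = v) (hput : ∀ v w, put (eσ v) w = eσ w)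
    (hemb : ∀ S k, emb S (ι k) = S k)
    (hupd : ∀ S k x, update (emb S) (ι k) x = emb (update S k x))
    (q : Stmt (fun k => Γ' (ι k)) Λ σ) (v : σ) (S : ∀ k, List (Γ' (ι k))) :
    stepAux (liftStmt ι get put φ e q) (eσ v) (emb S) =
      match stepAux q v S with
      | ⟨some l, v', S'⟩ => ⟨some (φ l), eσ v', emb S'⟩
      | ⟨none, v', S'⟩ => stepAux e (eσ v') (emb S') := by
  induction q generalizing v S with
  | push k f q ih => simp only [liftStmt, stepAux, hget, hemb, hupd, ih]
  | peek k f q ih => simp only [liftStmt, stepAux, hget, hput, hemb, ih]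
  | pop k f q ih => simp only [liftStmt, stepAux, hget, hput, hemb, hupd, ih]
  | load f q ih => simp only [liftStmt, stepAux, hget, hput, ih]
  | branch f q₁ q₂ ih₁ ih₂ =>
    simp only [liftStmt, stepAux, hget]
    cases f v
    · exact ih₂ v S
    · exact ih₁ v S
  | goto f => simp only [liftStmt, stepAux, hget]
  | halt => simp only [liftStmt, stepAux]

/-- A subroutine costs no extra step, since its exit `e` replaces `halt` inside a statement. -/
theorem Within.lift {m : Λ → Stmt (fun k => Γ' (ι k)) Λ σ} {m' : Λ' → Stmt Γ' Λ' σ'}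
    (hget : ∀ v, get (eσ v) = v) (hput : ∀ v w, put (eσ v) w = eσ w)
    (hemb : ∀ S k, emb S (ι k) = S k)
    (hupd : ∀ S k x, update (emb S) (ι k) x = emb (update S k x))
    (hm : ∀ l, m' (φ l) = liftStmt ι get put φ e (m l)) {n : ℕ} {l : Λ} {v v' : σ}
    {S S' : ∀ k, List (Γ' (ι k))} (h : Within m n ⟨some l, v, S⟩ ⟨none, v', S'⟩) :
    Within m' n ⟨some (φ l), eσ v, emb S⟩ (stepAux e (eσ v') (emb S')) := by
  obtain ⟨k, hk, h⟩ := h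
  refine ⟨k, hk, ?_⟩
  clear hk
  induction k generalizing l v S with
  | zero => simp [Steps] at h
  | succ k ih =>
    rw [Steps.succ_iff] at h ⊢
    rw [hm, stepAux_liftStmt hget hput hemb hupd]
    rcases hc : stepAux (m l) v S with ⟨_ | l₁, v₁, S₁⟩
    · rw [hc] at h
      cases k with
      | zero =>
        have h' : (⟨none, v₁, S₁⟩ : TM2.Cfg _ Λ σ) = ⟨none, v', S'⟩ := by simpa [Steps] using h
        cases h'
        rfl
      | succ k => exact absurd h Steps.none_succ
    · rw [hc] at h
      exact ih h

end Lift

/-! ### Moving the contents of stacks -/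

section Move

variable {K : Type} [DecidableEq K] {Γ : K → Type} {Λ σ X : Type}

/-- Move the contents of stack `k₁` to stack `k₂`, one symbol per step, then go to `l'`. -/
def moveStmt (k₁ k₂ : K) (get : σ → Option X) (put : σ → Option X → σ) (d : X)
    (f : Γ k₁ → X) (g : X → Γ k₂) (l l' : Λ) : Stmt Γ Λ σ :=
  .pop k₁ (fun s a => put s (a.map f))
    (.branch (fun s => (get s).isSome)
      (.push k₂ (fun s => g ((get s).getD d)) (.goto fun _ => l))
      (.goto fun _ => l'))

/-- The additional step is the one that finds `k₁` empty. Moving reverses the contents, which is why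
the machines below move everything twice. -/
theorem within_moveStmt {m : Λ → Stmt Γ Λ σ} {k₁ k₂ : K} (hk : k₁ ≠ k₂) {get : σ → Option X}
    {put : σ → Option X → σ} {d : X} {f : Γ k₁ → X} {g : X → Γ k₂} {l l' : Λ}
    (hm : m l = moveStmt k₁ k₂ get put d f g l l') (hget : ∀ s o, get (put s o) = o)
    (hput : ∀ s o o', put (put s o) o' = put s o') (v : σ) (L : List (Γ k₁))
    (S : ∀ k, List (Γ k)) (hL : S k₁ = L) :
    Within m (L.length + 1) ⟨some l, v, S⟩
      ⟨some l', put v none, update (update S k₁ []) k₂ ((L.map (g ∘ f)).reverse ++ S k₂)⟩ := by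
  induction L generalizing v S with
  | nil =>
    refine Within.step ?_
    rw [hm]
    simp only [moveStmt, stepAux, hL, hget]
    have : update (update S k₁ []) k₂ (S k₂) = update S k₁ [] := by
      rw [update_eq_self_iff, update_of_ne hk.symm]
    simpa [this] using Within.refl _
  | cons a L ih =>
    refine Within.step ?_
    rw [hm]
    simp only [moveStmt, stepAux, hL, hget, List.head?_cons, Option.map_some, Option.isSome_some,
      cond_true, List.tail_cons, Option.getD_some]
    have h := ih (put v (some (f a)))
      (update (update S k₁ L) k₂ (g (f a) :: update S k₁ L k₂)) (by simp [hk])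
    rw [hput] at h
    rw [List.length_cons]
    convert h using 2
    funext k
    by_cases h₂ : k = k₂
    · subst h₂; simp [hk.symm]
    · by_cases h₁ : k = k₁
      · subst h₁; simp [hk]
      · simp [h₁, h₂]

theorem within_move {m : Λ → Stmt Γ Λ σ} {l l' : Λ} (k₁ k₂ : K) {get : σ → Option X}
    {put : σ → Option X → σ} {d : X} {f : Γ k₁ → X} {g : X → Γ k₂}
    (hm : m l = moveStmt k₁ k₂ get put d f g l l') (hk : k₁ ≠ k₂) (hget : ∀ s o, get (put s o) = o)
    (hput : ∀ s o o', put (put s o) o' = put s o') (v : σ) (S : ∀ k, List (Γ k)) :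
    Within m ((S k₁).length + 1) ⟨some l, v, S⟩
      ⟨some l', put v none,
        update (update S k₁ []) k₂ (((S k₁).map (g ∘ f)).reverse ++ S k₂)⟩ :=
  within_moveStmt hk hm hget hput v _ S rfl

/-- Move the contents of stack `k₁` to the stacks `k₂` and `k₃`, then go to `l'`. -/
def moveStmt₂ (k₁ k₂ k₃ : K) (get : σ → Option X) (put : σ → Option X → σ) (d : X)
    (f : Γ k₁ → X) (g : X → Γ k₂) (g' : X → Γ k₃) (l l' : Λ) : Stmt Γ Λ σ :=
  .pop k₁ (fun s a => put s (a.map f))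
    (.branch (fun s => (get s).isSome)
      (.push k₂ (fun s => g ((get s).getD d)) (.push k₃ (fun s => g' ((get s).getD d))
        (.goto fun _ => l)))
      (.goto fun _ => l'))

theorem within_moveStmt₂ {m : Λ → Stmt Γ Λ σ} {k₁ k₂ k₃ : K} (hk : k₁ ≠ k₂) (hk' : k₁ ≠ k₃)
    (hk'' : k₂ ≠ k₃) {get : σ → Option X}
    {put : σ → Option X → σ} {d : X} {f : Γ k₁ → X} {g : X → Γ k₂} {g' : X → Γ k₃} {l l' : Λ}
    (hm : m l = moveStmt₂ k₁ k₂ k₃ get put d f g g' l l') (hget : ∀ s o, get (put s o) = o)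
    (hput : ∀ s o o', put (put s o) o' = put s o') (v : σ) (L : List (Γ k₁))
    (S : ∀ k, List (Γ k)) (hL : S k₁ = L) :
    Within m (L.length + 1) ⟨some l, v, S⟩
      ⟨some l', put v none, update (update (update S k₁ []) k₂
        ((L.map (g ∘ f)).reverse ++ S k₂)) k₃ ((L.map (g' ∘ f)).reverse ++ S k₃)⟩ := by
  induction L generalizing v S with
  | nil =>
    refine Within.step ?_
    rw [hm]
    simp only [moveStmt₂, stepAux, hL, hget]
    have : update (update (update S k₁ []) k₂ (S k₂)) k₃ (S k₃) = update S k₁ [] := by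
      have h₂ : update (update S k₁ []) k₂ (S k₂) = update S k₁ [] := by
        rw [update_eq_self_iff, update_of_ne hk.symm]
      rw [h₂, update_eq_self_iff, update_of_ne hk'.symm]
    simpa [this] using Within.refl _
  | cons a L ih =>
    refine Within.step ?_
    rw [hm]
    simp only [moveStmt₂, stepAux, hL, hget, List.head?_cons, Option.map_some, Option.isSome_some,
      cond_true, List.tail_cons, Option.getD_some]
    have h := ih (put v (some (f a)))
      (update (update (update S k₁ L) k₂ (g (f a) :: update S k₁ L k₂)) k₃
        (g' (f a) :: update (update S k₁ L) k₂ (g (f a) :: update S k₁ L k₂) k₃))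
      (by simp [hk, hk'])
    rw [hput] at h
    rw [List.length_cons]
    convert h using 2
    funext k
    by_cases h₂ : k = k₂
    · subst h₂; simp [hk.symm, hk'']
    · by_cases h₁ : k = k₁
      · subst h₁; simp [hk, hk']
      · by_cases h₃ : k = k₃
        · subst h₃; simp [hk'.symm, hk''.symm]
        · simp [h₁, h₂, h₃]

theorem within_move₂ {m : Λ → Stmt Γ Λ σ} {l l' : Λ} (k₁ k₂ k₃ : K) {get : σ → Option X}
    {put : σ → Option X → σ} {d : X} {f : Γ k₁ → X} {g : X → Γ k₂} {g' : X → Γ k₃}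
    (hm : m l = moveStmt₂ k₁ k₂ k₃ get put d f g g' l l') (hk : k₁ ≠ k₂) (hk' : k₁ ≠ k₃)
    (hk'' : k₂ ≠ k₃) (hget : ∀ s o, get (put s o) = o)
    (hput : ∀ s o o', put (put s o) o' = put s o') (v : σ) (S : ∀ k, List (Γ k)) :
    Within m ((S k₁).length + 1) ⟨some l, v, S⟩
      ⟨some l', put v none, update (update (update S k₁ []) k₂
        (((S k₁).map (g ∘ f)).reverse ++ S k₂)) k₃ (((S k₁).map (g' ∘ f)).reverse ++ S k₃)⟩ :=
  within_moveStmt₂ hk hk' hk'' hm hget hput v _ S rfl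

end Move

end KOWF

namespace KOWF

open Turing Turing.TM2 Function

theorem eval_mono (P : Polynomial ℕ) : Monotone fun n => P.eval n := by
  intro a b h
  simp only [Polynomial.eval_eq_sum_range]
  gcongr

/-! ### Closure of polynomial-time computability under composition, pairing and loops -/

/-- Polynomial-time computability with respect to encodings of inputs and outputs. -/
def PTime {α β A B : Type} (ea : α → List A) (eb : β → List B) (f : α → β) : Prop :=
  Nonempty (TM2ComputableInPolyTime ea eb f)

theorem initList_eq (tm : FinTM2) (s : List (tm.Γ tm.k₀)) :
    initList tm s = ⟨some tm.main, tm.initialState, update (fun _ => []) tm.k₀ s⟩ := by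
  unfold initList
  congr 1
  funext k
  by_cases h : k = tm.k₀
  · subst h; simp
  · simp [h]

theorem haltList_eq (tm : FinTM2) (s : List (tm.Γ tm.k₁)) :
    haltList tm s = ⟨none, tm.initialState, update (fun _ => []) tm.k₁ s⟩ := by
  unfold haltList
  congr 1
  funext k
  by_cases h : k = tm.k₁
  · subst h; simp
  · simp [h]

theorem PTime.exists_machine {α β A B : Type} {ea : α → List A} {eb : β → List B} {f : α → β}
    (h : PTime ea eb f) : ∃ (tm : FinTM2) (e₀ : tm.Γ tm.k₀ ≃ A) (e₁ : tm.Γ tm.k₁ ≃ B)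
      (T : Polynomial ℕ), ∀ a, Within tm.m (T.eval (ea a).length)
        ⟨some tm.main, tm.initialState, update (fun _ => []) tm.k₀ ((ea a).map e₀.symm)⟩
        ⟨none, tm.initialState, update (fun _ => []) tm.k₁ ((eb (f a)).map e₁.symm)⟩ := by
  obtain ⟨M⟩ := h
  refine ⟨M.tm, M.inputAlphabet, M.outputAlphabet, M.time, fun a => ?_⟩
  have h := M.outputsFun a
  refine ⟨h.steps, h.steps_le_m, ?_⟩
  rw [← initList_eq, ← haltList_eq]
  exact h.evals_in_steps

/-- A run has to end in the initial internal state with all stacks but the output empty. Every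
machine below therefore cleans up, and in return can be restarted as a subroutine. -/
theorem PTime.of_machine {α β A B : Type} {ea : α → List A} {eb : β → List B} {f : α → β}
    {K Λ σ : Type} [DecidableEq K] [Fintype K] [Fintype Λ] [Fintype σ] {Γ : K → Type}
    (m : Λ → Stmt Γ Λ σ) (k₀ k₁ : K) [Fintype (Γ k₀)] (l₀ : Λ) (v₀ : σ) (e₀ : Γ k₀ ≃ A)
    (e₁ : Γ k₁ ≃ B) (T : Polynomial ℕ)
    (h : ∀ a, Within m (T.eval (ea a).length)
        ⟨some l₀, v₀, update (fun _ => []) k₀ ((ea a).map e₀.symm)⟩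
        ⟨none, v₀, update (fun _ => []) k₁ ((eb (f a)).map e₁.symm)⟩) :
    PTime ea eb f := by
  refine ⟨⟨⟨⟨k₀, k₁, Γ, Λ, l₀, σ, v₀, m⟩, e₀, e₁⟩, T, fun a => ?_⟩⟩
  refine ⟨⟨(h a).choose, ?_⟩, (h a).choose_spec.1⟩
  have := (h a).choose_spec.2
  rw [initList_eq]
  simp only [Option.map_some, haltList_eq]
  exact this

theorem PTime.length_le {α β A B : Type} {ea : α → List A} {eb : β → List B} {f : α → β}
    (h : PTime ea eb f) : ∃ P : Polynomial ℕ, ∀ a, (eb (f a)).length ≤ P.eval (ea a).length := by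
  obtain ⟨tm, e₀, e₁, T, h⟩ := h.exists_machine
  have := tm.ΛFin
  obtain ⟨c, hc⟩ : ∃ c, ∀ l, pushes (tm.m l) ≤ c :=
    ⟨∑ l, pushes (tm.m l), fun l => Finset.single_le_sum (f := fun l => pushes (tm.m l))
      (fun _ _ => Nat.zero_le _) (Finset.mem_univ l)⟩
  -- The summand `X` covers machines whose output stack is the input stack.
  refine ⟨Polynomial.X + Polynomial.C c * T, fun a => ?_⟩
  obtain ⟨k, hk, h⟩ := h a
  have := h.length_le hc tm.k₁
  simp only [update_self, List.length_map] at this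
  refine this.trans ?_
  simp only [Polynomial.eval_add, Polynomial.eval_X, Polynomial.eval_mul, Polynomial.eval_C]
  refine add_le_add ?_ (Nat.mul_le_mul_left _ hk)
  by_cases h : tm.k₁ = tm.k₀
  · rw [h]; simp
  · simp [h]

/-! ### Stacks of machines composed of three parts -/

section Stacks

variable {K₁ K₂ K₃ : Type} {Γ₁ : K₁ → Type} {Γ₂ : K₂ → Type} {Γ₃ : K₃ → Type}

/-- The stack alphabets of a machine made of three parts. -/
@[reducible] def sumΓ (Γ₁ : K₁ → Type) (Γ₂ : K₂ → Type) (Γ₃ : K₃ → Type) : K₁ ⊕ K₂ ⊕ K₃ → Type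
  | .inl k => Γ₁ k
  | .inr (.inl k) => Γ₂ k
  | .inr (.inr k) => Γ₃ k

/-- The stacks of a machine made of three parts. -/
def sumStk (S₁ : ∀ k, List (Γ₁ k)) (S₂ : ∀ k, List (Γ₂ k)) (S₃ : ∀ k, List (Γ₃ k)) :
    ∀ k, List (sumΓ Γ₁ Γ₂ Γ₃ k)
  | .inl k => S₁ k
  | .inr (.inl k) => S₂ k
  | .inr (.inr k) => S₃ k

variable [DecidableEq K₁] [DecidableEq K₂] [DecidableEq K₃]

theorem update_sumStk_left (S₁ : ∀ k, List (Γ₁ k)) (S₂ : ∀ k, List (Γ₂ k))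
    (S₃ : ∀ k, List (Γ₃ k)) (k : K₁) (x : List (Γ₁ k)) :
    update (sumStk S₁ S₂ S₃) (.inl k) x = sumStk (update S₁ k x) S₂ S₃ := by
  funext k'
  rcases k' with k' | k' | k'
  · by_cases h : k' = k
    · subst h; exact (update_self ..).trans (show sumStk (update S₁ k' x) S₂ S₃ (.inl k') = x from update_self ..).symm
    · exact (update_of_ne (by simp [h]) ..).trans (update_of_ne h ..).symm
  · exact update_of_ne (by simp) ..
  · exact update_of_ne (by simp) ..

theorem update_sumStk_mid (S₁ : ∀ k, List (Γ₁ k)) (S₂ : ∀ k, List (Γ₂ k))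
    (S₃ : ∀ k, List (Γ₃ k)) (k : K₂) (x : List (Γ₂ k)) :
    update (sumStk S₁ S₂ S₃) (.inr (.inl k)) x = sumStk S₁ (update S₂ k x) S₃ := by
  funext k'
  rcases k' with k' | k' | k'
  · exact update_of_ne (by simp) ..
  · by_cases h : k' = k
    · subst h; exact (update_self ..).trans (show sumStk S₁ (update S₂ k' x) S₃ (.inr (.inl k')) = x from update_self ..).symm
    · exact (update_of_ne (by simp [h]) ..).trans (update_of_ne h ..).symm
  · exact update_of_ne (by simp) ..

theorem update_sumStk_right (S₁ : ∀ k, List (Γ₁ k)) (S₂ : ∀ k, List (Γ₂ k))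
    (S₃ : ∀ k, List (Γ₃ k)) (k : K₃) (x : List (Γ₃ k)) :
    update (sumStk S₁ S₂ S₃) (.inr (.inr k)) x = sumStk S₁ S₂ (update S₃ k x) := by
  funext k'
  rcases k' with k' | k' | k'
  · exact update_of_ne (by simp) ..
  · exact update_of_ne (by simp) ..
  · by_cases h : k' = k
    · subst h; exact (update_self ..).trans (show sumStk S₁ S₂ (update S₃ k' x) (.inr (.inr k')) = x from update_self ..).symm
    · exact (update_of_ne (by simp [h]) ..).trans (update_of_ne h ..).symm

omit [DecidableEq K₁] [DecidableEq K₂] [DecidableEq K₃] in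
theorem sumStk_nil : sumStk (fun k => ([] : List (Γ₁ k))) (fun k => ([] : List (Γ₂ k)))
    (fun k => ([] : List (Γ₃ k))) = fun _ => [] := by
  funext k'
  rcases k' with k' | k' | k' <;> rfl

end Stacks

section Comp

variable {K₁ K₂ Λ₁ Λ₂ σ₁ σ₂ B : Type} {Γ₁ : K₁ → Type} {Γ₂ : K₂ → Type}

/-- Run `m₁`, move its output from `k₁` to `k₂`, and run `m₂`. -/
def compMachine (m₁ : Λ₁ → Stmt Γ₁ Λ₁ σ₁) (m₂ : Λ₂ → Stmt Γ₂ Λ₂ σ₂) (k₁ : K₁) (k₂ : K₂)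
    (l₂ : Λ₂) (e₁ : Γ₁ k₁ → B) (e₂ : B → Γ₂ k₂) (d : B) :
    Λ₁ ⊕ Λ₂ ⊕ Bool →
      Stmt (sumΓ Γ₁ Γ₂ fun _ : Unit => B) (Λ₁ ⊕ Λ₂ ⊕ Bool) (σ₁ × σ₂ × Option B)
  | .inl l => liftStmt (Γ' := sumΓ Γ₁ Γ₂ fun _ : Unit => B) .inl (fun s => s.1)
      (fun s v => (v, s.2)) .inl (.goto fun _ => .inr (.inr false)) (m₁ l)
  | .inr (.inl l) => liftStmt (Γ' := sumΓ Γ₁ Γ₂ fun _ : Unit => B) (fun k => .inr (.inl k))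
      (fun s => s.2.1) (fun s v => (s.1, v, s.2.2)) (fun l => .inr (.inl l)) .halt (m₂ l)
  | .inr (.inr false) => moveStmt (.inl k₁) (.inr (.inr ())) (fun s => s.2.2)
      (fun s o => (s.1, s.2.1, o)) d e₁ (fun b => b) (.inr (.inr false)) (.inr (.inr true))
  | .inr (.inr true) => moveStmt (.inr (.inr ())) (.inr (.inl k₂)) (fun s => s.2.2)
      (fun s o => (s.1, s.2.1, o)) d (fun b => b) e₂ (.inr (.inr true)) (.inr (.inl l₂))

end Comp

theorem update_unit {X : Type} (x y : X) : update (fun _ : Unit => x) () y = fun _ => y := by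
  funext; simp

theorem PTime.comp {α β γ A B C : Type} [Inhabited B] {ea : α → List A} {eb : β → List B}
    {ec : γ → List C} {g : β → γ} {f : α → β} (hg : PTime eb ec g) (hf : PTime ea eb f) :
    PTime ea ec fun a => g (f a) := by
  obtain ⟨P, hP⟩ := hf.length_le
  obtain ⟨t₁, i₁, o₁, T₁, h₁⟩ := hf.exists_machine
  obtain ⟨t₂, i₂, o₂, T₂, h₂⟩ := hg.exists_machine
  have := t₁.kFin
  have := t₁.ΛFin
  have := t₁.σFin
  have := t₁.Γk₀Fin
  have := t₂.kFin
  have := t₂.ΛFin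
  have := t₂.σFin
  have := t₂.Γk₀Fin
  have : Fintype B := Fintype.ofEquiv _ i₂
  refine PTime.of_machine (compMachine t₁.m t₂.m t₁.k₁ t₂.k₀ t₂.main o₁ i₂.symm default)
    (.inl t₁.k₀) (.inr (.inl t₂.k₁)) (.inl t₁.main) (t₁.initialState, t₂.initialState, none) i₁ o₂
    -- The intermediate result has length at most `P` and is moved twice; monotonicity of `T₂`
    -- bounds the second run by `T₂` at `P`.
    (T₁ + (P + 1) + (P + 1) + T₂.comp P) fun a => ?_
  rw [← sumStk_nil, update_sumStk_left, update_sumStk_mid]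
  simp only [Polynomial.eval_add, Polynomial.eval_comp, Polynomial.eval_one]
  set m' := compMachine t₁.m t₂.m t₁.k₁ t₂.k₀ t₂.main o₁ i₂.symm default
  have r₁ := Within.lift (m' := m') (φ := .inl) (ι := .inl) (get := fun s => s.1)
    (put := fun s v => (v, s.2)) (e := .goto fun _ => .inr (.inr false))
    (eσ := fun v => (v, t₂.initialState, none))
    (emb := fun S => sumStk S (fun _ => []) fun _ => [])
    (fun _ => rfl) (fun _ _ => rfl) (fun _ _ => rfl) (fun _ _ _ => update_sumStk_left _ _ _ _ _)
    (fun _ => rfl) (h₁ a)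
  have r₂ := within_move (m := m') (l := .inr (.inr false)) (.inl t₁.k₁) (.inr (.inr ()))
    (compMachine.eq_3 ..)
    (by simp) (by intros; rfl) (by intros; rfl) (t₁.initialState, t₂.initialState, none)
    (sumStk (update (fun _ => []) t₁.k₁ ((eb (f a)).map o₁.symm)) (fun _ => []) fun _ => [])
  rw [update_sumStk_left, update_sumStk_right, update_idem] at r₂
  simp [sumStk] at r₂
  have r₃ := within_move (m := m') (l := .inr (.inr true)) (.inr (.inr ()))
    (.inr (.inl t₂.k₀)) (compMachine.eq_4 ..)
    (by simp) (by intros; rfl) (by intros; rfl) (t₁.initialState, t₂.initialState, none)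
    (sumStk (fun _ => []) (fun _ => []) fun _ => (eb (f a)).reverse)
  rw [update_sumStk_right, update_sumStk_mid] at r₃
  simp [sumStk] at r₃
  have r₄ := Within.lift (m' := m') (φ := fun l => .inr (.inl l)) (ι := fun k => .inr (.inl k))
    (get := fun s => s.2.1)
    (put := fun s v => (s.1, v, s.2.2)) (e := .halt)
    (eσ := fun v => (t₁.initialState, v, none))
    (emb := fun S => sumStk (fun _ => []) S fun _ => [])
    (fun _ => rfl) (fun _ _ => rfl) (fun _ _ => rfl) (fun _ _ _ => update_sumStk_mid _ _ _ _ _)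
    (fun _ => rfl) (h₂ (f a))
  have hlen := hP a
  simp only [Function.comp_def, Equiv.apply_symm_apply, update_unit, List.map_id_fun', id] at *
  exact ((r₁.trans (r₂.mono (by omega))).trans (r₃.mono (by omega))).trans
    (r₄.mono (eval_mono T₂ hlen))

/-! Running two machines on the same input and concatenating their outputs. -/

inductive PairStack
  | inp | revInp | out | revOut
  deriving DecidableEq

instance : Fintype PairStack := ⟨{.inp, .revInp, .out, .revOut}, by intro k; cases k <;> simp⟩

inductive PairLabel
  | revInp | copyInp | revSnd | copySnd | revFst | copyFst | fin
  deriving DecidableEq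

instance : Fintype PairLabel :=
  ⟨{.revInp, .copyInp, .revSnd, .copySnd, .revFst, .copyFst, .fin}, by intro k; cases k <;> simp⟩

@[reducible] def PairStack.alphabet (A B : Type) : PairStack → Type
  | .inp => A
  | .revInp => A
  | .out => B
  | .revOut => B

def pairStk {A B : Type} (x t : List A) (u w : List B) : ∀ k, List (PairStack.alphabet A B k)
  | .inp => x
  | .revInp => t
  | .out => u
  | .revOut => w

section PairStk

variable {A B : Type} (x t : List A) (u w : List B)

theorem update_pairStk_inp (y : List A) :
    update (pairStk x t u w) .inp y = pairStk y t u w := by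
  funext k; cases k <;> rfl

theorem update_pairStk_revInp (y : List A) :
    update (pairStk x t u w) .revInp y = pairStk x y u w := by
  funext k; cases k <;> rfl

theorem update_pairStk_out (y : List B) :
    update (pairStk x t u w) .out y = pairStk x t y w := by
  funext k; cases k <;> rfl

theorem update_pairStk_revOut (y : List B) :
    update (pairStk x t u w) .revOut y = pairStk x t u y := by
  funext k; cases k <;> rfl

theorem pairStk_nil : pairStk ([] : List A) [] ([] : List B) [] = fun _ => [] := by
  funext k; cases k <;> rfl

end PairStk

section Pair

variable {K₁ K₂ Λ₁ Λ₂ σ₁ σ₂ A B : Type} {Γ₁ : K₁ → Type} {Γ₂ : K₂ → Type}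

def pairMachine (m₁ : Λ₁ → Stmt Γ₁ Λ₁ σ₁) (m₂ : Λ₂ → Stmt Γ₂ Λ₂ σ₂) (i₁ o₁ : K₁) (i₂ o₂ : K₂)
    (l₁ : Λ₁) (l₂ : Λ₂) (e₁ : A → Γ₁ i₁) (e₂ : A → Γ₂ i₂) (f₁ : Γ₁ o₁ → B) (f₂ : Γ₂ o₂ → B)
    (d : A) (b : B) :
    Λ₁ ⊕ Λ₂ ⊕ PairLabel → Stmt (sumΓ Γ₁ Γ₂ (PairStack.alphabet A B)) (Λ₁ ⊕ Λ₂ ⊕ PairLabel)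
      (σ₁ × σ₂ × Option A × Option B)
  | .inl l => liftStmt (Γ' := sumΓ Γ₁ Γ₂ (PairStack.alphabet A B)) .inl (fun s => s.1)
      (fun s v => (v, s.2)) .inl (.goto fun _ => .inr (.inl l₂)) (m₁ l)
  | .inr (.inl l) => liftStmt (Γ' := sumΓ Γ₁ Γ₂ (PairStack.alphabet A B)) (fun k => .inr (.inl k))
      (fun s => s.2.1) (fun s v => (s.1, v, s.2.2)) (fun l => .inr (.inl l))
      (.goto fun _ => .inr (.inr .revSnd)) (m₂ l)
  | .inr (.inr .revInp) => moveStmt (.inr (.inr .inp)) (.inr (.inr .revInp)) (fun s => s.2.2.1)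
      (fun s o => (s.1, s.2.1, o, s.2.2.2)) d (fun b => b) (fun b => b) (.inr (.inr .revInp))
      (.inr (.inr .copyInp))
  | .inr (.inr .copyInp) => moveStmt₂ (.inr (.inr .revInp)) (.inl i₁) (.inr (.inl i₂))
      (fun s => s.2.2.1) (fun s o => (s.1, s.2.1, o, s.2.2.2)) d (fun b => b) e₁ e₂
      (.inr (.inr .copyInp)) (.inl l₁)
  | .inr (.inr .revSnd) => moveStmt (.inr (.inl o₂)) (.inr (.inr .revOut)) (fun s => s.2.2.2)
      (fun s o => (s.1, s.2.1, s.2.2.1, o)) b f₂ (fun b => b) (.inr (.inr .revSnd))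
      (.inr (.inr .copySnd))
  | .inr (.inr .copySnd) => moveStmt (.inr (.inr .revOut)) (.inr (.inr .out)) (fun s => s.2.2.2)
      (fun s o => (s.1, s.2.1, s.2.2.1, o)) b (fun b => b) (fun b => b) (.inr (.inr .copySnd))
      (.inr (.inr .revFst))
  | .inr (.inr .revFst) => moveStmt (.inl o₁) (.inr (.inr .revOut)) (fun s => s.2.2.2)
      (fun s o => (s.1, s.2.1, s.2.2.1, o)) b f₁ (fun b => b) (.inr (.inr .revFst))
      (.inr (.inr .copyFst))
  | .inr (.inr .copyFst) => moveStmt (.inr (.inr .revOut)) (.inr (.inr .out)) (fun s => s.2.2.2)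
      (fun s o => (s.1, s.2.1, s.2.2.1, o)) b (fun b => b) (fun b => b) (.inr (.inr .copyFst))
      (.inr (.inr .fin))
  | .inr (.inr .fin) => .push (.inr (.inr .out)) (fun _ => b) .halt

end Pair

/-- The output stack is filled from the bottom: the second result goes first, then the first result,
then the symbol `b`. With `b = true` this is the node symbol of the prefix notation for trees. -/
theorem PTime.pair {α β γ δ A B : Type} [Inhabited A] [Fintype A] [Fintype B]
    {ea : α → List A} {eb : β → List B} {ec : γ → List B} {ed : δ → List B} {f : α → β} {g : α → γ} {h : α → δ}
    (hf : PTime ea eb f) (hg : PTime ea ec g) (b : B)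
    (hh : ∀ a, ed (h a) = b :: (eb (f a) ++ ec (g a))) : PTime ea ed h := by
  obtain ⟨P₁, hP₁⟩ := hf.length_le
  obtain ⟨P₂, hP₂⟩ := hg.length_le
  obtain ⟨t₁, i₁, o₁, T₁, h₁⟩ := hf.exists_machine
  obtain ⟨t₂, i₂, o₂, T₂, h₂⟩ := hg.exists_machine
  have := t₁.kFin
  have := t₁.ΛFin
  have := t₁.σFin
  have := t₂.kFin
  have := t₂.ΛFin
  have := t₂.σFin
  refine PTime.of_machine (pairMachine t₁.m t₂.m t₁.k₀ t₁.k₁ t₂.k₀ t₂.k₁ t₁.main t₂.main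
    i₁.symm i₂.symm o₁ o₂ default b)
    (.inr (.inr .inp)) (.inr (.inr .out)) (.inr (.inr .revInp))
    (t₁.initialState, t₂.initialState, none, none) (Equiv.refl _) (Equiv.refl _)
    (.X + 1 + (.X + 1) + T₁ + T₂ + (P₂ + 1) + (P₂ + 1) + (P₁ + 1) + (P₁ + 1) + 1) fun a => ?_
  rw [← sumStk_nil, update_sumStk_right, update_sumStk_right, ← pairStk_nil, update_pairStk_inp,
    update_pairStk_out]
  simp only [Polynomial.eval_add, Polynomial.eval_X, Polynomial.eval_one]
  set m' := pairMachine t₁.m t₂.m t₁.k₀ t₁.k₁ t₂.k₀ t₂.k₁ t₁.main t₂.main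
    i₁.symm i₂.symm o₁ o₂ default b
  have r₁ := within_move (m := m') (l := .inr (.inr .revInp)) (.inr (.inr .inp))
    (.inr (.inr .revInp)) (pairMachine.eq_3 ..)
    (by simp) (by intros; rfl) (by intros; rfl) (t₁.initialState, t₂.initialState, none, none)
    (sumStk (fun _ => []) (fun _ => []) (pairStk (ea a) [] [] []))
  rw [update_sumStk_right, update_sumStk_right, update_pairStk_inp, update_pairStk_revInp] at r₁
  have r₂ := within_move₂ (m := m') (l := .inr (.inr .copyInp)) (.inr (.inr .revInp))
    (.inl t₁.k₀) (.inr (.inl t₂.k₀)) (pairMachine.eq_4 ..)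
    (by simp) (by simp) (by simp) (by intros; rfl) (by intros; rfl)
    (t₁.initialState, t₂.initialState, none, none)
    (sumStk (fun _ => []) (fun _ => []) (pairStk [] (ea a).reverse [] []))
  rw [update_sumStk_right, update_sumStk_left, update_sumStk_mid, update_pairStk_revInp] at r₂
  have r₃ := Within.lift (m' := m') (φ := .inl) (ι := .inl) (get := fun s => s.1)
    (put := fun s v => (v, s.2)) (e := .goto fun _ => .inr (.inl t₂.main))
    (eσ := fun v => (v, t₂.initialState, none, none))
    (emb := fun S => sumStk S (update (fun _ => []) t₂.k₀ ((ea a).map i₂.symm))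
      (pairStk [] [] [] []))
    (fun _ => rfl) (fun _ _ => rfl) (fun _ _ => rfl) (fun _ _ _ => update_sumStk_left _ _ _ _ _)
    (fun _ => rfl) (h₁ a)
  have r₄ := Within.lift (m' := m') (φ := fun l => .inr (.inl l)) (ι := fun k => .inr (.inl k))
    (get := fun s => s.2.1)
    (put := fun s v => (s.1, v, s.2.2)) (e := .goto fun _ => .inr (.inr .revSnd))
    (eσ := fun v => (t₁.initialState, v, none, none))
    (emb := fun S => sumStk (update (fun _ => []) t₁.k₁ ((eb (f a)).map o₁.symm)) S
      (pairStk [] [] [] []))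
    (fun _ => rfl) (fun _ _ => rfl) (fun _ _ => rfl) (fun _ _ _ => update_sumStk_mid _ _ _ _ _)
    (fun _ => rfl) (h₂ a)
  have r₅ := within_move (m := m') (l := .inr (.inr .revSnd)) (.inr (.inl t₂.k₁))
    (.inr (.inr .revOut)) (pairMachine.eq_5 ..)
    (by simp) (by intros; rfl) (by intros; rfl) (t₁.initialState, t₂.initialState, none, none)
    (sumStk (update (fun _ => []) t₁.k₁ ((eb (f a)).map o₁.symm))
      (update (fun _ => []) t₂.k₁ ((ec (g a)).map o₂.symm)) (pairStk [] [] [] []))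
  rw [update_sumStk_mid, update_sumStk_right, update_pairStk_revOut, update_idem] at r₅
  have r₆ := within_move (m := m') (l := .inr (.inr .copySnd)) (.inr (.inr .revOut))
    (.inr (.inr .out)) (pairMachine.eq_6 ..)
    (by simp) (by intros; rfl) (by intros; rfl) (t₁.initialState, t₂.initialState, none, none)
    (sumStk (update (fun _ => []) t₁.k₁ ((eb (f a)).map o₁.symm))
      (fun _ => []) (pairStk [] [] [] (ec (g a)).reverse))
  rw [update_sumStk_right, update_sumStk_right, update_pairStk_revOut, update_pairStk_out] at r₆
  have r₇ := within_move (m := m') (l := .inr (.inr .revFst)) (.inl t₁.k₁)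
    (.inr (.inr .revOut)) (pairMachine.eq_7 ..)
    (by simp) (by intros; rfl) (by intros; rfl) (t₁.initialState, t₂.initialState, none, none)
    (sumStk (update (fun _ => []) t₁.k₁ ((eb (f a)).map o₁.symm))
      (fun _ => []) (pairStk [] [] (ec (g a)) []))
  rw [update_sumStk_left, update_sumStk_right, update_pairStk_revOut, update_idem] at r₇
  have r₈ := within_move (m := m') (l := .inr (.inr .copyFst)) (.inr (.inr .revOut))
    (.inr (.inr .out)) (pairMachine.eq_8 ..)
    (by simp) (by intros; rfl) (by intros; rfl) (t₁.initialState, t₂.initialState, none, none)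
    (sumStk (fun _ => []) (fun _ => []) (pairStk [] [] (ec (g a)) (eb (f a)).reverse))
  rw [update_sumStk_right, update_sumStk_right, update_pairStk_revOut, update_pairStk_out] at r₈
  have r₉ := Within.one (m := m') (.inr (.inr .fin)) (t₁.initialState, t₂.initialState, none, none)
    (sumStk (fun _ => []) (fun _ => []) (pairStk [] [] (eb (f a) ++ ec (g a)) []))
  rw [show m' (.inr (.inr .fin)) = _ from pairMachine.eq_9 .., stepAux.eq_1,
    update_sumStk_right, update_pairStk_out, stepAux.eq_7] at r₉
  have hl₁ := hP₁ a
  have hl₂ := hP₂ a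
  simp [sumStk, pairStk, Function.comp_def] at r₁ r₂ r₃ r₄ r₅ r₆ r₇ r₈ r₉ ⊢
  rw [hh]
  exact ((((((((r₁.trans r₂).trans r₃).trans r₄).trans (r₅.mono (by omega))).trans
    (r₆.mono (by omega))).trans (r₇.mono (by omega))).trans (r₈.mono (by omega))).trans r₉)

end KOWF

namespace KOWF

open Turing Turing.TM2 Function

/-! Iterating a machine as long as the second symbol of the encoding of the state is `true`. -/

inductive LoopLabel
  | check | revInp | copyInp | revOut | copyOut
  deriving DecidableEq

instance : Fintype LoopLabel :=
  ⟨{.check, .revInp, .copyInp, .revOut, .copyOut}, by intro k; cases k <;> simp⟩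

section Loop

variable {K Λ σ : Type} {Γ : K → Type}

def loopMachine (m : Λ → Stmt Γ Λ σ) (i o : K) (l : Λ) (e : Bool → Γ i) (f : Γ o → Bool) :
    Λ ⊕ LoopLabel →
      Stmt (sumΓ Γ (fun _ : Unit => Bool) fun _ : Unit => Bool) (Λ ⊕ LoopLabel)
        (σ × Option Bool × Bool)
  | .inl l => liftStmt (Γ' := sumΓ Γ (fun _ : Unit => Bool) fun _ : Unit => Bool) .inl
      (fun s => s.1) (fun s v => (v, s.2)) .inl (.goto fun _ => .inr .revOut) (m l)
  | .inr .check => .pop (.inr (.inl ())) (fun s a => (s.1, a, s.2.2))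
      (.peek (.inr (.inl ())) (fun s a => (s.1, s.2.1, decide (a = some true)))
        (.push (.inr (.inl ())) (fun s => s.2.1.getD true)
          (.branch (fun s => s.2.2)
            (.load (fun s => (s.1, none, false)) (.goto fun _ => .inr .revInp))
            (.load (fun s => (s.1, none, false)) .halt))))
  | .inr .revInp => moveStmt (.inr (.inl ())) (.inr (.inr ())) (fun s => s.2.1)
      (fun s o => (s.1, o, s.2.2)) true (fun b => b) (fun b => b) (.inr .revInp) (.inr .copyInp)
  | .inr .copyInp => moveStmt (.inr (.inr ())) (.inl i) (fun s => s.2.1)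
      (fun s o => (s.1, o, s.2.2)) true (fun b => b) e (.inr .copyInp) (.inl l)
  | .inr .revOut => moveStmt (.inl o) (.inr (.inr ())) (fun s => s.2.1)
      (fun s o => (s.1, o, s.2.2)) true f (fun b => b) (.inr .revOut) (.inr .copyOut)
  | .inr .copyOut => moveStmt (.inr (.inr ())) (.inr (.inl ())) (fun s => s.2.1)
      (fun s o => (s.1, o, s.2.2)) true (fun b => b) (fun b => b) (.inr .copyOut) (.inr .check)

end Loop

/-- Iterates of a polynomial-time step may grow exponentially, so `P` must bound the sizes of all
intermediate states as well as the number of rounds. The test is a single symbol: for a state that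
is a pair starting with a list, the second symbol of the word tells whether that list is nonempty.
-/
theorem PTime.loop {α τ : Type} {es : τ → List Bool} {step : τ → τ} (c : τ → Bool)
    (hs : PTime es es step)
    (hc : ∀ s, ∃ b r, es s = b :: r ∧ decide (r.head? = some true) = c s)
    (ini : α → τ) (N : α → ℕ) (hhalt : ∀ a, c (step^[N a] (ini a)) = false)
    (hrun : ∀ a, ∀ i < N a, c (step^[i] (ini a)) = true) (P : Polynomial ℕ)
    (hN : ∀ a, N a ≤ P.eval (es (ini a)).length)
    (hsize : ∀ a, ∀ i ≤ N a, (es (step^[i] (ini a))).length ≤ P.eval (es (ini a)).length) :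
    PTime (fun a => es (ini a)) es (fun a => step^[N a] (ini a)) := by
  obtain ⟨t, i₀, o₀, T, h⟩ := hs.exists_machine
  have := t.kFin
  have := t.ΛFin
  have := t.σFin
  refine PTime.of_machine (loopMachine t.m t.k₀ t.k₁ t.main i₀.symm o₀)
    (.inr (.inl ())) (.inr (.inl ())) (.inr .check) (t.initialState, none, false)
    -- A round is one test, two moves in, two moves out and the body; the last summand is the final
    -- test.
    (Equiv.refl _) (Equiv.refl _) (P * (1 + 4 * (P + 1) + T.comp P) + 1) fun a => ?_
  rw [← sumStk_nil, update_sumStk_mid, update_sumStk_mid]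
  set m' := loopMachine t.m t.k₀ t.k₁ t.main i₀.symm o₀
  simp only [update_unit]
  let st : τ → TM2.Cfg (sumΓ t.Γ (fun _ : Unit => Bool) fun _ : Unit => Bool) (t.Λ ⊕ LoopLabel)
    (t.σ × Option Bool × Bool) := fun s =>
      ⟨some (.inr .check), (t.initialState, none, false),
        sumStk (fun _ => []) (fun _ => es s) fun _ => []⟩
  have hcheck : ∀ s, Within m' 1 (st s)
      ⟨if c s then some (.inr .revInp) else none, (t.initialState, none, false),
        sumStk (fun _ => []) (fun _ => es s) fun _ => []⟩ := by
    intro s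
    have h := Within.one (m := m') (.inr .check) (t.initialState, none, false)
      (sumStk (fun _ => []) (fun _ => es s) fun _ => [])
    rw [show m' (.inr .check) = _ from loopMachine.eq_2 ..] at h
    obtain ⟨b, r, hb, hr⟩ := hc s
    simp only [stepAux.eq_3, stepAux.eq_2, stepAux.eq_1, stepAux.eq_5, update_sumStk_mid,
      update_unit] at h
    simp only [sumStk, hb, List.tail_cons, List.head?_cons, Option.getD_some, hr] at h
    simp only [st, hb]
    cases hcs : c s <;> simpa [hcs] using h
  have hbody : ∀ s, c s = true → (es (step s)).length ≤ P.eval (es (ini a)).length →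
      (es s).length ≤ P.eval (es (ini a)).length →
      Within m' (1 + 4 * (P.eval (es (ini a)).length + 1) + T.eval (P.eval (es (ini a)).length))
        (st s) (st (step s)) := by
    intro s hs hl₁ hl₂
    have r₀ := hcheck s
    rw [if_pos hs] at r₀
    have r₁ := within_move (m := m') (l := .inr .revInp) (.inr (.inl ())) (.inr (.inr ()))
      (loopMachine.eq_3 ..) (by simp) (by intros; rfl) (by intros; rfl)
      (t.initialState, none, false) (sumStk (fun _ => []) (fun _ => es s) fun _ => [])
    rw [update_sumStk_mid, update_sumStk_right] at r₁
    have r₂ := within_move (m := m') (l := .inr .copyInp) (.inr (.inr ())) (.inl t.k₀)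
      (loopMachine.eq_4 ..) (by simp) (by intros; rfl) (by intros; rfl)
      (t.initialState, none, false) (sumStk (fun _ => []) (fun _ => []) fun _ => (es s).reverse)
    rw [update_sumStk_right, update_sumStk_left] at r₂
    have r₃ := Within.lift (m' := m') (φ := .inl) (ι := .inl) (get := fun s => s.1)
      (put := fun s v => (v, s.2)) (e := .goto fun _ => .inr .revOut)
      (eσ := fun v => (v, none, false))
      (emb := fun S => sumStk S (fun _ => []) fun _ => [])
      (fun _ => rfl) (fun _ _ => rfl) (fun _ _ => rfl) (fun _ _ _ => update_sumStk_left _ _ _ _ _)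
      (fun _ => rfl) (h s)
    have r₄ := within_move (m := m') (l := .inr .revOut) (.inl t.k₁) (.inr (.inr ()))
      (loopMachine.eq_5 ..) (by simp) (by intros; rfl) (by intros; rfl)
      (t.initialState, none, false)
      (sumStk (update (fun _ => []) t.k₁ ((es (step s)).map o₀.symm)) (fun _ => []) fun _ => [])
    rw [update_sumStk_left, update_sumStk_right, update_idem] at r₄
    have r₅ := within_move (m := m') (l := .inr .copyOut) (.inr (.inr ())) (.inr (.inl ()))
      (loopMachine.eq_6 ..) (by simp) (by intros; rfl) (by intros; rfl)
      (t.initialState, none, false)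
      (sumStk (fun _ => []) (fun _ => []) fun _ => (es (step s)).reverse)
    rw [update_sumStk_right, update_sumStk_mid] at r₅
    have hT := eval_mono T hl₂
    simp [sumStk, Function.comp_def] at r₁ r₂ r₃ r₄ r₅ hT
    exact (((((r₀.trans r₁).trans r₂).trans r₃).trans r₄).trans r₅).mono (by omega)
  have hiter : ∀ i ≤ N a, Within m' (i * (1 + 4 * (P.eval (es (ini a)).length + 1) +
      T.eval (P.eval (es (ini a)).length))) (st (ini a)) (st (step^[i] (ini a))) := by
    intro i
    induction i with
    | zero => intro; simpa using Within.refl _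
    | succ i ih =>
      intro hi
      have h₁ := hbody (step^[i] (ini a)) (hrun a i hi)
      rw [← iterate_succ_apply' step i] at h₁
      exact ((ih (by omega)).trans (h₁ (hsize a _ hi) (hsize a _ (by omega)))).mono
        (Nat.succ_mul ..).ge
  have hlast := (hiter _ le_rfl).trans (hcheck _)
  rw [hhalt] at hlast
  simp only [st, Bool.false_eq_true, if_false] at hlast
  simp only [Equiv.refl_symm, Equiv.coe_refl, List.map_id, Polynomial.eval_add,
    Polynomial.eval_mul, Polynomial.eval_one, Polynomial.eval_comp, Polynomial.eval_ofNat]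
  exact hlast.mono (by gcongr; exact hN a)

/-! ### Sequential transducers with a counter -/

/-- The instructions for the counter of a transducer. -/
inductive CounterOp
  | keep | inc | dec

def CounterOp.isInc : CounterOp → Bool
  | .inc => true
  | _ => false

def CounterOp.isDec : CounterOp → Bool
  | .dec => true
  | _ => false

def CounterOp.app : CounterOp → ℕ → ℕ
  | .keep, n => n
  | .inc, n => n + 1
  | .dec, n => n - 1

/-- The output of a transducer: in state `q`, with a counter that is tested for `0`, it reads a
symbol, changes its state and its counter, and appends a word to its output. At the end of
the input it appends another word. -/
def transduce {Q A B : Type} (δ : Q → Bool → A → Q × CounterOp × List B) (fin : Q → List B) :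
    Q → ℕ → List A → List B
  | q, _, [] => fin q
  | q, c, a :: l => (δ q (c == 0) a).2.2 ++
      transduce δ fin (δ q (c == 0) a).1 ((δ q (c == 0) a).2.1.app c) l

section PushList

variable {K : Type} [DecidableEq K] {Γ : K → Type} {Λ σ : Type}

/-- Push the list `e s`, whose length is at most `n`. -/
def pushList (k : K) (d : Γ k) : ℕ → (σ → List (Γ k)) → Stmt Γ Λ σ → Stmt Γ Λ σ
  | 0, _, q => q
  | n + 1, e, q => .branch (fun s => (e s).isEmpty) q
      (.push k (fun s => (e s).headD d) (pushList k d n (fun s => (e s).tail) q))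

theorem stepAux_pushList (k : K) (d : Γ k) (n : ℕ) (e : σ → List (Γ k)) (q : Stmt Γ Λ σ) (v : σ)
    (S : ∀ k, List (Γ k)) (h : (e v).length ≤ n) :
    stepAux (pushList k d n e q) v S = stepAux q v (update S k ((e v).reverse ++ S k)) := by
  induction n generalizing e S with
  | zero =>
    have : e v = [] := List.length_eq_zero_iff.1 (by omega)
    simp [pushList, this]
  | succ n ih =>
    rw [pushList, stepAux.eq_5]
    rcases he : e v with _ | ⟨a, l⟩
    · simp
    · simp only [List.isEmpty_cons, cond_false, stepAux.eq_1, he, List.headD_cons]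
      rw [ih _ _ (by simp [he] at h ⊢; omega)]
      simp [he]

end PushList

inductive TransStack
  | inp | counter | revOut | out
  deriving DecidableEq

instance : Fintype TransStack := ⟨{.inp, .counter, .revOut, .out}, by intro k; cases k <;> simp⟩

@[reducible] def TransStack.alphabet (A B : Type) : TransStack → Type
  | .inp => A
  | .counter => Unit
  | .revOut => B
  | .out => B

def transStk {A B : Type} (x : List A) (c : List Unit) (w u : List B) :
    ∀ k, List (TransStack.alphabet A B k)
  | .inp => x
  | .counter => c
  | .revOut => w
  | .out => u

section TransStk

variable {A B : Type} (x : List A) (c : List Unit) (w u : List B)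

theorem update_transStk_inp (y : List A) :
    update (transStk x c w u) .inp y = transStk y c w u := by
  funext k; cases k <;> rfl

theorem update_transStk_counter (y : List Unit) :
    update (transStk x c w u) .counter y = transStk x y w u := by
  funext k; cases k <;> rfl

theorem update_transStk_revOut (y : List B) :
    update (transStk x c w u) .revOut y = transStk x c y u := by
  funext k; cases k <;> rfl

theorem update_transStk_out (y : List B) :
    update (transStk x c w u) .out y = transStk x c w y := by
  funext k; cases k <;> rfl

theorem transStk_nil : transStk ([] : List A) [] ([] : List B) [] = fun _ => [] := by
  funext k; cases k <;> rfl

end TransStk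

inductive TransLabel
  | read | clear | copy
  deriving DecidableEq

instance : Fintype TransLabel := ⟨{.read, .clear, .copy}, by intro k; cases k <;> simp⟩

section Transducer

variable {Q A B : Type}

/-- The variables of the machine of a transducer: the state, the symbol that was read, the result
of the test of the counter, and a symbol to be moved. -/
structure TransVar (Q A B : Type) where
  state : Q
  read : Option A
  isZero : Bool
  sym : Option B

def TransVar.equiv : TransVar Q A B ≃ Q × Option A × Bool × Option B where
  toFun v := (v.state, v.read, v.isZero, v.sym)
  invFun v := ⟨v.1, v.2.1, v.2.2.1, v.2.2.2⟩
  left_inv _ := rfl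
  right_inv _ := rfl

noncomputable instance [Fintype Q] [Fintype A] [Fintype B] : Fintype (TransVar Q A B) :=
  Fintype.ofEquiv _ TransVar.equiv.symm

def transMachine [Inhabited A] [Inhabited B] (δ : Q → Bool → A → Q × CounterOp × List B)
    (fin : Q → List B) (q₀ : Q) (n : ℕ) :
    TransLabel → Stmt (TransStack.alphabet A B) TransLabel (TransVar Q A B)
  | .read => .pop .inp (fun s a => { s with read := a })
      (.peek .counter (fun s a => { s with isZero := a.isNone })
        (.branch (fun s => s.read.isSome)
          (pushList .revOut default n (fun s => (δ s.state s.isZero (s.read.getD default)).2.2)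
            (.branch (fun s => (δ s.state s.isZero (s.read.getD default)).2.1.isInc)
              (.push .counter (fun _ => ())
                (.load (fun s => ⟨(δ s.state s.isZero (s.read.getD default)).1, none, false, none⟩)
                  (.goto fun _ => .read)))
              (.branch (fun s => (δ s.state s.isZero (s.read.getD default)).2.1.isDec)
                (.pop .counter (fun s _ => s)
                  (.load
                    (fun s => ⟨(δ s.state s.isZero (s.read.getD default)).1, none, false, none⟩)
                    (.goto fun _ => .read)))
                (.load (fun s => ⟨(δ s.state s.isZero (s.read.getD default)).1, none, false, none⟩)
                  (.goto fun _ => .read)))))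
          (pushList .revOut default n (fun s => fin s.state)
            (.load (fun _ => ⟨q₀, none, false, none⟩) (.goto fun _ => .clear)))))
  | .clear => .pop .counter (fun s a => { s with isZero := a.isSome })
      (.branch (fun s => s.isZero) (.load (fun s => { s with isZero := false })
        (.goto fun _ => .clear)) (.goto fun _ => .copy))
  | .copy => .pop .revOut (fun s a => { s with sym := a })
      (.branch (fun s => s.sym.isSome) (.push .out (fun s => s.sym.getD default)
        (.load (fun s => { s with sym := none }) (.goto fun _ => .copy))) .halt)

/-- The counter is a stack over a one-letter alphabet. Finiteness of `Q` and `A` bounds the words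
written per symbol, so one statement can write them. At the end the counter is emptied and the
reversed output is turned around. -/
theorem PTime.transduce {α β : Type} [Inhabited A] [Inhabited B] [Fintype Q] [Fintype A] [Fintype B]
    {ea : α → List A} {eb : β → List B} {f : α → β}
    (δ : Q → Bool → A → Q × CounterOp × List B) (fin : Q → List B) (q₀ : Q)
    (h : ∀ a, transduce δ fin q₀ 0 (ea a) = eb (f a)) : PTime ea eb f := by
  obtain ⟨n, hn, hn'⟩ : ∃ n, (∀ q b a, (δ q b a).2.2.length ≤ n) ∧ ∀ q, (fin q).length ≤ n := by
    refine ⟨∑ x : Q × Bool × A, (δ x.1 x.2.1 x.2.2).2.2.length + ∑ q, (fin q).length,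
      fun q b a => ?_, fun q => ?_⟩
    · exact (Finset.single_le_sum (f := fun x : Q × Bool × A => (δ x.1 x.2.1 x.2.2).2.2.length)
        (fun _ _ => Nat.zero_le _) (Finset.mem_univ (q, b, a))).trans (Nat.le_add_right _ _)
    · exact (Finset.single_le_sum (f := fun q => (fin q).length)
        (fun _ _ => Nat.zero_le _) (Finset.mem_univ q)).trans (Nat.le_add_left _ _)
  set m := transMachine δ fin q₀ n with hm
  have hcopy : ∀ (w u : List B), Within m (w.length + 1)
      ⟨some .copy, ⟨q₀, none, false, none⟩, transStk [] [] w u⟩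
      ⟨none, ⟨q₀, none, false, none⟩, transStk [] [] [] (w.reverse ++ u)⟩ := by
    intro w
    induction w with
    | nil =>
      intro u
      refine Within.step ?_
      simp only [hm, transMachine, stepAux, update_transStk_revOut]
      simpa [transStk] using Within.refl _
    | cons b w ih =>
      intro u
      refine Within.step ?_
      simp only [hm, transMachine, stepAux, update_transStk_revOut, update_transStk_out]
      simpa [transStk] using ih (b :: u)
  have hclear : ∀ (c : ℕ) (w : List B), Within m (c + 1)
      ⟨some .clear, ⟨q₀, none, false, none⟩, transStk [] (List.replicate c ()) w []⟩
      ⟨some .copy, ⟨q₀, none, false, none⟩, transStk [] [] w []⟩ := by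
    intro c w
    induction c with
    | zero =>
      refine Within.step ?_
      simp only [hm, transMachine, stepAux, update_transStk_counter]
      simpa [transStk] using Within.refl _
    | succ c ih =>
      refine Within.step ?_
      simp only [hm, transMachine, stepAux, update_transStk_counter]
      simpa [transStk, List.replicate_succ] using ih
  have hread : ∀ (l : List A) (q : Q) (c : ℕ) (w : List B),
      -- The three summands pay for reading, for clearing a counter that grows by at most one per
      -- symbol, and for reversing the output.
      Within m ((l.length + 1) + (l.length + c + 1) + (w.length + n * (l.length + 1) + 1))
        ⟨some .read, ⟨q, none, false, none⟩, transStk l (List.replicate c ()) w []⟩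
        ⟨none, ⟨q₀, none, false, none⟩,
          transStk [] [] [] (w.reverse ++ KOWF.transduce δ fin q c l)⟩ := by
    intro l
    induction l with
    | nil =>
      intro q c w
      have r : Within m 1 ⟨some .read, ⟨q, none, false, none⟩, transStk [] (List.replicate c ()) w []⟩
          ⟨some .clear, ⟨q₀, none, false, none⟩,
            transStk [] (List.replicate c ()) ((fin q).reverse ++ w) []⟩ := by
        refine Within.step ?_
        simp only [hm, transMachine, stepAux, update_transStk_inp]
        simp only [transStk, List.head?_nil, Option.isSome_none, cond_false]
        rw [stepAux_pushList _ _ _ _ _ _ _ (hn' q), update_transStk_revOut]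
        exact Within.refl _
      have hf := hn' q
      have r' := (r.trans (hclear c _)).trans (hcopy ((fin q).reverse ++ w) [])
      simp only [List.reverse_append, List.reverse_reverse, List.append_nil, List.length_append,
        List.length_reverse] at r'
      rw [KOWF.transduce]
      refine r'.mono ?_
      simp only [List.length_nil, zero_add, mul_one]
      omega
    | cons a l ih =>
      intro q c w
      have r : Within m 1
          ⟨some .read, ⟨q, none, false, none⟩, transStk (a :: l) (List.replicate c ()) w []⟩
          ⟨some .read, ⟨(δ q (c == 0) a).1, none, false, none⟩,
            transStk l (List.replicate ((δ q (c == 0) a).2.1.app c) ())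
              ((δ q (c == 0) a).2.2.reverse ++ w) []⟩ := by
        have hc : (List.replicate c ()).head?.isNone = (c == 0) := by
          cases c <;> simp [List.replicate_succ]
        refine Within.step ?_
        simp only [hm, transMachine, stepAux, update_transStk_inp]
        simp only [transStk, List.head?_cons, Option.isSome_some, cond_true, List.tail_cons, hc]
        rw [stepAux_pushList _ _ _ _ _ _ _ (hn _ _ _), update_transStk_revOut]
        simp only [stepAux, Option.getD_some]
        have hop : ∀ o : CounterOp, o = .keep ∨ o = .inc ∨ o = .dec := by intro o; cases o <;> simp
        obtain hδ | hδ | hδ := hop (δ q (c == 0) a).2.1 <;> rw [hδ]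
        · simpa [CounterOp.app, CounterOp.isInc, CounterOp.isDec, transStk] using Within.refl _
        · simpa [CounterOp.app, CounterOp.isInc, CounterOp.isDec, update_transStk_counter, transStk, List.replicate_succ]
            using Within.refl _
        · simpa [CounterOp.app, CounterOp.isInc, CounterOp.isDec, update_transStk_counter, transStk] using Within.refl _
      have hf := hn q (c == 0) a
      have hc : (δ q (c == 0) a).2.1.app c ≤ c + 1 := by
        cases (δ q (c == 0) a).2.1 <;> simp [CounterOp.app]; all_goals omega
      have r' := r.trans (ih (δ q (c == 0) a).1 ((δ q (c == 0) a).2.1.app c)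
        ((δ q (c == 0) a).2.2.reverse ++ w))
      simp only [List.reverse_append, List.reverse_reverse, List.length_append,
        List.length_reverse, List.append_assoc] at r'
      rw [KOWF.transduce]
      refine r'.mono ?_
      simp only [List.length_cons, Nat.mul_succ]
      omega
  refine PTime.of_machine m .inp .out .read ⟨q₀, none, false, none⟩ (Equiv.refl _) (Equiv.refl _)
    ((.X + 1) + (.X + 1) + (Polynomial.C n * (.X + 1) + 1)) fun a => ?_
  have := hread (ea a) q₀ 0 []
  rw [← transStk_nil, update_transStk_inp, update_transStk_out]
  simp at this ⊢
  rw [← h]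
  exact this

end Transducer

end KOWF

namespace KOWF

open Turing Function

/-! ### Binary trees and typed polynomial-time functions -/

/-- Binary trees, the universal data type. -/
inductive STree
  | nil
  | node (l r : STree)

namespace STree

/-- The word of a tree in prefix notation. -/
def word : STree → List Bool
  | nil => [false]
  | node l r => true :: (l.word ++ r.word)

def car : STree → STree
  | nil => nil
  | node l _ => l

def cdr : STree → STree
  | nil => nil
  | node _ r => r

/-- `node c (node a b) ↦ if c = nil then b else a`. -/
def select : STree → STree
  | node nil (node _ b) => b
  | node (node _ _) (node a _) => a
  | _ => nil

/-- Prefix notation is a prefix code, so the subtrees of a node need no separator. -/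
theorem word_append_inj {s t : STree} {u v : List Bool} (h : s.word ++ u = t.word ++ v) :
    s = t ∧ u = v := by
  induction s generalizing t u v with
  | nil =>
    cases t with
    | nil => simpa [word] using h
    | node l r => simp [word] at h
  | node l r ihl ihr =>
    cases t with
    | nil => simp [word] at h
    | node l' r' =>
      simp only [word, List.cons_append, List.append_assoc, List.cons.injEq, true_and] at h
      obtain ⟨rfl, h₁⟩ := ihl h
      obtain ⟨rfl, h'⟩ := ihr h₁
      exact ⟨rfl, h'⟩

theorem word_injective : Injective word := fun s t h =>
  (word_append_inj (u := []) (v := []) (by simpa using h)).1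

end STree

/-- Types whose elements are represented by trees. -/
class Code (α : Type) where
  enc : α → STree
  enc_injective : Injective enc


/-- The word that represents an element of a type. -/
def code {α : Type} [Code α] (a : α) : List Bool := (Code.enc a).word

theorem code_injective {α : Type} [Code α] : Injective (code : α → List Bool) :=
  STree.word_injective.comp Code.enc_injective

/-- The length of the representation. -/
def size {α : Type} [Code α] (a : α) : ℕ := (code a).length

/-- Polynomial-time computable functions between represented types. -/
@[fun_prop]
def PF {α β : Type} [Code α] [Code β] (f : α → β) : Prop := PTime (code : α → _) (code : β → _) f

section Instances

variable {α β : Type} [Code α] [Code β]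

instance : Code STree := ⟨id, injective_id⟩

instance : Code Unit := ⟨fun _ => .nil, fun _ _ _ => rfl⟩

instance : Code Bool :=
  ⟨fun b => cond b (.node .nil .nil) .nil, fun a b h => by cases a <;> cases b <;> simp_all⟩

instance : Code (α × β) :=
  ⟨fun p => .node (Code.enc p.1) (Code.enc p.2), fun p q h => by
    simp only [STree.node.injEq] at h
    exact Prod.ext (Code.enc_injective h.1) (Code.enc_injective h.2)⟩

def encList : List α → STree
  | [] => .nil
  | a :: l => .node (Code.enc a) (encList l)

theorem encList_injective : Injective (encList : List α → STree) := by
  intro l l' h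
  induction l generalizing l' with
  | nil => cases l' <;> simp_all [encList]
  | cons a l ih =>
    cases l' with
    | nil => simp [encList] at h
    | cons a' l' =>
      simp only [encList, STree.node.injEq] at h
      rw [Code.enc_injective h.1, ih h.2]

instance : Code (List α) := ⟨encList, encList_injective⟩

instance : Code ℕ :=
  ⟨fun n => encList (List.replicate n ()), fun m n h => by
    simpa using congrArg List.length (encList_injective h)⟩

instance : Code (Option α) :=
  ⟨fun o => encList o.toList, fun a b h => by
    have := encList_injective h
    cases a <;> cases b <;> simp_all⟩

end Instances

/-! ### Sizes of representations -/

section Size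

variable {α β : Type} [Code α] [Code β]

@[simp] theorem code_pair (a : α) (b : β) : code (a, b) = true :: (code a ++ code b) := rfl

@[simp] theorem code_nil : code ([] : List α) = [false] := rfl

@[simp] theorem code_cons (a : α) (l : List α) : code (a :: l) = true :: (code a ++ code l) := rfl

@[simp] theorem size_pair (a : α) (b : β) : size (a, b) = size a + size b + 1 := by
  simp [size]

@[simp] theorem size_nil : size ([] : List α) = 1 := rfl

@[simp] theorem size_cons (a : α) (l : List α) : size (a :: l) = size a + size l + 1 := by
  simp [size]

theorem size_pos (a : α) : 0 < size a := by
  unfold size code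
  cases Code.enc a <;> simp [STree.word]

@[simp] theorem size_none : size (none : Option α) = 1 := rfl

@[simp] theorem size_some (a : α) : size (some a) = size a + 2 := size_cons a []

theorem size_nat_eq (n : ℕ) : size n = size (List.replicate n ()) := rfl

@[simp] theorem size_nat (n : ℕ) : size n = 2 * n + 1 := by
  rw [size_nat_eq]
  induction n with
  | zero => rfl
  | succ n ih => rw [List.replicate_succ, size_cons, ih]; change 1 + _ + 1 = _; omega

theorem size_bool_le (b : Bool) : size b ≤ 3 := by cases b <;> decide

theorem size_append (l l' : List α) : size (l ++ l') + 1 = size l + size l' := by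
  induction l with
  | nil => simp [add_comm]
  | cons a l ih => simp; omega

theorem size_lt_of_mem {a : α} {l : List α} (h : a ∈ l) : size a < size l := by
  induction l with
  | nil => simp at h
  | cons b l ih =>
    rcases List.mem_cons.1 h with rfl | h
    · simp only [size_cons]; omega
    · have := ih h
      simp; omega

theorem size_le_of_sublist {l l' : List α} (h : l.Sublist l') : size l ≤ size l' := by
  induction h with
  | slnil => exact le_rfl
  | cons a h ih => simp; omega
  | cons_cons a h ih => simp; omega

theorem length_lt_size (l : List α) : l.length < size l := by
  induction l with
  | nil => simp
  | cons a l ih => simp; omega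

theorem size_bits_le (l : List Bool) : size l ≤ 4 * l.length + 1 := by
  induction l with
  | nil => simp
  | cons a l ih => have := size_bool_le a; simp; omega

end Size

/-! ### Basic functions -/

/-- A machine only sees words, so the same machine computes every function that induces the same map
on words. -/
theorem PTime.congr {α α' β β' A B : Type} {ea : α → List A} {eb : β → List B}
    {ea' : α' → List A} {eb' : β' → List B} {f : α → β} {f' : α' → β'} (h : PTime ea eb f)
    (i : α' → α) (hi : ∀ a, ea (i a) = ea' a) (hf : ∀ a, eb (f (i a)) = eb' (f' a)) :
    PTime ea' eb' f' := by
  obtain ⟨M⟩ := h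
  refine ⟨⟨M.toTM2ComputableAux, M.time, fun a => ?_⟩⟩
  rw [← hi, ← hf]
  exact M.outputsFun (i a)

/-- The counter holds the number of subtrees still to be read after the current one: a node symbol
adds one, a leaf removes one, and a leaf at counter `0` ends the tree. The flag `e` tells whether
the tree is copied or skipped. -/
theorem transduce_word {Q : Type} {δ : Q → Bool → Bool → Q × CounterOp × List Bool}
    {fin : Q → List Bool} {q q' : Q} (e : Bool)
    (h₁ : ∀ z, δ q z true = (q, .inc, if e then [true] else []))
    (h₂ : δ q false false = (q, .dec, if e then [false] else []))
    (h₃ : δ q true false = (q', .keep, if e then [false] else [])) (t : STree) (c : ℕ)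
    (l : List Bool) :
    transduce δ fin q c (t.word ++ l) = (if e then t.word else []) ++
      (if c = 0 then transduce δ fin q' 0 l else transduce δ fin q (c - 1) l) := by
  induction t generalizing c l with
  | nil =>
    cases c with
    | zero => simp [STree.word, transduce, h₃, CounterOp.app]
    | succ c => simp [STree.word, transduce, h₂, CounterOp.app]
  | node a b iha ihb =>
    simp only [STree.word, List.cons_append, transduce, h₁, CounterOp.app, List.append_assoc]
    rw [iha, if_neg (Nat.succ_ne_zero c), Nat.add_sub_cancel, ihb]
    cases e <;> simp

theorem PF.car : PF STree.car := by
  refine PTime.transduce (Q := Fin 3) (fun q z b => match q, z, b with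
    | 0, _, true => (1, .keep, [])
    | 0, _, false => (2, .keep, [false])
    | 1, _, true => (1, .inc, [true])
    | 1, false, false => (1, .dec, [false])
    | 1, true, false => (2, .keep, [false])
    | 2, _, _ => (2, .keep, [])) (fun _ => []) 0 fun t => ?_
  have h₂ : ∀ l c, KOWF.transduce (Q := Fin 3) (fun q z b => match q, z, b with
    | 0, _, true => (1, .keep, [])
    | 0, _, false => (2, .keep, [false])
    | 1, _, true => (1, .inc, [true])
    | 1, false, false => (1, .dec, [false])
    | 1, true, false => (2, .keep, [false])
    | 2, _, _ => (2, .keep, [])) (fun _ => ([] : List Bool)) 2 c l = [] := by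
    intro l
    induction l with
    | nil => intro; rfl
    | cons b l ih => intro c; exact ih c
  cases t with
  | nil => rfl
  | node l r =>
    refine (transduce_word (q := 1) (q' := 2) true ?_ ?_ ?_ l 0 r.word).trans ?_
    · intro z; cases z <;> rfl
    · rfl
    · rfl
    · simp only [if_true, h₂, List.append_nil]; rfl

theorem PF.cdr : PF STree.cdr := by
  refine PTime.transduce (Q := Fin 3) (fun q z b => match q, z, b with
    | 0, _, true => (1, .keep, [])
    | 0, _, false => (2, .keep, [false])
    | 1, _, true => (1, .inc, [])
    | 1, false, false => (1, .dec, [])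
    | 1, true, false => (2, .keep, [])
    | 2, _, b => (2, .keep, [b])) (fun _ => []) 0 fun t => ?_
  have h₂ : ∀ l c, KOWF.transduce (Q := Fin 3) (fun q z b => match q, z, b with
    | 0, _, true => (1, .keep, [])
    | 0, _, false => (2, .keep, [false])
    | 1, _, true => (1, .inc, [])
    | 1, false, false => (1, .dec, [])
    | 1, true, false => (2, .keep, [])
    | 2, _, b => (2, .keep, [b])) (fun _ => ([] : List Bool)) 2 c l = l := by
    intro l
    induction l with
    | nil => intro; rfl
    | cons b l ih => intro c; exact congrArg (b :: ·) (ih c)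
  cases t with
  | nil => rfl
  | node l r =>
    refine (transduce_word (q := 1) (q' := 2) false ?_ ?_ ?_ l 0 r.word).trans ?_
    · intro z; cases z <;> rfl
    · rfl
    · rfl
    · simp only [if_true, h₂]; rfl

theorem PF.select : PF STree.select := by
  -- State `1` reads the root of the condition. A leaf leads to `2`, which opens the pair of
  -- alternatives, and `4`, which skips the first one. A node leads to `3`, which skips the two
  -- subtrees of the condition, and `5`, which opens the pair. State `6` copies the chosen
  -- alternative and `7` ignores the rest.
  refine PTime.transduce (Q := Fin 8) (fun q z b => match q, z, b with
    | 0, _, true => (1, .keep, [])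
    | 0, _, false => (7, .keep, [false])
    | 1, _, false => (2, .keep, [])
    | 1, _, true => (3, .inc, [])
    | 2, _, true => (4, .keep, [])
    | 2, _, false => (7, .keep, [false])
    | 3, _, true => (3, .inc, [])
    | 3, false, false => (3, .dec, [])
    | 3, true, false => (5, .keep, [])
    | 4, _, true => (4, .inc, [])
    | 4, false, false => (4, .dec, [])
    | 4, true, false => (6, .keep, [])
    | 5, _, true => (6, .keep, [])
    | 5, _, false => (7, .keep, [false])
    | 6, _, true => (6, .inc, [true])
    | 6, false, false => (6, .dec, [false])
    | 6, true, false => (7, .keep, [false])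
    | 7, _, _ => (7, .keep, [])) (fun _ => []) 0 fun t => ?_
  generalize hδ : (fun (q : Fin 8) (z b : Bool) => _ : Fin 8 → Bool → Bool → Fin 8 × CounterOp × List Bool) = δ
  have h₇ : ∀ l c, KOWF.transduce δ (fun _ => ([] : List Bool)) 7 c l = [] := by
    intro l
    induction l with
    | nil => intro; rfl
    | cons b l ih => intro c; subst hδ; exact ih c
  have h₃ := transduce_word (δ := δ) (fin := fun _ => []) (q := 3) (q' := 5) false
    (by subst hδ; intro z; cases z <;> rfl) (by subst hδ; rfl) (by subst hδ; rfl)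
  have h₄ := transduce_word (δ := δ) (fin := fun _ => []) (q := 4) (q' := 6) false
    (by subst hδ; intro z; cases z <;> rfl) (by subst hδ; rfl) (by subst hδ; rfl)
  have h₆ := transduce_word (δ := δ) (fin := fun _ => []) (q := 6) (q' := 7) true
    (by subst hδ; intro z; cases z <;> rfl) (by subst hδ; rfl) (by subst hδ; rfl)
  have hstep : ∀ (q q' : Fin 8) (c : ℕ) (b : Bool) (l : List Bool) (o : CounterOp) (w : List Bool),
      δ q (c == 0) b = (q', o, w) → KOWF.transduce δ (fun _ => []) q c (b :: l) =
        w ++ KOWF.transduce δ (fun _ => []) q' (o.app c) l := by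
    intro q q' c b l o w h
    rw [KOWF.transduce, h]
  change KOWF.transduce δ (fun _ => []) 0 0 t.word = t.select.word
  rcases t with _ | ⟨c, t⟩
  · rw [STree.word, hstep 0 7 0 false [] .keep [false] (by subst hδ; rfl), h₇]; rfl
  rw [STree.word, hstep 0 1 0 true _ .keep [] (by subst hδ; rfl), CounterOp.app, List.nil_append]
  rcases c with _ | ⟨c₁, c₂⟩
  · rw [STree.word, List.cons_append,
      hstep 1 2 0 false _ .keep [] (by subst hδ; rfl), CounterOp.app, List.nil_append,
      List.nil_append]
    rcases t with _ | ⟨a, b⟩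
    · rw [STree.word, hstep 2 7 0 false [] .keep [false] (by subst hδ; rfl), h₇]; rfl
    · rw [STree.word, hstep 2 4 0 true _ .keep [] (by subst hδ; rfl), h₄]
      have := h₆ b 0 []
      simp only [List.append_nil, if_true, h₇] at this
      simpa [CounterOp.app, STree.select] using this
  · rw [STree.word, List.cons_append, hstep 1 3 0 true _ .inc [] (by subst hδ; rfl),
      List.append_assoc, h₃, CounterOp.app, if_neg (by simp), h₃]
    simp only [Bool.false_eq_true, if_false, List.nil_append, zero_add, Nat.sub_self, if_true]
    rcases t with _ | ⟨a, b⟩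
    · rw [STree.word, hstep 5 7 0 false [] .keep [false] (by subst hδ; rfl), h₇]; rfl
    · rw [STree.word, hstep 5 6 0 true _ .keep [] (by subst hδ; rfl), h₆]
      simp [CounterOp.app, h₇, STree.select]

/-! ### Closure rules for typed polynomial-time functions -/

section Rules

variable {α β γ δ : Type} [Code α] [Code β] [Code γ] [Code δ]

@[fun_prop]
theorem PF.id' : PF fun a : α => a :=
  ⟨idComputableInPolyTime code⟩

@[fun_prop]
theorem PF.comp {g : β → γ} {f : α → β} (hg : PF g) (hf : PF f) : PF fun a => g (f a) :=
  PTime.comp hg hf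

@[fun_prop]
theorem PF.const (b : β) : PF fun _ : α => b := by
  refine PTime.transduce (Q := Unit) (fun q _ _ => (q, .keep, [])) (fun _ => code b) () fun a => ?_
  generalize code a = l
  induction l with
  | nil => rfl
  | cons x l ih => exact ih

@[fun_prop]
theorem PF.prodMk {f : α → β} {g : α → γ} (hf : PF f) (hg : PF g) : PF fun a => (f a, g a) :=
  PTime.pair hf hg true fun _ => rfl

/-- A typed function is computable in polynomial time if a function of trees that represents it
is. -/
theorem PF.of_tree {F : STree → STree} (hF : PF F) {f : α → β}
    (h : ∀ a, F (Code.enc a) = Code.enc (f a)) : PF f :=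
  PTime.congr hF Code.enc (fun _ => rfl) fun a => congrArg STree.word (h a)

theorem PF.of_enc_eq {f : α → β} (h : ∀ a, Code.enc a = Code.enc (f a)) : PF f :=
  PF.of_tree PF.id' h

@[fun_prop]
theorem PF.fst : PF fun p : α × β => p.1 := PF.of_tree PF.car fun _ => rfl

@[fun_prop]
theorem PF.snd : PF fun p : α × β => p.2 := PF.of_tree PF.cdr fun _ => rfl

@[fun_prop]
theorem PF.fst' {f : α → β × γ} (hf : PF f) : PF fun a => (f a).1 := PF.fst.comp hf

@[fun_prop]
theorem PF.snd' {f : α → β × γ} (hf : PF f) : PF fun a => (f a).2 := PF.snd.comp hf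

@[fun_prop]
theorem PF.cond {c : α → Bool} {f g : α → β} (hc : PF c) (hf : PF f) (hg : PF g) :
    PF fun a => bif c a then f a else g a := by
  have h : PF fun p : Bool × β × β => bif p.1 then p.2.1 else p.2.2 :=
    PF.of_tree PF.select fun p => by rcases p with ⟨_ | _, a, b⟩ <;> rfl
  exact h.comp (hc.prodMk (hf.prodMk hg))

@[fun_prop]
theorem PF.ite {p : α → Prop} [DecidablePred p] {f g : α → β} (hc : PF fun a => decide (p a))
    (hf : PF f) (hg : PF g) : PF fun a => if p a then f a else g a := by
  have := hc.cond hf hg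
  simpa only [Bool.cond_decide] using this

theorem PF.bool₂ (o : Bool → Bool → Bool) {f g : α → Bool} (hf : PF f) (hg : PF g) :
    PF fun a => o (f a) (g a) := by
  have := hf.cond (hg.cond (PF.const (o true true)) (PF.const (o true false)))
    (hg.cond (PF.const (o false true)) (PF.const (o false false)))
  convert this using 2 with a
  cases f a <;> cases g a <;> rfl

@[fun_prop]
theorem PF.and {f g : α → Bool} (hf : PF f) (hg : PF g) : PF fun a => f a && g a :=
  PF.bool₂ (· && ·) hf hg

@[fun_prop]
theorem PF.or {f g : α → Bool} (hf : PF f) (hg : PF g) : PF fun a => f a || g a :=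
  PF.bool₂ (· || ·) hf hg

@[fun_prop]
theorem PF.not {f : α → Bool} (hf : PF f) : PF fun a => !f a :=
  PF.bool₂ (fun b _ => !b) hf hf

@[fun_prop]
theorem PF.decide_and {p q : α → Prop} [DecidablePred p] [DecidablePred q]
    (hp : PF fun a => decide (p a)) (hq : PF fun a => decide (q a)) :
    PF fun a => decide (p a ∧ q a) := by
  simpa only [Bool.decide_and] using hp.and hq

@[fun_prop]
theorem PF.listCons {f : α → β} {g : α → List β} (hf : PF f) (hg : PF g) :
    PF fun a => f a :: g a :=
  (PF.of_enc_eq (f := fun p : β × List β => p.1 :: p.2) fun _ => rfl).comp (hf.prodMk hg)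

@[fun_prop]
theorem PF.listTail {f : α → List β} (hf : PF f) : PF fun a => (f a).tail :=
  (PF.of_tree PF.cdr (f := fun l : List β => l.tail)
    fun l => by cases l <;> rfl).comp hf

@[fun_prop]
theorem PF.listHeadD {f : α → List β} {g : α → β} (hf : PF f) (hg : PF g) :
    PF fun a => (f a).headD (g a) := by
  have h : PF fun t : STree => STree.select (.node t.car (.node t.car.car t.cdr)) := by
    have hnode : PF fun p : STree × STree => STree.node p.1 p.2 := PF.of_enc_eq fun _ => rfl
    exact PF.select.comp (hnode.comp (PF.car.prodMk (hnode.comp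
      ((PF.car.comp PF.car).prodMk PF.cdr))))
  exact (PF.of_tree h (f := fun p : List β × β => p.1.headD p.2)
    fun p => by rcases p with ⟨_ | _, _⟩ <;> rfl).comp (hf.prodMk hg)

@[fun_prop]
theorem PF.listIsEmpty {f : α → List β} (hf : PF f) : PF fun a => (f a).isEmpty := by
  have h : PF fun t : STree => STree.select (.node t (.node .nil (.node .nil .nil))) := by
    have hnode : PF fun p : STree × STree => STree.node p.1 p.2 := PF.of_enc_eq fun _ => rfl
    exact PF.select.comp (hnode.comp (PF.id'.prodMk (PF.const _)))
  exact (PF.of_tree h (f := fun l : List β => l.isEmpty)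
    fun l => by rcases l with _ | _ <;> rfl).comp hf

@[fun_prop]
theorem PF.optionSome {f : α → β} (hf : PF f) : PF fun a => some (f a) :=
  PTime.congr (hf.listCons (PF.const ([] : List β))) (fun a => a) (fun _ => rfl) fun _ => rfl

@[fun_prop]
theorem PF.toList {f : α → Option β} (hf : PF f) : PF fun a => (f a).toList :=
  (PF.of_enc_eq (f := fun o : Option β => o.toList) fun _ => rfl).comp hf

@[fun_prop]
theorem PF.getD {f : α → Option β} {g : α → β} (hf : PF f) (hg : PF g) :
    PF fun a => (f a).getD (g a) := by
  have := hf.toList.listHeadD hg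
  convert this using 2 with a
  cases f a <;> rfl

@[fun_prop]
theorem PF.isSome {f : α → Option β} (hf : PF f) : PF fun a => (f a).isSome := by
  have := hf.toList.listIsEmpty.not
  convert this using 2 with a
  cases f a <;> rfl

@[fun_prop]
theorem PF.isNone {f : α → Option β} (hf : PF f) : PF fun a => (f a).isNone := by
  have := hf.toList.listIsEmpty
  convert this using 2 with a
  cases f a <;> rfl

@[fun_prop]
theorem PF.listHead? {f : α → List β} (hf : PF f) : PF fun a => (f a).head? := by
  have h : PF fun t : STree => STree.select (.node t (.node (.node t.car .nil) .nil)) := by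
    have hnode : PF fun p : STree × STree => STree.node p.1 p.2 := PF.of_enc_eq fun _ => rfl
    exact PF.select.comp (hnode.comp (PF.id'.prodMk (hnode.comp ((hnode.comp
      (PF.car.prodMk (PF.const _))).prodMk (PF.const _)))))
  exact (PF.of_tree h (f := fun l : List β => l.head?)
    fun l => by rcases l with _ | _ <;> rfl).comp hf

theorem PF.size_le {f : α → β} (hf : PF f) : ∃ P : Polynomial ℕ, ∀ a, size (f a) ≤ P.eval (size a) :=
  PTime.length_le hf

end Rules

end KOWF

namespace KOWF

open Turing Function

/-! ### Folds, and a library of list and number functions -/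

section Fold

variable {α ι τ : Type} [Code α] [Code ι] [Code τ]

/-- The fold is a loop on triples of remaining list, parameter and accumulator. The list comes first
so that its emptiness is visible in the second symbol, and `Q` bounds all partial folds. -/
theorem PF.foldl_of_bound [Inhabited ι] {l : α → List ι} {g : α → τ → ι → τ} {s₀ : α → τ}
    (hl : PF l) (hs : PF s₀) (hg : PF fun p : α × τ × ι => g p.1 p.2.1 p.2.2) (Q : Polynomial ℕ)
    (hQ : ∀ a n, size (((l a).take n).foldl (g a) (s₀ a)) ≤ Q.eval (size a)) :
    PF fun a => (l a).foldl (g a) (s₀ a) := by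
  let step : List ι × α × τ → List ι × α × τ := fun t =>
    (t.1.tail, t.2.1, g t.2.1 t.2.2 (t.1.headD default))
  have hstep : PF step := by fun_prop
  have hini : PF fun a => (l a, a, s₀ a) := by fun_prop
  have hiter : ∀ (n : ℕ) (a : α) (l : List ι) (s : τ), n ≤ l.length →
      step^[n] (l, a, s) = (l.drop n, a, (l.take n).foldl (g a) s) := by
    intro n a
    induction n with
    | zero => simp
    | succ n ih =>
      intro l s h
      cases l with
      | nil => simp at h
      | cons i l =>
        rw [iterate_succ_apply]
        exact ih l (g a s i) (by simpa using h)
  have hloop := PTime.loop (es := (code : List ι × α × τ → _)) (step := step)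
    (fun t => !t.1.isEmpty) hstep (by
      rintro ⟨l, a, s⟩
      refine ⟨true, _, code_pair _ _, ?_⟩
      cases l <;> simp) (fun a : α => (l a, a, s₀ a)) (fun a => (l a).length)
    (fun a => by simp [hiter _ a (l a) (s₀ a) le_rfl])
    (fun a i hi => by simpa [hiter _ a (l a) (s₀ a) hi.le] using hi)
    (.X + .X + Q + 2)
    (fun a => by
      have h₁ := length_lt_size (l a)
      have h₂ := size_pair (l a) (a, s₀ a)
      simp only [size] at h₁ h₂
      simp only [Polynomial.eval_add, Polynomial.eval_X]
      omega)
    (fun a i hi => by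
      rw [hiter _ a (l a) (s₀ a) hi]
      have h₁ := hQ a i
      have h₂ := size_le_of_sublist (List.drop_sublist i (l a))
      have h₃ := size_pair (l a) (a, s₀ a)
      have h₄ := size_pair a (s₀ a)
      have h₅ := eval_mono Q (show size a ≤ size (l a, a, s₀ a) by omega)
      simp only [size_pair] at h₃ h₄
      change size _ ≤ Polynomial.eval (size (l a, a, s₀ a)) _
      simp only [size_pair, Polynomial.eval_add, Polynomial.eval_X, Polynomial.eval_ofNat] at h₅ ⊢
      omega)
  have h : PF fun a => (([] : List ι), a, (l a).foldl (g a) (s₀ a)) :=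
    (PTime.comp hloop (PTime.congr hini (eb' := fun a => code (l a, a, s₀ a)) (f' := fun a => a)
      (fun a => a) (fun _ => rfl) fun _ => rfl)).congr (fun a => a) (fun _ => rfl) fun a => by
      rw [hiter _ a (l a) (s₀ a) le_rfl, List.drop_length, List.take_length]
  exact h.snd'.snd'

/-- Folds whose state, as long as it has a property `I`, stays small. -/
theorem PF.foldl_of_invariant [Inhabited ι] {l : α → List ι} {g : α → τ → ι → τ} {s₀ : α → τ}
    (hl : PF l) (hs : PF s₀) (hg : PF fun p : α × τ × ι => g p.1 p.2.1 p.2.2)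
    (I : α → τ → Prop) (h₀ : ∀ a, I a (s₀ a)) (hI : ∀ a s, ∀ i ∈ l a, I a s → I a (g a s i))
    (Q : Polynomial ℕ) (hQ : ∀ a s, I a s → size s ≤ Q.eval (size a)) :
    PF fun a => (l a).foldl (g a) (s₀ a) := by
  refine PF.foldl_of_bound hl hs hg Q fun a n => hQ a _ ?_
  have : ∀ (l' : List ι) (s : τ), (∀ i ∈ l', i ∈ l a) → I a s → I a (l'.foldl (g a) s) := by
    intro l'
    induction l' with
    | nil => intro s _ h; exact h
    | cons i l' ih =>
      intro s h hs
      exact ih _ (fun j hj => h j (List.mem_cons_of_mem _ hj)) (hI a s i (h i (by simp)) hs)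
  exact this _ _ (fun i hi => List.mem_of_mem_take hi) (h₀ a)

/-- Folds whose state grows only by an amount that is bounded in terms of the parameters. -/
theorem PF.foldl_of_growth [Inhabited ι] {l : α → List ι} {g : α → τ → ι → τ} {s₀ : α → τ}
    (hl : PF l) (hs : PF s₀) (hg : PF fun p : α × τ × ι => g p.1 p.2.1 p.2.2) (G : Polynomial ℕ)
    (hG : ∀ a s, ∀ i ∈ l a, size (g a s i) ≤ size s + G.eval (size a)) :
    PF fun a => (l a).foldl (g a) (s₀ a) := by
  obtain ⟨P₁, hP₁⟩ := hl.size_le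
  obtain ⟨P₂, hP₂⟩ := hs.size_le
  refine PF.foldl_of_bound hl hs hg (P₂ + P₁ * G) fun a n => ?_
  have : ∀ (l' : List ι) (s : τ), (∀ i ∈ l', i ∈ l a) →
      size (l'.foldl (g a) s) ≤ size s + l'.length * G.eval (size a) := by
    intro l'
    induction l' with
    | nil => intro s _; simp
    | cons i l' ih =>
      intro s h
      have h₁ := ih (g a s i) (fun j hj => h j (List.mem_cons_of_mem _ hj))
      have h₂ := hG a s i (h i (by simp))
      rw [List.length_cons, Nat.succ_mul]
      exact h₁.trans (by omega)
  refine (this _ _ fun i hi => List.mem_of_mem_take hi).trans ?_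
  simp only [Polynomial.eval_add, Polynomial.eval_mul]
  gcongr
  · exact hP₂ a
  · have h₁ := length_lt_size (l a)
    have h₂ := hP₁ a
    simp only [List.length_take]
    omega

/-- Iteration with growth bounded in terms of the parameters. -/
theorem PF.iterate {n : α → ℕ} {g : α → τ → τ} {s₀ : α → τ}
    (hn : PF n) (hs : PF s₀) (hg : PF fun p : α × τ => g p.1 p.2) (G : Polynomial ℕ)
    (hG : ∀ a s, size (g a s) ≤ size s + G.eval (size a)) : PF fun a => (g a)^[n a] (s₀ a) := by
  have hl : PF fun a => List.replicate (n a) () :=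
    (PF.of_enc_eq (f := fun n : ℕ => List.replicate n ()) fun _ => rfl).comp hn
  have h := PF.foldl_of_growth (g := fun a s _ => g a s) hl hs
    (hg.comp (PF.fst.prodMk PF.snd.fst')) G fun a s _ _ => hG a s
  convert h using 2 with a
  generalize s₀ a = s
  induction n a generalizing s with
  | zero => rfl
  | succ k ih => rw [List.replicate_succ, List.foldl_cons, iterate_succ_apply, ih]

theorem PF.iterate_of_invariant {n : α → ℕ} {g : α → τ → τ} {s₀ : α → τ}
    (hn : PF n) (hs : PF s₀) (hg : PF fun p : α × τ => g p.1 p.2) (I : α → τ → Prop)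
    (h₀ : ∀ a, I a (s₀ a)) (hI : ∀ a s, I a s → I a (g a s))
    (Q : Polynomial ℕ) (hQ : ∀ a s, I a s → size s ≤ Q.eval (size a)) :
    PF fun a => (g a)^[n a] (s₀ a) := by
  have hl : PF fun a => List.replicate (n a) () :=
    (PF.of_enc_eq (f := fun n : ℕ => List.replicate n ()) fun _ => rfl).comp hn
  have h := PF.foldl_of_invariant (g := fun a s _ => g a s) hl hs
    (hg.comp (PF.fst.prodMk PF.snd.fst')) I h₀ (fun a s _ _ => hI a s) Q hQ
  convert h using 2 with a
  generalize s₀ a = s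
  induction n a generalizing s with
  | zero => rfl
  | succ k ih => rw [List.replicate_succ, List.foldl_cons, iterate_succ_apply, ih]

end Fold

section Lists

variable {α β ι κ : Type} [Code α] [Code β] [Code ι] [Code κ]

@[fun_prop]
theorem PF.reverse [Inhabited ι] {l : α → List ι} (hl : PF l) : PF fun a => (l a).reverse := by
  have h : PF fun l : List ι => l.foldl (fun s i => i :: s) [] :=
    PF.foldl_of_growth (l := fun l : List ι => l) (g := fun _ s i => i :: s) (s₀ := fun _ => [])
      (by fun_prop) (by fun_prop) (by fun_prop) (.X + 1) fun a s i hi => by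
        have := size_lt_of_mem hi
        simp; omega
  convert h.comp hl using 2 with a
  simp

@[fun_prop]
theorem PF.append [Inhabited ι] {l l' : α → List ι} (hl : PF l) (hl' : PF l') :
    PF fun a => l a ++ l' a := by
  have h : PF fun p : List ι × List ι => p.1.reverse.foldl (fun s i => i :: s) p.2 :=
    PF.foldl_of_growth (l := fun p : List ι × List ι => p.1.reverse) (g := fun _ s i => i :: s)
      (s₀ := fun p => p.2) (by fun_prop) (by fun_prop) (by fun_prop) (.X + 1) fun a s i hi => by
        obtain ⟨x, y⟩ := a
        have := size_lt_of_mem (List.mem_reverse.1 hi)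
        simp at this ⊢
        omega
  convert h.comp (hl.prodMk hl') using 2 with a
  simp

theorem PF.flatMap [Inhabited ι] [Inhabited κ] {l : α → List ι} {f : α → ι → List κ} (hl : PF l)
    (hf : PF fun p : α × ι => f p.1 p.2) : PF fun a => (l a).flatMap (f a) := by
  obtain ⟨P₁, hP₁⟩ := hl.size_le
  obtain ⟨P₂, hP₂⟩ := hf.size_le
  have h := PF.foldl_of_growth (l := l) (g := fun a s i => s ++ f a i) (s₀ := fun _ => []) hl
    (by fun_prop) ((by fun_prop : PF fun p : α × List κ × ι => p.2.1).append
      (hf.comp (PF.fst.prodMk PF.snd.snd'))) (P₂.comp (.X + P₁ + 1)) fun a s i hi => by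
        have h₁ := size_lt_of_mem hi
        have h₂ := hP₁ a
        have h₃ := hP₂ (a, i)
        have h₄ := size_append s (f a i)
        have h₅ := eval_mono P₂ (show size (a, i) ≤ size a + P₁.eval (size a) + 1 by simp; omega)
        simp at h₅ h₃ ⊢
        omega
  convert h using 2 with a
  rw [List.flatMap_eq_foldl]

theorem PF.map [Inhabited ι] [Inhabited κ] {l : α → List ι} {f : α → ι → κ} (hl : PF l)
    (hf : PF fun p : α × ι => f p.1 p.2) : PF fun a => (l a).map (f a) := by
  have h := PF.flatMap (f := fun a i => [f a i]) hl (by fun_prop)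
  convert h using 2 with a
  induction l a <;> simp_all

theorem PF.filter [Inhabited ι] {l : α → List ι} {f : α → ι → Bool} (hl : PF l)
    (hf : PF fun p : α × ι => f p.1 p.2) : PF fun a => (l a).filter (f a) := by
  have h := PF.flatMap (f := fun a i => bif f a i then [i] else []) hl (by fun_prop)
  convert h using 2 with a
  induction l a with
  | nil => rfl
  | cons i l ih => cases h : f a i <;> simp [h, ih]

theorem PF.find? [Inhabited ι] {l : α → List ι} {f : α → ι → Bool} (hl : PF l)
    (hf : PF fun p : α × ι => f p.1 p.2) : PF fun a => (l a).find? (f a) := by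
  have h := (PF.filter hl hf).listHead?
  simpa only [List.head?_filter] using h

/-! Numbers are represented in unary. -/

@[fun_prop]
theorem PF.succ {f : α → ℕ} (hf : PF f) : PF fun a => f a + 1 :=
  PTime.congr ((PF.const ()).listCons ((PF.of_enc_eq (f := fun n : ℕ => List.replicate n ())
    fun _ => rfl).comp hf)) (fun a => a) (fun _ => rfl) fun _ => rfl

theorem PF.replicate_unit {f : α → ℕ} (hf : PF f) : PF fun a => List.replicate (f a) () :=
  (PF.of_enc_eq (f := fun n : ℕ => List.replicate n ()) fun _ => rfl).comp hf

@[fun_prop]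
theorem PF.pred {f : α → ℕ} (hf : PF f) : PF fun a => f a - 1 :=
  PTime.congr ((PF.replicate_unit hf).listTail) (fun a => a) (fun _ => rfl) fun a => by
    rw [List.tail_replicate]; rfl

@[fun_prop]
theorem PF.length [Inhabited ι] {l : α → List ι} (hl : PF l) : PF fun a => (l a).length := by
  have h : PF fun l : List ι => l.foldl (fun s _ => s + 1) 0 :=
    PF.foldl_of_growth (l := fun l : List ι => l) (g := fun _ s _ => s + 1) (s₀ := fun _ => 0)
      (by fun_prop) (by fun_prop) (by fun_prop) 2 fun a s i hi => by simp; omega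
  convert h.comp hl using 2 with a
  simp

@[fun_prop]
theorem PF.add {f g : α → ℕ} (hf : PF f) (hg : PF g) : PF fun a => f a + g a := by
  have h := PF.iterate (g := fun (_ : α) (s : ℕ) => s + 1) hg hf (by fun_prop) 2
    fun a s => by simp; omega
  convert h using 2 with a
  simp

@[fun_prop]
theorem PF.sub {f g : α → ℕ} (hf : PF f) (hg : PF g) : PF fun a => f a - g a := by
  have h := PF.iterate (g := fun (_ : α) (s : ℕ) => s - 1) hg hf (by fun_prop) 0
    fun a s => by simp
  convert h using 2 with a
  induction g a with
  | zero => rfl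
  | succ k ih => rw [iterate_succ_apply', ← ih]; omega

@[fun_prop]
theorem PF.mul {f g : α → ℕ} (hf : PF f) (hg : PF g) : PF fun a => f a * g a := by
  have h : PF fun p : ℕ × ℕ => (fun s => s + p.1)^[p.2] 0 :=
    PF.iterate (n := fun p : ℕ × ℕ => p.2) (g := fun p s => s + p.1) (by fun_prop) (by fun_prop)
      (by fun_prop) .X fun a s => by
        have := size_pair a.1 a.2
        simp at this ⊢
        omega
  convert h.comp (hf.prodMk hg) using 2 with a
  simp only
  induction g a with
  | zero => rfl
  | succ k ih => rw [iterate_succ_apply', ← ih]; ring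

/-- In unary notation polynomially large values are affordable, and addition and multiplication
suffice. -/
theorem PF.eval (P : Polynomial ℕ) {f : α → ℕ} (hf : PF f) : PF fun a => P.eval (f a) := by
  induction P using Polynomial.induction_on' with
  | add p q hp hq => simpa only [Polynomial.eval_add] using hp.add hq
  | monomial n c =>
    simp only [Polynomial.eval_monomial]
    refine (PF.const c).mul ?_
    induction n with
    | zero => simpa using PF.const _
    | succ n ih => simpa only [pow_succ] using ih.mul hf

@[fun_prop]
theorem PF.decide_le {f g : α → ℕ} (hf : PF f) (hg : PF g) : PF fun a => decide (f a ≤ g a) := by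
  have h := (PF.replicate_unit (hf.sub hg)).listIsEmpty
  convert h using 2 with a
  rw [Bool.eq_iff_iff]
  simp [Nat.sub_eq_zero_iff_le]

@[fun_prop]
theorem PF.decide_lt {f g : α → ℕ} (hf : PF f) (hg : PF g) : PF fun a => decide (f a < g a) :=
  PF.decide_le hf.succ hg

@[fun_prop]
theorem PF.drop {n : α → ℕ} {l : α → List ι} (hn : PF n) (hl : PF l) :
    PF fun a => (l a).drop (n a) := by
  have h := PF.iterate (g := fun (_ : α) (s : List ι) => s.tail) hn hl (by fun_prop) 0
    fun a s => by simpa using size_le_of_sublist (List.tail_sublist s)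
  convert h using 2 with a
  induction n a with
  | zero => rfl
  | succ k ih => rw [iterate_succ_apply', ← ih, List.tail_drop]

@[fun_prop]
theorem PF.take [Inhabited ι] {n : α → ℕ} {l : α → List ι} (hn : PF n) (hl : PF l) :
    PF fun a => (l a).take (n a) := by
  have h : PF fun a => ((l a).reverse.drop ((l a).length - n a)).reverse := by fun_prop
  convert h using 2 with a
  rw [List.drop_reverse, List.reverse_reverse]
  rcases le_total (n a) (l a).length with h | h
  · congr 1; omega
  · rw [List.take_of_length_le h, List.take_of_length_le (by omega)]

@[fun_prop]
theorem PF.replicate {n : α → ℕ} {f : α → ι} (hn : PF n) (hf : PF f) :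
    PF fun a => List.replicate (n a) (f a) := by
  obtain ⟨P, hP⟩ := hf.size_le
  have h := PF.iterate (g := fun (a : α) (s : List ι) => f a :: s) hn (PF.const []) (by fun_prop)
    (P + 1) fun a s => by have := hP a; simp; omega
  convert h using 2 with a
  induction n a with
  | zero => rfl
  | succ k ih => rw [iterate_succ_apply', ← ih, List.replicate_succ]

theorem foldl_replicate_range (k : ℕ) :
    (List.replicate k ()).foldl (fun (s : List ℕ) _ => s ++ [s.length]) [] = List.range k := by
  induction k with
  | zero => rfl
  | succ k ih =>
    rw [List.replicate_succ', List.foldl_append, ih, List.range_succ]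
    simp

theorem size_range_le (k : ℕ) : size (List.range k) ≤ k * (2 * k + 2) + 1 := by
  suffices h : ∀ m ≤ k, size (List.range m) ≤ m * (2 * k + 2) + 1 from h k le_rfl
  intro m
  induction m with
  | zero => simp
  | succ m ih =>
    intro h
    have h₁ := size_append (List.range m) [m]
    have h₂ := ih (by omega)
    rw [List.range_succ, Nat.succ_mul]
    simp at h₁
    omega

@[fun_prop]
theorem PF.range {n : α → ℕ} (hn : PF n) : PF fun a => List.range (n a) := by
  have h : PF fun n : ℕ => (List.replicate n ()).foldl
      (fun (s : List ℕ) _ => s ++ [s.length]) [] := by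
    -- The appended number is the current length of the accumulator, so the growth is not bounded by
    -- the parameter for arbitrary accumulators; the partial folds are bounded directly.
    refine PF.foldl_of_bound (l := fun n : ℕ => List.replicate n ())
      (g := fun _ s _ => s ++ [s.length]) (s₀ := fun _ => [])
      (PF.replicate_unit (by fun_prop)) (by fun_prop) (by fun_prop) (.X * (2 * .X + 2) + 1) ?_
    intro n m
    rw [List.take_replicate, foldl_replicate_range]
    refine (size_range_le _).trans ?_
    have h : min m n ≤ size n := by simp; omega
    simp only [Polynomial.eval_add, Polynomial.eval_mul, Polynomial.eval_X, Polynomial.eval_ofNat,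
      Polynomial.eval_one]
    gcongr
  simpa only [foldl_replicate_range] using h.comp hn

/-- Compare the first element of the rest of a list with a symbol, and remove it. -/
def matchStep (s : Bool × List Bool) (i : Bool) : Bool × List Bool :=
  (s.1 && !s.2.isEmpty && ((s.2.headD false && i) || (!(s.2.headD false) && !i)), s.2.tail)

theorem PF.decide_eq_bits {f g : α → List Bool} (hf : PF f) (hg : PF g) :
    PF fun a => decide (f a = g a) := by
  have h : PF fun p : List Bool × List Bool => p.1.foldl matchStep (true, p.2) := by
    refine PF.foldl_of_growth (l := fun p : List Bool × List Bool => p.1)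
      (g := fun _ s i => matchStep s i) (by fun_prop) (by fun_prop) (by unfold matchStep; fun_prop)
      3 fun a s i _ => ?_
    have h₁ := size_le_of_sublist (List.tail_sublist s.2)
    have h₂ := size_bool_le (matchStep s i).1
    change size ((matchStep s i).1, s.2.tail) ≤ size (s.1, s.2) + _
    simp only [size_pair, Polynomial.eval_ofNat]
    omega
  have h' := (h.fst'.and h.snd'.listIsEmpty).comp (hf.prodMk hg)
  convert h' using 2 with a
  -- The fold over `l` consumes `l'` in parallel. Equality means that all symbols match and nothing
  -- of `l'` is left; the flag `b` is general for the induction.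
  have key : ∀ (l l' : List Bool) (b : Bool), (b && decide (l = l')) =
      ((l.foldl matchStep (b, l')).1 && (l.foldl matchStep (b, l')).2.isEmpty) := by
    intro l
    induction l with
    | nil => intro l' b; cases l' <;> simp
    | cons i l ih =>
      intro l' b
      rw [List.foldl_cons, matchStep, ← ih]
      cases l' with
      | nil => simp
      | cons j l' =>
        have : decide (i :: l = j :: l') = (decide (i = j) && decide (l = l')) := by
          rw [← Bool.decide_and]; simp only [List.cons.injEq]
        rw [this]
        cases i <;> cases j <;> simp
        all_goals exact congrArg (b && ·) (decide_eq_decide.2 Iff.rfl)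
  simpa using key (f a) (g a) true

/-- Making the word itself a value reduces equality in any coded type to equality of bit strings,
and lets structured data be output injectively. -/
theorem PF.codeWord {f : α → β} (hf : PF f) : PF fun a => code (f a) := by
  have h : PTime (KOWF.code : β → _) (KOWF.code : List Bool → _) fun b => code b := by
    refine PTime.transduce (Q := Unit) (fun q _ b => (q, .keep, true :: KOWF.code b))
      (fun _ => [false]) () fun b => ?_
    generalize KOWF.code b = l
    induction l with
    | nil => rfl
    | cons x l ih => exact congrArg (fun w => true :: (KOWF.code x ++ w)) ih
  exact PTime.comp h hf

@[fun_prop]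
theorem PF.decide_eq [DecidableEq β] {f g : α → β} (hf : PF f) (hg : PF g) :
    PF fun a => decide (f a = g a) := by
  simpa only [code_injective.eq_iff] using PF.decide_eq_bits hf.codeWord hg.codeWord

end Lists

end KOWF

namespace KOWF

open Turing Function

/-! ### Polynomial-time functions and algorithms on bit strings -/

theorem PTime.encodeBits : PTime (id : List Bool → List Bool) code fun l : List Bool => l := by
  refine PTime.transduce (Q := Unit) (fun q _ b => (q, .keep, true :: code b))
    (fun _ => [false]) () fun l => ?_
  change KOWF.transduce _ _ () 0 l = code l
  induction l with
  | nil => rfl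
  | cons x l ih => exact congrArg (fun w => true :: (code x ++ w)) ih

theorem PTime.decodeBits : PTime code (id : List Bool → List Bool) fun l : List Bool => l := by
  -- Each entry starts with a cons symbol, read in state `0`. The bit `false` follows as one leaf,
  -- the bit `true` as a node with two leaves, which states `2` and `3` consume.
  refine PTime.transduce (Q := Fin 4) (fun q _ b => match q, b with
    | 0, true => (1, .keep, [])
    | 0, false => (0, .keep, [])
    | 1, false => (0, .keep, [false])
    | 1, true => (2, .keep, [])
    | 2, _ => (3, .keep, [])
    | 3, _ => (0, .keep, [true])) (fun _ => []) 0 fun l => ?_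
  induction l with
  | nil => rfl
  | cons x l ih =>
    cases x
    · exact congrArg (false :: ·) ih
    · exact congrArg (true :: ·) ih

theorem PTime.encodeTape : PTime withTape code fun p : List Bool × List Bool => p := by
  refine PTime.transduce (Q := Fin 3) (fun q _ b => match q, b with
    | 0, .inl b => (1, .keep, true :: true :: code b)
    | 0, .inr b => (2, .keep, true :: false :: true :: code b)
    | 1, .inl b => (1, .keep, true :: code b)
    | 1, .inr b => (2, .keep, false :: true :: code b)
    | 2, .inr b => (2, .keep, true :: code b)
    | 2, .inl _ => (2, .keep, [])) (fun q => match q with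
    | 0 => [true, false, false]
    | 1 => [false, false]
    | 2 => [false]) 0 fun p => ?_
  generalize hδ : (fun (q : Fin 3) (z : Bool) (b : Bool ⊕ Bool) => _ :
    Fin 3 → Bool → Bool ⊕ Bool → Fin 3 × CounterOp × List Bool) = δ
  generalize hf : (fun q : Fin 3 => _ : Fin 3 → List Bool) = fin
  have h₂ : ∀ r : List Bool, KOWF.transduce δ fin 2 0 (r.map .inr) = code r := by
    intro r
    induction r with
    | nil => subst hf; rfl
    | cons b r ih =>
      rw [code_cons, ← ih]
      subst hδ
      rfl
  have h₁ : ∀ x r : List Bool, KOWF.transduce δ fin 1 0 (x.map .inl ++ r.map .inr) =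
      code x ++ code r := by
    intro x r
    induction x with
    | nil =>
      cases r with
      | nil => subst hf; rfl
      | cons b r =>
        rw [code_cons, ← h₂ r]
        subst hδ
        rfl
    | cons b x ih =>
      rw [code_cons, List.cons_append, List.append_assoc, ← ih]
      subst hδ
      rfl
  obtain ⟨_ | ⟨b, x⟩, r⟩ := p
  · cases r with
    | nil => subst hf; rfl
    | cons b r =>
      rw [code_pair, code_cons, ← h₂ r]
      subst hδ
      rfl
  · rw [code_pair, code_cons, List.cons_append, List.append_assoc, ← h₁ x r]
    subst hδ
    rfl

theorem PTime.decodeTape : PTime code withTape fun p : List Bool × List Bool => p := by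
  refine PTime.transduce (Q := Fin 9) (fun q _ b => match q, b with
    | 0, _ => (1, .keep, [])
    | 1, true => (2, .keep, [])
    | 1, false => (5, .keep, [])
    | 2, false => (1, .keep, [.inl false])
    | 2, true => (3, .keep, [])
    | 3, _ => (4, .keep, [])
    | 4, _ => (1, .keep, [.inl true])
    | 5, true => (6, .keep, [])
    | 5, false => (5, .keep, [])
    | 6, false => (5, .keep, [.inr false])
    | 6, true => (7, .keep, [])
    | 7, _ => (8, .keep, [])
    | 8, _ => (5, .keep, [.inr true])) (fun _ => []) 0 fun p => ?_
  generalize hδ : (fun (q : Fin 9) (z : Bool) (b : Bool) => _ :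
    Fin 9 → Bool → Bool → Fin 9 × CounterOp × List (Bool ⊕ Bool)) = δ
  obtain ⟨x, r⟩ := p
  have h₂ : KOWF.transduce δ (fun _ => []) 5 0 (code r) = r.map .inr := by
    induction r with
    | nil => subst hδ; rfl
    | cons b r ih =>
      rw [List.map_cons, ← ih]
      subst hδ
      cases b <;> rfl
  have h₁ : KOWF.transduce δ (fun _ => []) 1 0 (code x ++ code r) = withTape (x, r) := by
    induction x with
    | nil =>
      rw [withTape, ← h₂]
      subst hδ
      rfl
    | cons b x ih =>
      rw [withTape, List.map_cons, List.cons_append]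
      rw [withTape] at ih
      rw [← ih]
      subst hδ
      cases b <;> rfl
  rw [← h₁]
  subst hδ
  rfl

/-- Converting between raw bits and tree words at both ends identifies the typed calculus with the
official notion of polynomial time. -/
theorem PolyTime.pf {f : List Bool → List Bool} (hf : PolyTime f) : PF f :=
  PTime.comp (g := fun l : List Bool => l) PTime.encodeBits (PTime.comp hf PTime.decodeBits)

theorem PF.polyTime {f : List Bool → List Bool} (hf : PF f) : PolyTime f :=
  PTime.comp (g := fun l : List Bool => l) PTime.decodeBits (PTime.comp hf PTime.encodeBits)

theorem PPT.pf (A : PPT) : PF A.run :=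
  PTime.comp (g := fun l : List Bool => l) PTime.encodeBits (PTime.comp A.polyTime PTime.decodeTape)

/-- A probabilistic algorithm from a typed polynomial-time function. -/
def PPT.ofPF (coins : Polynomial ℕ) (run : List Bool × List Bool → List Bool) (h : PF run) : PPT :=
  ⟨coins, run, PTime.comp (g := fun l : List Bool => l) PTime.decodeBits (PTime.comp h PTime.encodeTape)⟩

/-! ### The universal machine -/

theorem foldl_takeWhile {ι : Type} (p : ι → Bool) (l acc : List ι) (b : Bool) :
    l.foldl (fun s i => bif s.1 && p i then (true, i :: s.2) else (false, s.2)) (b, acc) =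
      (b && l.all p, bif b then (l.takeWhile p).reverse ++ acc else acc) := by
  induction l generalizing b acc with
  | nil => cases b <;> simp
  | cons i l ih =>
    rw [List.foldl_cons]
    cases b <;> cases h : p i <;> simp [h, ih]

section MoreLists

variable {α β γ ι : Type} [Code α] [Code β] [Code γ] [Code ι]

theorem PF.optionBind [Inhabited β] {f : α → Option β} {g : α → β → Option γ} (hf : PF f)
    (hg : PF fun p : α × β => g p.1 p.2) : PF fun a => (f a).bind (g a) := by
  have h : PF fun a => bif (f a).isSome then g a ((f a).getD default) else none :=
    hf.isSome.cond (hg.comp (PF.id'.prodMk (hf.getD (PF.const default)))) (PF.const _)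
  convert h using 2 with a
  cases f a <;> rfl

theorem PF.optionMap [Inhabited β] {f : α → Option β} {g : α → β → γ} (hf : PF f)
    (hg : PF fun p : α × β => g p.1 p.2) : PF fun a => (f a).map (g a) := by
  have h := PF.optionBind (g := fun a b => some (g a b)) hf (by fun_prop)
  convert h using 2 with a
  cases f a <;> rfl

theorem PF.takeWhile [Inhabited ι] {p : α → ι → Bool} {l : α → List ι} (hl : PF l)
    (hp : PF fun x : α × ι => p x.1 x.2) : PF fun a => (l a).takeWhile (p a) := by
  obtain ⟨P, hP⟩ := hl.size_le
  have hg : PF fun x : α × (Bool × List ι) × ι => bif x.2.1.1 && p x.1 x.2.2 then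
      (true, x.2.2 :: x.2.1.2) else (false, x.2.1.2) := by
    have : PF fun x : α × (Bool × List ι) × ι => p x.1 x.2.2 :=
      hp.comp (g := fun x : α × ι => p x.1 x.2) (PF.fst.prodMk PF.snd.snd')
    fun_prop
  have h := PF.foldl_of_growth (l := l) (g := fun a (s : Bool × List ι) i =>
    bif s.1 && p a i then (true, i :: s.2) else (false, s.2)) (s₀ := fun _ => (true, [])) hl
    (by fun_prop) hg (P + 4) fun a s i hi => by
      have h₁ := size_lt_of_mem hi
      have h₂ := hP a
      have h₃ := size_bool_le
      obtain ⟨b, t⟩ := s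
      have h₄ := size_pos b
      have h₅ := h₃ true
      have h₆ := h₃ false
      cases b && p a i <;> simp <;> omega
  have h' := h.snd'.reverse
  simpa only [foldl_takeWhile, cond_true, List.append_nil, List.reverse_reverse] using h'

end MoreLists

/-- A form without recursion, to which the closure rules apply. -/
theorem readUnary_eq (l : List Bool) : readUnary l =
    if (l.takeWhile fun b => b).length < l.length then
      some ((l.takeWhile fun b => b).length, l.drop ((l.takeWhile fun b => b).length + 1)) else none := by
  induction l with
  | nil => rfl
  | cons b l ih =>
    cases b with
    | false => simp [readUnary]
    | true =>
      rw [readUnary, ih]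
      by_cases h : (l.takeWhile fun b => b).length < l.length <;> simp [h]

@[fun_prop]
theorem PF.readUnary {α : Type} [Code α] {f : α → List Bool} (hf : PF f) :
    PF fun a => readUnary (f a) := by
  have h : PF fun l : List Bool => l.takeWhile fun b => b := PF.takeWhile (by fun_prop) (by fun_prop)
  have h' : PF fun l : List Bool => if (l.takeWhile fun b => b).length < l.length then
      some ((l.takeWhile fun b => b).length, l.drop ((l.takeWhile fun b => b).length + 1)) else none := by
    fun_prop
  simp only [readUnary_eq]
  exact h'.comp hf

instance : Inhabited Rule := ⟨⟨0, 0, 0, 0, 0⟩⟩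

instance : Code Rule :=
  ⟨fun r => Code.enc (r.q, r.a, r.q', r.b, r.dir), fun r r' h => by
    have := Code.enc_injective h
    cases r; cases r'
    simp_all⟩

instance : Code Cfg :=
  ⟨fun c => Code.enc (c.state, c.left, c.head, c.right), fun r r' h => by
    have := Code.enc_injective h
    cases r; cases r'
    simp_all⟩

section Structures

variable {α : Type} [Code α]

theorem PF.ruleTuple {f : α → Rule} (hf : PF f) :
    PF fun a => ((f a).q, (f a).a, (f a).q', (f a).b, (f a).dir) :=
  (PF.of_enc_eq (f := fun r : Rule => (r.q, r.a, r.q', r.b, r.dir)) fun _ => rfl).comp hf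

@[fun_prop]
theorem PF.rule_q {f : α → Rule} (hf : PF f) : PF fun a => (f a).q := hf.ruleTuple.fst'

@[fun_prop]
theorem PF.rule_a {f : α → Rule} (hf : PF f) : PF fun a => (f a).a := hf.ruleTuple.snd'.fst'

@[fun_prop]
theorem PF.rule_q' {f : α → Rule} (hf : PF f) : PF fun a => (f a).q' := hf.ruleTuple.snd'.snd'.fst'

@[fun_prop]
theorem PF.rule_b {f : α → Rule} (hf : PF f) : PF fun a => (f a).b :=
  hf.ruleTuple.snd'.snd'.snd'.fst'

@[fun_prop]
theorem PF.rule_dir {f : α → Rule} (hf : PF f) : PF fun a => (f a).dir :=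
  hf.ruleTuple.snd'.snd'.snd'.snd'

@[fun_prop]
theorem PF.rule_mk {f₁ f₂ f₃ f₄ f₅ : α → ℕ} (h₁ : PF f₁) (h₂ : PF f₂) (h₃ : PF f₃) (h₄ : PF f₄)
    (h₅ : PF f₅) : PF fun a => Rule.mk (f₁ a) (f₂ a) (f₃ a) (f₄ a) (f₅ a) :=
  (PF.of_enc_eq (f := fun p : ℕ × ℕ × ℕ × ℕ × ℕ => Rule.mk p.1 p.2.1 p.2.2.1 p.2.2.2.1 p.2.2.2.2)
    fun _ => rfl).comp (h₁.prodMk (h₂.prodMk (h₃.prodMk (h₄.prodMk h₅))))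

theorem PF.cfgTuple {f : α → Cfg} (hf : PF f) :
    PF fun a => ((f a).state, (f a).left, (f a).head, (f a).right) :=
  (PF.of_enc_eq (f := fun c : Cfg => (c.state, c.left, c.head, c.right)) fun _ => rfl).comp hf

@[fun_prop]
theorem PF.cfg_state {f : α → Cfg} (hf : PF f) : PF fun a => (f a).state := hf.cfgTuple.fst'

@[fun_prop]
theorem PF.cfg_left {f : α → Cfg} (hf : PF f) : PF fun a => (f a).left := hf.cfgTuple.snd'.fst'

@[fun_prop]
theorem PF.cfg_head {f : α → Cfg} (hf : PF f) : PF fun a => (f a).head :=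
  hf.cfgTuple.snd'.snd'.fst'

@[fun_prop]
theorem PF.cfg_right {f : α → Cfg} (hf : PF f) : PF fun a => (f a).right :=
  hf.cfgTuple.snd'.snd'.snd'

@[fun_prop]
theorem PF.cfg_mk {f₁ f₃ : α → ℕ} {f₂ f₄ : α → List ℕ} (h₁ : PF f₁) (h₂ : PF f₂) (h₃ : PF f₃)
    (h₄ : PF f₄) : PF fun a => Cfg.mk (f₁ a) (f₂ a) (f₃ a) (f₄ a) :=
  (PF.of_enc_eq (f := fun p : ℕ × List ℕ × ℕ × List ℕ => Cfg.mk p.1 p.2.1 p.2.2.1 p.2.2.2)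
    fun _ => rfl).comp (h₁.prodMk (h₂.prodMk (h₃.prodMk h₄)))

end Structures

theorem PF.readRule {α : Type} [Code α] {f : α → List Bool} (hf : PF f) :
    PF fun a => readRule (f a) := by
  have h : PF fun l : List Bool => (KOWF.readUnary l).bind fun p₁ =>
      (KOWF.readUnary p₁.2).bind fun p₂ => (KOWF.readUnary p₂.2).bind fun p₃ =>
      (KOWF.readUnary p₃.2).bind fun p₄ => (KOWF.readUnary p₄.2).bind fun p₅ =>
      some (Rule.mk p₁.1 p₂.1 p₃.1 p₄.1 p₅.1, p₅.2) := by
    refine PF.optionBind (PF.readUnary (by fun_prop)) ?_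
    refine PF.optionBind (PF.readUnary (by fun_prop)) ?_
    refine PF.optionBind (PF.readUnary (by fun_prop)) ?_
    refine PF.optionBind (PF.readUnary (by fun_prop)) ?_
    refine PF.optionBind (PF.readUnary (by fun_prop)) ?_
    fun_prop
  exact h.comp hf

theorem readUnary_length {l l' : List Bool} {k : ℕ} (h : readUnary l = some (k, l')) :
    k + 1 + l'.length = l.length := by
  induction l generalizing k with
  | nil => simp [readUnary] at h
  | cons b l ih =>
    cases b with
    | false =>
      simp only [readUnary, Option.some.injEq, Prod.mk.injEq] at h
      simp [← h.1, ← h.2, add_comm]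
    | true =>
      simp only [readUnary, Option.map_eq_some_iff, Prod.mk.injEq] at h
      obtain ⟨⟨k', l''⟩, h, rfl, rfl⟩ := h
      have := ih h
      simp only [List.length_cons] at this ⊢
      omega

theorem size_rule (r : Rule) : size r = 2 * (r.q + r.a + r.q' + r.b + r.dir) + 9 := by
  change size (r.q, r.a, r.q', r.b, r.dir) = _
  simp
  omega

/-- A rule whose fields sum to `σ` takes `σ + 5` bits and has size `2σ + 9`. So the size of the
rules read so far plus twice the number of remaining bits is constant, which is the invariant that
keeps parsing small. -/
theorem readRule_length {l l' : List Bool} {r : Rule} (h : readRule l = some (r, l')) :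
    size r + 1 + 2 * l'.length = 2 * l.length := by
  simp only [readRule, Option.bind_eq_bind, Option.bind_eq_some_iff] at h
  obtain ⟨⟨k₁, l₁⟩, h₁, ⟨k₂, l₂⟩, h₂, ⟨k₃, l₃⟩, h₃, ⟨k₄, l₄⟩, h₄, ⟨k₅, l₅⟩, h₅, h⟩ := h
  simp only [Option.pure_def, Option.some.injEq, Prod.mk.injEq] at h
  obtain ⟨rfl, rfl⟩ := h
  have := readUnary_length h₁
  have := readUnary_length h₂
  have := readUnary_length h₃
  have := readUnary_length h₄
  have := readUnary_length h₅
  rw [size_rule]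
  simp only at *
  omega

/-- Read one more rule. -/
def readMore (s : Option (Machine × List Bool)) : Option (Machine × List Bool) :=
  s.bind fun p => (readRule p.2).map fun x => (x.1 :: p.1, x.2)

/-- The recursion becomes an iteration with an accumulator, which collects the rules in reverse
order; a failure is absorbing. -/
theorem iterate_readMore (k : ℕ) (M : Machine) (l : List Bool) :
    readMore^[k] (some (M, l)) = (readRules k l).map fun p => (p.1.reverse ++ M, p.2) := by
  induction k generalizing M l with
  | zero => rfl
  | succ k ih =>
    rw [iterate_succ_apply]
    simp only [readMore, readRules, Option.bind_some, Option.bind_eq_bind]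
    rcases h : readRule l with _ | ⟨r, l'⟩
    · simp only [Option.map_none, Option.bind_none]
      clear ih
      induction k with
      | zero => rfl
      | succ k ih => rw [iterate_succ_apply]; exact ih
    · simp only [Option.map_some, Option.bind_some]
      rw [ih]
      rcases readRules k l' with _ | ⟨M', l''⟩ <;> simp

theorem PF.readRules {α : Type} [Code α] {k : α → ℕ} {f : α → List Bool} (hk : PF k) (hf : PF f) :
    PF fun a => readRules (k a) (f a) := by
  have hstep : PF readMore := by
    unfold readMore
    refine PF.optionBind (by fun_prop) (PF.optionMap (PF.readRule (by fun_prop)) ?_)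
    fun_prop
  have h : PF fun a => readMore^[k a] (some (([] : Machine), f a)) := by
    obtain ⟨P, hP⟩ := hf.size_le
    refine PF.iterate_of_invariant (g := fun _ s => readMore s) hk (by fun_prop)
      (hstep.comp PF.snd) (fun a s => ∀ p, s = some p → size p.1 + 2 * p.2.length ≤
        1 + 2 * (f a).length) ?_ ?_ (6 * P + 4) ?_
    · rintro a p hp
      simp only [Option.some.injEq] at hp
      subst hp
      simp
    · rintro a s hs ⟨M, l⟩ hp
      simp only [readMore, Option.bind_eq_some_iff, Option.map_eq_some_iff] at hp
      obtain ⟨⟨M', l'⟩, rfl, ⟨r, l''⟩, h, hp⟩ := hp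
      simp only [Prod.mk.injEq] at hp
      obtain ⟨rfl, rfl⟩ := hp
      have h₁ := hs _ rfl
      have h₂ := readRule_length h
      simp only [size_cons] at h₁ h₂ ⊢
      omega
    · rintro a (_ | ⟨M, l⟩) hs
      · simp
      · have h₁ := hs _ rfl
        have h₂ := hP a
        have h₃ := length_lt_size (f a)
        have h₄ := size_bits_le l
        simp at h₁ ⊢
        omega
  have h' : PF fun a => (readMore^[k a] (some (([] : Machine), f a))).map
      fun p => (p.1.reverse, p.2) := PF.optionMap h (by fun_prop)
  convert h' using 2 with a
  rw [iterate_readMore]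
  rcases KOWF.readRules (k a) (f a) with _ | ⟨M, l⟩ <;> simp

theorem PF.decodeDesc {α : Type} [Code α] {f : α → List Bool} (hf : PF f) :
    PF fun a => decodeDesc (f a) := by
  unfold KOWF.decodeDesc
  exact PF.optionBind (PF.readUnary hf) (PF.readRules (by fun_prop) (by fun_prop))

theorem size_cfg (c : Cfg) : size c = size c.left + size c.right + 2 * (c.state + c.head) + 5 := by
  change size (c.state, c.left, c.head, c.right) = _
  simp
  omega

/-- A step only brings in the symbol and the state named in the rule. So `t` steps add at most `t`
times the size of the machine, and emulation is polynomial in `t` and the description. -/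
theorem size_apply_le (c : Cfg) (r : Rule) : size (c.apply r) ≤ size c + size r := by
  have htail : ∀ l : List ℕ, size l.tail + 2 * l.headD 0 ≤ size l := by
    intro l
    cases l <;> simp
    omega
  have h₁ := htail c.left
  have h₂ := htail c.right
  rw [size_rule, size_cfg c]
  unfold Cfg.apply
  split_ifs <;> rw [size_cfg] <;> simp only [size_cons, size_nat] <;> omega

theorem PF.tmStep : PF fun p : Machine × Cfg => step p.1 p.2 := by
  have happly : PF fun p : Cfg × Rule => p.1.apply p.2 := by
    unfold Cfg.apply
    fun_prop
  exact PF.optionMap (PF.find? (by fun_prop) (by fun_prop))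
    (happly.comp (PF.fst.snd'.prodMk PF.snd))

theorem PF.runFor {α : Type} [Code α] {M : α → Machine} {w : α → List Bool} {t : α → ℕ} (hM : PF M)
    (hw : PF w) (ht : PF t) : PF fun a => runFor (M a) (w a) (t a) := by
  have hsym : PF bitSymbol := by
    have : PF fun b : Bool => bif b then 2 else 1 := by fun_prop
    convert this using 2 with b
    cases b <;> rfl
  have hmap : PF fun w : List Bool => w.map bitSymbol :=
    PF.map (by fun_prop) (hsym.comp PF.snd)
  have hinit : PF fun w : List Bool => Cfg.init w := by
    unfold Cfg.init
    fun_prop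
  have hout : PF fun c : Cfg => c.output := by
    unfold Cfg.output
    refine PF.map (PF.takeWhile (by fun_prop) ?_) (by fun_prop)
    simp only [Bool.decide_or]
    fun_prop
  obtain ⟨P, hP⟩ := hM.size_le
  have hc : PF fun a => (fun c => (KOWF.step (M a) c).getD c)^[t a] (Cfg.init (w a)) := by
    refine PF.iterate (g := fun a c => (KOWF.step (M a) c).getD c) ht (hinit.comp hw) ?_ P ?_
    · exact (PF.tmStep.comp ((hM.comp PF.fst).prodMk PF.snd)).getD PF.snd
    · intro a c
      unfold KOWF.step
      generalize h : (M a).find? (fun r => r.q = c.state ∧ r.a = c.head) = o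
      rcases o with _ | r
      · rw [Option.map_none, Option.getD_none]
        omega
      · have h₁ := size_lt_of_mem (List.mem_of_find?_eq_some h)
        have h₂ := size_apply_le c r
        have h₃ := hP a
        rw [Option.map_some, Option.getD_some]
        omega
  have h := (PF.tmStep.comp (hM.prodMk hc)).isNone.cond (hout.comp hc).optionSome (PF.const none)
  convert h using 2 with a
  simp only [KOWF.runFor, cond_eq_ite]

theorem PF.U {α : Type} [Code α] {D : α → List Bool} {t : α → ℕ} (hD : PF D) (ht : PF t) :
    PF fun a => U (D a) (t a) := by
  unfold KOWF.U
  exact PF.optionBind (PF.decodeDesc hD) (PF.runFor (by fun_prop) (by fun_prop) (ht.comp PF.fst))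

end KOWF

namespace KOWF

open Turing Function

/-! ### Binary numbers, logarithms and integer-valued polynomials -/

/-- Add one to a binary number, least significant bit first. -/
def incr : List Bool → List Bool
  | [] => [true]
  | false :: l => true :: l
  | true :: l => false :: incr l

theorem incr_eq (l : List Bool) : incr l = (l.takeWhile fun b => b).map (fun _ => false) ++
    true :: l.drop ((l.takeWhile fun b => b).length + 1) := by
  induction l with
  | nil => rfl
  | cons b l ih =>
    cases b with
    | false => simp [incr]
    | true => simp [incr, ih]

theorem size_incr_le (l : List Bool) : size (incr l) ≤ size l + 4 := by
  induction l with
  | nil => decide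
  | cons b l ih =>
    have h₁ : size true = 3 := rfl
    have h₂ : size false = 1 := rfl
    cases b <;> simp only [incr, size_cons] <;> omega

theorem PF.incr_iterate {α : Type} [Code α] {n : α → ℕ} {f : α → List Bool} (hn : PF n)
    (hf : PF f) : PF fun a => incr^[n a] (f a) := by
  refine PF.iterate (g := fun _ s => incr s) hn hf ?_ 4 fun a s => by simpa using size_incr_le s
  have h : PF fun l : List Bool => (l.takeWhile fun b => b).map (fun _ => false) ++
      true :: l.drop ((l.takeWhile fun b => b).length + 1) := by
    have h : PF fun l : List Bool => l.takeWhile fun b => b :=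
      PF.takeWhile (by fun_prop) (by fun_prop)
    exact (PF.map h (by fun_prop)).append (by fun_prop)
  simp only [incr_eq]
  exact h.comp PF.snd

theorem encodePosNum_succ (n : PosNum) :
    Computability.encodePosNum n.succ = incr (Computability.encodePosNum n) := by
  induction n with
  | one => rfl
  | bit0 n _ => rfl
  | bit1 n ih => simp [PosNum.succ, Computability.encodePosNum, incr, ih]

/-- Counting up to `n` in binary is affordable because `n` is given in unary. -/
theorem encodeNat_eq (n : ℕ) : Computability.encodeNat n = incr^[n] [] := by
  induction n with
  | zero => rfl
  | succ n ih =>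
    rw [iterate_succ_apply', ← ih, Computability.encodeNat, Computability.encodeNat, Nat.cast_succ,
      Num.add_one]
    cases (n : Num) with
    | zero => rfl
    | pos n => exact encodePosNum_succ n

@[fun_prop]
theorem PF.encodeNat {α : Type} [Code α] {n : α → ℕ} (hn : PF n) :
    PF fun a => Computability.encodeNat (n a) := by
  simp only [encodeNat_eq]
  exact PF.incr_iterate hn (PF.const _)

/-- The `k` bits of a number, least significant first. -/
def bits (k i : ℕ) : List Bool := incr^[i] (List.replicate k false)

/-- The hypothesis excludes the overflow of the last carry, which would lengthen the list. -/
theorem incr_spec (l : List Bool) (h : Nat.ofDigits 2 (l.map Bool.toNat) + 1 < 2 ^ l.length) :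
    (incr l).length = l.length ∧
      Nat.ofDigits 2 ((incr l).map Bool.toNat) = Nat.ofDigits 2 (l.map Bool.toNat) + 1 := by
  induction l with
  | nil => simp at h
  | cons b l ih =>
    cases b with
    | false => simp [incr, Nat.ofDigits_cons, add_comm]
    | true =>
      simp only [List.map_cons, Nat.ofDigits_cons, List.length_cons, pow_succ, Bool.toNat_true] at h
      have := ih (by omega)
      simp [incr, Nat.ofDigits_cons, this.1, this.2]
      ring

theorem bits_spec {k i : ℕ} (h : i < 2 ^ k) :
    (bits k i).length = k ∧ indexOf (bits k i) = i + 1 := by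
  induction i with
  | zero =>
    have : ∀ k, Nat.ofDigits 2 ((List.replicate k false).map Bool.toNat) = 0 := by
      intro k
      induction k with
      | zero => rfl
      | succ k ih => rw [List.replicate_succ, List.map_cons, Nat.ofDigits_cons, ih]; rfl
    simp [bits, indexOf]
  | succ i ih =>
    obtain ⟨h₁, h₂⟩ := ih (by omega)
    simp only [indexOf, Nat.add_right_cancel_iff] at h₂
    have := incr_spec (bits k i) (by rw [h₁, h₂]; exact h)
    rw [bits, iterate_succ_apply', ← bits, indexOf, this.1, this.2, h₁, h₂]
    exact ⟨rfl, rfl⟩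

@[fun_prop]
theorem PF.bits {α : Type} [Code α] {k i : α → ℕ} (hk : PF k) (hi : PF i) :
    PF fun a => bits (k a) (i a) :=
  PF.incr_iterate hi (PF.replicate hk (PF.const false))

@[fun_prop]
theorem PF.sum {α : Type} [Code α] {n : α → ℕ} {f : α → ℕ → ℕ} (hn : PF n)
    (hf : PF fun p : α × ℕ => f p.1 p.2) : PF fun a => ∑ j ∈ Finset.range (n a), f a j := by
  have h : PF fun a => ((List.range (n a)).flatMap fun j => List.replicate (f a j) ()).length :=
    PF.length (PF.flatMap (by fun_prop) (PF.replicate_unit hf))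
  convert h using 2 with a
  rw [List.length_flatMap]
  simp only [List.length_replicate]
  rfl

@[fun_prop]
theorem PF.natMin {α : Type} [Code α] {f g : α → ℕ} (hf : PF f) (hg : PF g) :
    PF fun a => min (f a) (g a) := by
  have h : PF fun a => f a - (f a - g a) := by fun_prop
  convert h using 2 with a
  omega

/-- The number denoted by a bit string may be exponential, too large for unary notation. Capping
every stage of Horner's scheme keeps it small and commutes with the scheme; for `take`, the length
of the list is a sufficient cap. -/
theorem foldl_min_ofDigits (cap : ℕ) (l : List Bool) :
    l.reverse.foldl (fun s b => min cap (2 * s + bif b then 1 else 0)) 0 =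
      min cap (Nat.ofDigits 2 (l.map Bool.toNat)) := by
  induction l with
  | nil => simp
  | cons b l ih =>
    rw [List.reverse_cons, List.foldl_append, ih, List.map_cons, Nat.ofDigits_cons]
    cases b <;> simp <;> omega

theorem PF.take_indexOf {α ι : Type} [Code α] [Code ι] [Inhabited ι] {l : α → List ι}
    {f : α → List Bool} (hl : PF l) (hf : PF f) : PF fun a => (l a).take (indexOf (f a)) := by
  have h : PF fun p : ℕ × List Bool =>
      p.2.reverse.foldl (fun s b => min p.1 (2 * s + bif b then 1 else 0)) 0 := by
    refine PF.foldl_of_invariant (l := fun p : ℕ × List Bool => p.2.reverse)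
      (g := fun p s b => min p.1 (2 * s + bif b then 1 else 0)) (by fun_prop) (by fun_prop)
      (by fun_prop) (fun p s => s ≤ p.1) (by simp) (by simp) .X ?_
    rintro ⟨m, l⟩ s hs
    simp at hs ⊢
    omega
  have h' := PF.take ((h.comp ((PF.length hl).prodMk hf)).succ) hl
  convert h' using 2 with a
  rw [foldl_min_ofDigits, indexOf, ← min_add_add_right]
  refine (List.take_eq_take_iff.2 ?_)
  dsimp only
  omega

/-- The algorithm doubles `1` as long as it is below `N` and counts the doublings; `N` rounds are
enough, and the power never exceeds `2N + 1`. -/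
theorem PF.clog {α : Type} [Code α] {n : α → ℕ} (hn : PF n) : PF fun a => Nat.clog 2 (n a) := by
  have h : PF fun N : ℕ => (fun s : ℕ × ℕ => bif decide (s.1 < N) then (2 * s.1, s.2 + 1) else s)^[N]
      (1, 0) := by
    refine PF.iterate_of_invariant (n := fun N : ℕ => N) (g := fun N s => bif decide (s.1 < N) then
      (2 * s.1, s.2 + 1) else s) (by fun_prop) (by fun_prop) (by fun_prop)
      (fun N s => s.2 < s.1 ∧ s.1 ≤ 2 * N + 1) ?_ ?_ (4 * .X + 4) ?_
    · intro N
      simp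
    · rintro N ⟨i, j⟩ ⟨h₁, h₂⟩
      by_cases h : i < N <;> simp [h] <;> simp at h₁ h₂ <;> omega
    · rintro N ⟨i, j⟩ ⟨h₁, h₂⟩
      simp at h₁ h₂ ⊢
      omega
  convert (h.comp hn).snd' using 2 with a
  generalize n a = N
  suffices h : ∀ k, (fun s : ℕ × ℕ => bif decide (s.1 < N) then (2 * s.1, s.2 + 1) else s)^[k] (1, 0) =
      (2 ^ min k (Nat.clog 2 N), min k (Nat.clog 2 N)) by
    rw [h, min_eq_right]
    refine Nat.clog_le_of_le_pow ?_
    exact Nat.lt_two_pow_self.le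
  intro k
  induction k with
  | zero => simp
  | succ k ih =>
    rw [iterate_succ_apply', ih]
    rcases lt_or_ge k (Nat.clog 2 N) with h | h
    · have h' := (Nat.lt_clog_iff_pow_lt one_lt_two).1 h
      simp [min_eq_left h.le, min_eq_left (Nat.succ_le_of_lt h), h', pow_succ, mul_comm]
    · have h' : ¬ 2 ^ Nat.clog 2 N < N := fun h' => lt_irrefl _ ((Nat.lt_clog_iff_pow_lt one_lt_two).2 h')
      simp [min_eq_right h, min_eq_right (Nat.le_succ_of_le h), h']

open fwdDiff in
-- Induction on the number of differences, by `u n = u 0 + ∑ j < n, Δu j`. Only natural numbers are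
-- coded, so an integer is carried as a difference of two of them.
theorem exists_pf_sub_of_fwdDiff (d : ℕ) (u : ℕ → ℤ) (h : (Δ_[1])^[d] u = 0) :
    ∃ a b : ℕ → ℕ, PF a ∧ PF b ∧ ∀ n, u n = a n - b n := by
  induction d generalizing u with
  | zero =>
    have h : u = 0 := h
    exact ⟨fun _ => 0, fun _ => 0, PF.const _, PF.const _, fun n => by simp [h]⟩
  | succ d ih =>
    obtain ⟨a, b, ha, hb, hab⟩ := ih (Δ_[1] u) h
    refine ⟨fun n => (u 0).toNat + ∑ j ∈ Finset.range n, a j,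
      fun n => (-u 0).toNat + ∑ j ∈ Finset.range n, b j, ?_, ?_, fun n => ?_⟩
    · exact (PF.const _).add (PF.sum (by fun_prop) (ha.comp PF.snd))
    · exact (PF.const _).add (PF.sum (by fun_prop) (hb.comp PF.snd))
    · induction n with
      | zero => simp
      | succ n ih' =>
        have := hab n
        rw [fwdDiff] at this
        simp only [Finset.sum_range_succ]
        push_cast at ih' ⊢
        omega

open fwdDiff in
-- The real coefficients of `T` are of no use to an algorithm, but a high enough forward difference
-- of the integer values vanishes, and iterated summation recovers them from finitely many integers.
theorem pf_of_polynomial (t : ℕ → ℕ) (T : Polynomial ℝ)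
    (hT : ∀ n : ℕ, 1 ≤ n → (t n : ℝ) = T.eval (n : ℝ)) : PF t := by
  have key : ∀ (d : ℕ) (u : ℕ → ℤ) (F : ℝ → ℝ), (∀ n, (u n : ℝ) = F n) →
      ∀ n, (((Δ_[1])^[d] u n : ℤ) : ℝ) = (Δ_[1])^[d] F n := by
    intro d
    induction d with
    | zero => exact fun u F h => h
    | succ d ih =>
      intro u F h
      refine ih (Δ_[1] u) (Δ_[1] F) fun n => ?_
      have := h (n + 1)
      simp [fwdDiff, h]
  -- The values agree with `T` only from `1` on, hence the shift; `t 0` is hard-wired below.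
  set T' : Polynomial ℝ := T.comp (.X + 1) with hT'
  have h := key (T'.natDegree + 1) (fun n => (t (n + 1) : ℤ)) T'.eval fun n => by
    have := hT (n + 1) (by omega)
    simp [hT', this]
  rw [Polynomial.fwdDiff_iter_degree_add_one_eq_zero] at h
  obtain ⟨a, b, ha, hb, hab⟩ := exists_pf_sub_of_fwdDiff _ (fun n => (t (n + 1) : ℤ))
    (funext fun n => Int.cast_injective ((h n).trans Int.cast_zero.symm))
  have : PF fun n : ℕ => if n ≤ 0 then t 0 else a (n - 1) - b (n - 1) :=
    PF.ite (by fun_prop) (by fun_prop) ((ha.comp (by fun_prop)).sub (hb.comp (by fun_prop)))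
  convert this using 2 with n
  cases n with
  | zero => rfl
  | succ n =>
    have := hab n
    simp
    omega

/-! ### The candidate function -/

section Candidate

variable {α : Type} [Code α]

@[fun_prop]
theorem PF.unary {n : α → ℕ} (hn : PF n) : PF fun a => unary (n a) :=
  (PF.replicate hn (PF.const true)).append (PF.const [false])

@[fun_prop]
theorem PF.withSecurity {n : α → ℕ} {y : α → List Bool} (hn : PF n) (hy : PF y) :
    PF fun a => withSecurity (n a) (y a) :=
  hn.unary.append hy

theorem PF.ktLength {c : ℕ} {n : α → ℕ} (hn : PF n) : PF fun a => ktLength c (n a) := by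
  have h := PF.clog (hn.add (PF.const c))
  unfold KOWF.ktLength
  fun_prop

theorem PF.ktFun {t : ℕ → ℕ} (ht : PF t) {c : ℕ} {n : α → ℕ} {x : α → List Bool} (hn : PF n)
    (hx : PF x) : PF fun a => ktFun t c (n a) (x a) := by
  have h := PF.clog (hn.add (PF.const c))
  have h₁ : PF fun a => (x a).take (Nat.clog 2 (n a + c)) := by fun_prop
  have h₂ : PF fun a => (x a).drop (Nat.clog 2 (n a + c)) := by fun_prop
  exact h₁.append ((PF.U (PF.take_indexOf h₂ h₁) (ht.comp hn)).getD (PF.const []))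

end Candidate

end KOWF

namespace KOWF

open Finset

/-! ### Averages over bit strings -/

theorem avg_congr {n : ℕ} {g h : List Bool → ℝ} (H : ∀ x, x.length = n → g x = h x) :
    avg n g = avg n h := by
  unfold avg
  congr 1
  exact sum_congr rfl fun x _ => H _ List.length_ofFn

theorem avg_mono {n : ℕ} {g h : List Bool → ℝ} (H : ∀ x, x.length = n → g x ≤ h x) :
    avg n g ≤ avg n h := by
  unfold avg
  gcongr with x
  exact H _ List.length_ofFn

theorem avg_const (n : ℕ) (a : ℝ) : avg n (fun _ => a) = a := by
  simp [avg]

theorem avg_add (n : ℕ) (g h : List Bool → ℝ) :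
    avg n (fun x => g x + h x) = avg n g + avg n h := by
  simp [avg, sum_add_distrib, add_div]

theorem avg_mul_left (n : ℕ) (a : ℝ) (g : List Bool → ℝ) :
    avg n (fun x => a * g x) = a * avg n g := by
  simp [avg, ← mul_sum, mul_div_assoc]

theorem avg_sub (n : ℕ) (g h : List Bool → ℝ) :
    avg n (fun x => g x - h x) = avg n g - avg n h := by
  simp [avg, sum_sub_distrib, sub_div]

theorem avg_one_sub (n : ℕ) (g : List Bool → ℝ) : avg n (fun x => 1 - g x) = 1 - avg n g := by
  rw [avg_sub, avg_const]

theorem avg_sum {ι : Type*} (s : Finset ι) (n : ℕ) (g : ι → List Bool → ℝ) :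
    avg n (fun x => ∑ i ∈ s, g i x) = ∑ i ∈ s, avg n (g i) := by
  simp only [avg, sum_div]
  exact sum_comm

theorem avg_nonneg {n : ℕ} {g : List Bool → ℝ} (H : ∀ x, x.length = n → 0 ≤ g x) : 0 ≤ avg n g :=
  (avg_const n 0).symm.le.trans (avg_mono H)

theorem avg_le_one {n : ℕ} {g : List Bool → ℝ} (H : ∀ x, x.length = n → g x ≤ 1) : avg n g ≤ 1 :=
  (avg_mono H).trans (avg_const n 1).le

theorem avg_comm (a b : ℕ) (g : List Bool → List Bool → ℝ) :
    avg a (fun x => avg b (fun y => g x y)) = avg b (fun y => avg a (fun x => g x y)) := by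
  simp only [avg, sum_div]
  rw [sum_comm]
  refine sum_congr rfl fun x _ => sum_congr rfl fun y _ => ?_
  ring

theorem avg_append (a b : ℕ) (g : List Bool → ℝ) :
    avg (a + b) g = avg a fun x => avg b fun y => g (x ++ y) := by
  unfold avg
  rw [← (Fin.appendEquiv a b).sum_comp, Fintype.sum_prod_type, pow_add, ← sum_div, div_div,
    mul_comm (2 ^ a : ℝ)]
  congr 1
  refine sum_congr rfl fun x _ => sum_congr rfl fun y _ => ?_
  simp [Fin.appendEquiv, List.ofFn_fin_append]

/-- Unused random bits do not affect a probability, so an algorithm may be given a longer tape than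
it needs. -/
theorem avg_take {a n : ℕ} (h : a ≤ n) (g : List Bool → ℝ) :
    avg n (fun x => g (x.take a)) = avg a g := by
  obtain ⟨b, rfl⟩ := Nat.exists_eq_add_of_le h
  rw [avg_append]
  refine avg_congr fun x hx => ?_
  rw [avg_congr (h := fun _ => g x) fun y _ => by rw [← hx, List.take_left], avg_const]

/-- With the denominators cleared, these are sums over all strings; the injection `φ` embeds the
first into the second, whose other terms are nonnegative. -/
theorem avg_le_of_injOn {a b : ℕ} {g h : List Bool → ℝ} (φ : List Bool → List Bool)
    (hφ : ∀ x, x.length = a → (φ x).length = b)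
    (hinj : ∀ x x', x.length = a → x'.length = a → φ x = φ x' → x = x')
    (hgh : ∀ x, x.length = a → g x ≤ h (φ x)) (hh : ∀ x, 0 ≤ h x) :
    2 ^ a * avg a g ≤ 2 ^ b * avg b h := by
  unfold avg
  rw [mul_div_cancel₀ _ (by positivity), mul_div_cancel₀ _ (by positivity)]
  have hget : ∀ x : Fin a → Bool, List.ofFn (fun i : Fin b => (φ (List.ofFn x)).getD i false) =
      φ (List.ofFn x) := by
    intro x
    have := hφ _ (List.length_ofFn (f := x))
    refine List.ext_getElem (by simp [this]) fun i h₁ h₂ => ?_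
    simp [List.getElem?_eq_getElem h₂]
  let ψ : (Fin a → Bool) → (Fin b → Bool) := fun x i => (φ (List.ofFn x)).getD i false
  have hψ : Function.Injective ψ := fun x y hxy => by
    refine List.ofFn_injective (hinj _ _ List.length_ofFn List.length_ofFn ?_)
    rw [← hget x, ← hget y]
    exact congrArg List.ofFn hxy
  calc ∑ x, g (List.ofFn x) ≤ ∑ x, h (List.ofFn (ψ x)) :=
        sum_le_sum fun x _ => (hgh _ List.length_ofFn).trans (by rw [hget])
    _ = ∑ y ∈ univ.map ⟨ψ, hψ⟩, h (List.ofFn y) := by rw [sum_map]; rfl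
    _ ≤ _ := sum_le_sum_of_subset_of_nonneg (subset_univ _) fun _ _ _ => hh _

theorem PPT.prob_nonneg (A : PPT) (x : List Bool) (S : Set (List Bool)) : 0 ≤ A.prob x S :=
  avg_nonneg fun _ _ => by split_ifs <;> norm_num

theorem PPT.prob_le_one (A : PPT) (x : List Bool) (S : Set (List Bool)) : A.prob x S ≤ 1 :=
  avg_le_one fun _ _ => by split_ifs <;> norm_num

end KOWF

namespace KOWF

open Finset

/-! ### The candidate family is weakly one-way -/

theorem exists_nat_polynomial_ge (p : Polynomial ℝ) :
    ∃ P : Polynomial ℕ, ∀ n : ℕ, p.eval (n : ℝ) ≤ (P.eval n : ℕ) := by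
  induction p using Polynomial.induction_on' with
  | add p q hp hq =>
    obtain ⟨P, hP⟩ := hp
    obtain ⟨Q, hQ⟩ := hq
    exact ⟨P + Q, fun n => by simpa using add_le_add (hP n) (hQ n)⟩
  | monomial d a =>
    refine ⟨.monomial d ⌈a⌉₊, fun n => ?_⟩
    simp only [Polynomial.eval_monomial, Nat.cast_mul, Nat.cast_pow]
    gcongr
    exact Nat.le_ceil a

theorem exists_description (t : ℕ → ℕ) (x : List Bool) :
    ∃ D : List Bool, D.length = Kt t x ∧ U D (t x.length) = some x :=
  Nat.sInf_mem (s := {k | ∃ D : List Bool, D.length = k ∧ U D (t x.length) = some x})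
    ⟨_, false :: x, rfl, U_false_cons x _⟩

/-- The empty string describes no pair. Hence `K^t(x)` has the form `i + 1`, as the numbers denoted
by index strings do. -/
theorem Kt_pos (t : ℕ → ℕ) (x : List Bool) : 0 < Kt t x := by
  obtain ⟨D, hD, h⟩ := exists_description t x
  rw [← hD]
  rcases D with _ | ⟨b, D⟩
  · cases h
  · simp

theorem length_withSecurity (n : ℕ) (y : List Bool) :
    (withSecurity n y).length = n + 1 + y.length := by
  simp [withSecurity, unary, add_assoc, add_comm 1]

/-! ### Computing `K^t` with an inverter -/

section Search

variable (A : PPT) (t : ℕ → ℕ) (c : ℕ)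

/-- The answer of `A` to `1^m` and `ℓ‖x`, where `ℓ` stands for `i + 1`. -/
def candidate (x R : List Bool) (i : ℕ) : List Bool :=
  let y := withSecurity (ktLength c x.length) (bits (Nat.clog 2 (x.length + c)) i ++ x)
  A.run (y, R.take (A.coins.eval y.length))

/-- The least `i` for which the answer of `A` is correct. -/
def searchIndex (x R : List Bool) : ℕ :=
  ((List.range (x.length + c)).find? fun i =>
    decide ((candidate A c x R i).length = ktLength c x.length) &&
      decide (ktFun t c x.length (candidate A c x R i) =
        bits (Nat.clog 2 (x.length + c)) i ++ x)).getD 0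

theorem pf_searchIndex (ht : PF t) :
    PF fun p : List Bool × List Bool => searchIndex A t c p.1 p.2 := by
  have hclog : PF fun p : (List Bool × List Bool) × ℕ => Nat.clog 2 (p.1.1.length + c) :=
    PF.clog (by fun_prop)
  have hlen : PF fun p : (List Bool × List Bool) × ℕ => ktLength c p.1.1.length :=
    PF.ktLength (by fun_prop)
  have hcand : PF fun p : (List Bool × List Bool) × ℕ => candidate A c p.1.1 p.1.2 p.2 := by
    refine A.pf.comp (PF.prodMk (by fun_prop) (PF.take (PF.eval _ ?_) (by fun_prop)))
    fun_prop
  have hfun : PF fun p : (List Bool × List Bool) × ℕ =>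
      ktFun t c p.1.1.length (candidate A c p.1.1 p.1.2 p.2) := PF.ktFun ht (by fun_prop) hcand
  exact PF.getD (PF.find? (by fun_prop) (by fun_prop)) (by fun_prop)

/-- An algorithm for `K^t` from an inverter of the candidate family. -/
noncomputable def ktSolver (ht : PF t) : PPT :=
  -- The query has length `m + 1 + k + n` with `m = k + n + c`, and `k ≤ n + c`. The same random
  -- bits serve all queries.
  .ofPF (A.coins.comp (4 * .X + .C (3 * c + 1)))
    (fun p => Computability.encodeNat (searchIndex A t c p.1 p.2 + 1))
    (pf_searchIndex A t c ht).succ.encodeNat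

variable {A t c}

theorem lt_two_pow_clog {n i : ℕ} (h : i < n) : i < 2 ^ Nat.clog 2 n :=
  h.trans_le (Nat.le_pow_clog one_lt_two n)

/-- The prefix of length `i + 1` read off from the preimage describes `x`. For empty `x` this could
fail, since a missing output also counts as the empty string. -/
theorem Kt_le_of_ktFun_eq {x z : List Bool} {i : ℕ} (hx : x ≠ []) (hi : i < x.length + c)
    (hz : z.length = ktLength c x.length)
    (h : ktFun t c x.length z = bits (Nat.clog 2 (x.length + c)) i ++ x) : Kt t x ≤ i + 1 := by
  obtain ⟨h₁, h₂⟩ := bits_spec (lt_two_pow_clog hi)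
  obtain ⟨h₃, h₄⟩ := List.append_inj h (by
    rw [h₁, List.length_take, hz, ktLength]
    omega)
  rw [h₃, h₂] at h₄
  rcases hU : U ((z.drop (Nat.clog 2 (x.length + c))).take (i + 1)) (t x.length) with _ | x'
  · rw [hU] at h₄
    exact absurd h₄.symm hx
  · rw [hU, Option.getD_some] at h₄
    subst h₄
    have : Kt t x' ≤ _ := Nat.sInf_le ⟨_, rfl, hU⟩
    refine this.trans ?_
    simp

/-- Answers to other queries do no harm: a smaller index that passes the check would bound `K^t(x)`
below its value. -/
theorem searchIndex_eq {x R : List Bool} {i : ℕ} (hx : x ≠ []) (hi : i < x.length + c)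
    (hiK : Kt t x = i + 1) (hz : (candidate A c x R i).length = ktLength c x.length)
    (h : ktFun t c x.length (candidate A c x R i) = bits (Nat.clog 2 (x.length + c)) i ++ x) :
    searchIndex A t c x R = i := by
  have : (List.range (x.length + c)).find? (fun i =>
    decide ((candidate A c x R i).length = ktLength c x.length) &&
      decide (ktFun t c x.length (candidate A c x R i) =
        bits (Nat.clog 2 (x.length + c)) i ++ x)) = some i := by
    rw [List.find?_range_eq_some]
    refine ⟨by simp [hz, h], by simpa using hi, fun j hj => ?_⟩
    by_contra hj'
    simp only [Bool.not_eq_true', Bool.and_eq_false_iff, decide_eq_false_iff_not, not_or,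
      not_not] at hj'
    have := Kt_le_of_ktFun_eq hx (hj.trans hi) hj'.1 hj'.2
    omega
  rw [searchIndex, this, Option.getD_some]

theorem exists_preimage (hc : ∀ x : List Bool, Kt t x ≤ x.length + c) (x : List Bool) :
    ∃ z : List Bool, z.length = ktLength c x.length ∧
      ktFun t c x.length z = bits (Nat.clog 2 (x.length + c)) (Kt t x - 1) ++ x := by
  obtain ⟨D, hD, hU⟩ := exists_description t x
  have h₀ := Kt_pos t x
  have h₁ := hc x
  obtain ⟨h₂, h₃⟩ := bits_spec (lt_two_pow_clog (show Kt t x - 1 < x.length + c by omega))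
  set b := bits (Nat.clog 2 (x.length + c)) (Kt t x - 1)
  -- A shortest description, preceded by its length and padded to `n + c` bits.
  refine ⟨b ++ (D ++ List.replicate (x.length + c - Kt t x) false), ?_, ?_⟩
  · simp [h₂, hD, ktLength]
    omega
  · have h₄ : (b ++ (D ++ List.replicate (x.length + c - Kt t x) false)).take
        (Nat.clog 2 (x.length + c)) = b := by rw [← h₂, List.take_left]
    have h₅ : (b ++ (D ++ List.replicate (x.length + c - Kt t x) false)).drop
        (Nat.clog 2 (x.length + c)) = D ++ List.replicate (x.length + c - Kt t x) false := by
      rw [← h₂, List.drop_left]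
    simp only [ktFun, h₄, h₅, h₃]
    rw [show Kt t x - 1 + 1 = D.length by omega, List.take_left, hU, Option.getD_some]

theorem prob_le_prob_ktSolver (ht : PF t) {x z : List Bool} (hx : x ≠ [])
    (hc : Kt t x ≤ x.length + c)
    (hz : ktFun t c x.length z = bits (Nat.clog 2 (x.length + c)) (Kt t x - 1) ++ x) :
    A.prob (withSecurity (ktLength c x.length) (ktFun t c x.length z))
      {z' | z'.length = ktLength c x.length ∧ ktFun t c x.length z' = ktFun t c x.length z} ≤
    (ktSolver A t c ht).prob x {Computability.encodeNat (Kt t x)} := by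
  have h₀ := Kt_pos t x
  have hclog : Nat.clog 2 (x.length + c) ≤ x.length + c :=
    Nat.clog_le_of_le_pow Nat.lt_two_pow_self.le
  have hbits := (bits_spec (lt_two_pow_clog (show Kt t x - 1 < x.length + c by omega))).1
  rw [PPT.prob, PPT.prob, hz, ← avg_take (n := (ktSolver A t c ht).coins.eval x.length)]
  · refine avg_mono fun R _ => ?_
    split_ifs with h₁ h₂
    · exact le_rfl
    · refine absurd ?_ h₂
      change Computability.encodeNat (searchIndex A t c x R + 1) = _
      rw [searchIndex_eq hx (i := Kt t x - 1) (by omega) (by omega) h₁.1 h₁.2]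
      congr 1
      omega
    · norm_num
    · exact le_rfl
  · simp only [ktSolver, PPT.ofPF, Polynomial.eval_comp]
    refine eval_mono _ ?_
    simp [length_withSecurity, hbits, ktLength]
    omega

/-- Each `x` owns a preimage `φ x` of `K^t(x)‖x`, at which `A` fails at least as often as the solver
does at `x`. The factor is the ratio of the numbers of strings of lengths `m(n)` and `n`. -/
theorem one_sub_prob_ktSolver_le (ht : PF t) (hc : ∀ x : List Bool, Kt t x ≤ x.length + c) {n : ℕ}
    (hn : n ≠ 0) :
    1 - avg n (fun x => (ktSolver A t c ht).prob x {Computability.encodeNat (Kt t x)}) ≤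
      2 ^ (Nat.clog 2 (n + c) + c) * (1 - avg (ktLength c n) fun x =>
        A.prob (withSecurity (ktLength c n) (ktFun t c n x))
          {x' | x'.length = ktLength c n ∧ ktFun t c n x' = ktFun t c n x}) := by
  choose φ hφ₁ hφ₂ using exists_preimage hc
  have key := avg_le_of_injOn (a := n) (b := ktLength c n)
    (g := fun x => 1 - (ktSolver A t c ht).prob x {Computability.encodeNat (Kt t x)})
    (h := fun x => 1 - A.prob (withSecurity (ktLength c n) (ktFun t c n x))
          {x' | x'.length = ktLength c n ∧ ktFun t c n x' = ktFun t c n x}) φ ?_ ?_ ?_ ?_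
  · rw [avg_one_sub, avg_one_sub, ktLength, show Nat.clog 2 (n + c) + (n + c) =
      n + (Nat.clog 2 (n + c) + c) by ring, pow_add, mul_assoc] at key
    rw [ktLength, show Nat.clog 2 (n + c) + (n + c) = n + (Nat.clog 2 (n + c) + c) by ring]
    exact le_of_mul_le_mul_left key (by positivity)
  · rintro x rfl
    exact hφ₁ x
  -- The map `φ` is injective because `x` is the tail of the image of `φ x`.
  · intro x x' hx hx' h
    have h₁ := hφ₂ x
    have h₂ := hφ₂ x'
    rw [← h, hx', ← hx] at h₂
    refine (List.append_inj (h₁.symm.trans h₂) ?_).2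
    have h₃ := hc x
    have h₄ := hc x'
    have h₅ := Kt_pos t x
    have h₆ := Kt_pos t x'
    rw [(bits_spec (lt_two_pow_clog (show Kt t x - 1 < x.length + c by omega))).1,
      (bits_spec (lt_two_pow_clog (show Kt t x' - 1 < x.length + c by omega))).1]
  · rintro x rfl
    have := prob_le_prob_ktSolver (A := A) ht (x := x) (z := φ x)
      (by rintro rfl; exact hn rfl) (hc x) (hφ₂ x)
    linarith
  · intro x
    have := A.prob_le_one (withSecurity (ktLength c n) (ktFun t c n x))
          {x' | x'.length = ktLength c n ∧ ktFun t c n x' = ktFun t c n x}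
    linarith

end Search

theorem two_pow_clog_le (n : ℕ) : 2 ^ Nat.clog 2 n ≤ 2 * n + 1 := by
  rcases le_or_gt n 1 with h | h
  · interval_cases n <;> simp
  · have h₁ := Nat.pow_pred_clog_lt_self one_lt_two h
    have h₂ := Nat.clog_pos one_lt_two h
    rw [← Nat.succ_pred_eq_of_pos h₂, pow_succ]
    omega

theorem isWeakOWFFamily_ktFun {t : ℕ → ℕ} (ht : PF t) {p : Polynomial ℝ}
    (hp : ∀ n : ℕ, 1 ≤ n → 0 < p.eval (n : ℝ))
    (hard : IsHardOnAverage (fun n => 1 / p.eval (n : ℝ))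
      (fun x => Computability.encodeNat (Kt t x)))
    {c : ℕ} (hc : ∀ x : List Bool, Kt t x ≤ x.length + c) :
    IsWeakOWFFamily (ktLength c) (ktFun t c) := by
  refine ⟨⟨fun l => ((readUnary l).map fun p => ktFun t c p.1 p.2).getD [], ?_, ?_⟩, ?_⟩
  · exact (PF.getD (PF.optionMap (PF.readUnary PF.id')
      (PF.ktFun ht (by fun_prop) (by fun_prop))) (PF.const [])).polyTime
  · intro n x _
    simp only [readUnary_unary, Option.map_some, Option.getD_some]
  · obtain ⟨P, hP⟩ := exists_nat_polynomial_ge p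
    -- The hardness bound `P ≥ p` times the loss `2^k · 2^c`, with `2^k ≤ 2(n+c) + 1`; the final `1`
    -- makes the polynomial positive everywhere.
    refine ⟨P * (2 * (.X + .C c) + 1) * .C (2 ^ c) + 1, by simp, fun A => ?_⟩
    filter_upwards [hard (ktSolver A t c ht), Filter.eventually_ge_atTop 1] with n h hn
    have h₁ := one_sub_prob_ktSolver_le (A := A) ht hc (n := n) (by omega)
    set a := avg (ktLength c n) fun x =>
        A.prob (withSecurity (ktLength c n) (ktFun t c n x))
          {x' | x'.length = ktLength c n ∧ ktFun t c n x' = ktFun t c n x}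
    have h₂ : 1 / p.eval (n : ℝ) < 2 ^ (Nat.clog 2 (n + c) + c) * (1 - a) := by linarith
    have hpn := hp n hn
    rw [div_lt_iff₀ hpn] at h₂
    have h₃ : (2 : ℝ) ^ Nat.clog 2 (n + c) ≤ 2 * (n + c) + 1 := by
      exact_mod_cast two_pow_clog_le (n + c)
    have ha : 0 < 1 - a := by
      by_contra ha
      have : (2 : ℝ) ^ (Nat.clog 2 (n + c) + c) * (1 - a) * p.eval (n : ℝ) ≤ 0 :=
        mul_nonpos_of_nonpos_of_nonneg (mul_nonpos_of_nonneg_of_nonpos (by positivity)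
          (not_lt.1 ha)) hpn.le
      linarith
    suffices 1 / (((P * (2 * (.X + .C c) + 1) * .C (2 ^ c) + 1).eval n : ℕ) : ℝ) < 1 - a by linarith
    rw [div_lt_iff₀ (by simp; positivity)]
    refine h₂.trans_le ?_
    rw [mul_comm _ (1 - a), mul_assoc]
    refine mul_le_mul_of_nonneg_left ?_ ha.le
    simp only [Polynomial.eval_add, Polynomial.eval_mul, Polynomial.eval_C, Polynomial.eval_X,
      Polynomial.eval_one, Polynomial.eval_ofNat, Nat.cast_add, Nat.cast_mul, Nat.cast_one,
      Nat.cast_pow, Nat.cast_ofNat]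
    have := hP n
    calc (2 : ℝ) ^ (Nat.clog 2 (n + c) + c) * p.eval (n : ℝ)
        = p.eval (n : ℝ) * 2 ^ Nat.clog 2 (n + c) * 2 ^ c := by rw [pow_add]; ring
      _ ≤ (P.eval n : ℕ) * (2 * (n + c) + 1) * 2 ^ c := by gcongr
      _ ≤ _ := by linarith

end KOWF

namespace KOWF

open Finset

/-! ### From the family to a single weak one-way function -/

theorem PPT.prob_le_prob {A B : PPT} {x y : List Bool} {S S' : Set (List Bool)}
    (hle : B.coins.eval y.length ≤ A.coins.eval x.length)
    (h : ∀ R : List Bool, B.run (y, R.take (B.coins.eval y.length)) ∈ S → A.run (x, R) ∈ S') :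
    B.prob y S ≤ A.prob x S' := by
  rw [PPT.prob, PPT.prob, ← avg_take hle]
  refine avg_mono fun R _ => ?_
  split_ifs with h₁ h₂
  · exact le_rfl
  · exact absurd (h R h₁) h₂
  · norm_num
  · exact le_rfl

theorem PF.findGreatest {α : Type} [Code α] {p : α → ℕ → Prop} [∀ a, DecidablePred (p a)]
    {n : α → ℕ} (hn : PF n) (hp : PF fun x : α × ℕ => decide (p x.1 x.2)) :
    PF fun a => Nat.findGreatest (p a) (n a) := by
  have h : PF fun a => ((List.range (n a + 1)).reverse.find? fun i => decide (p a i)).getD 0 :=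
    PF.getD (PF.find? (by fun_prop) hp) (by fun_prop)
  convert h using 2 with a
  induction n a with
  | zero => by_cases h : p a 0 <;> simp [h]
  | succ k ih =>
    rw [List.range_succ, List.reverse_append, Nat.findGreatest_succ, ih]
    by_cases h : p a (k + 1) <;> simp [h]

section Single

variable (t : ℕ → ℕ) (B : PPT)

/-- The largest index whose domain fits into `N` bits. -/
def ktIndex (N : ℕ) : ℕ := Nat.findGreatest (fun n => ktLength 1 n ≤ N) N

/-- The family `ktFun t 1`, as one function that also outputs the length of its input. -/
def ktSingle (x : List Bool) : List Bool :=
  unary x.length ++ ktFun t 1 (ktIndex x.length) (x.take (ktLength 1 (ktIndex x.length)))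

variable {t}

theorem pf_ktIndex {α : Type} [Code α] {n : α → ℕ} (hn : PF n) : PF fun a => ktIndex (n a) := by
  have : PF fun p : α × ℕ => ktLength 1 p.2 := PF.ktLength (by fun_prop)
  exact PF.findGreatest hn (by fun_prop)

theorem pf_ktSingle (ht : PF t) : PF (ktSingle t) := by
  have h : PF fun x : List Bool => ktIndex x.length := pf_ktIndex (by fun_prop)
  have h' := PF.ktLength (c := 1) h
  have h'' := PF.ktFun (x := fun x : List Bool => x.take (ktLength 1 (ktIndex x.length))) ht
    (c := 1) h (by fun_prop)
  unfold ktSingle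
  fun_prop

theorem self_le_ktLength (n : ℕ) : n ≤ ktLength 1 n := by
  unfold ktLength
  omega

/-- The logarithm grows by at most one. As the gaps are at most 2, every length has a surplus of 0
or 1 bits, and two truncated inverters cover all lengths. -/
theorem ktLength_succ_le (n : ℕ) : ktLength 1 (n + 1) ≤ ktLength 1 n + 2 := by
  have h : Nat.clog 2 (n + 1 + 1) ≤ Nat.clog 2 (n + 1) + 1 := by
    refine Nat.clog_le_of_le_pow ?_
    have := Nat.le_pow_clog one_lt_two (n + 1)
    rw [pow_succ]
    omega
  unfold ktLength
  omega

theorem le_ktIndex {n N : ℕ} (h : ktLength 1 n ≤ N) : n ≤ ktIndex N :=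
  Nat.le_findGreatest ((self_le_ktLength n).trans h) h

theorem exists_eq_ktLength_add {N : ℕ} (h : 1 ≤ N) :
    ∃ r < 2, N = ktLength 1 (ktIndex N) + r := by
  have h₁ : ktLength 1 (ktIndex N) ≤ N :=
    Nat.findGreatest_spec (P := fun n => ktLength 1 n ≤ N) (m := 0) (Nat.zero_le _) (by simpa [ktLength])
  have h₂ : N < ktLength 1 (ktIndex N + 1) := by
    by_contra h₂
    have := le_ktIndex (not_lt.1 h₂)
    omega
  have h₃ := ktLength_succ_le (ktIndex N)
  exact ⟨N - ktLength 1 (ktIndex N), by omega, by omega⟩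

/-- An inverter for the family from an inverter `B` for `ktSingle`, for inputs with `r` bits more
than the domain of the family has. -/
noncomputable def truncatedInverter (r : ℕ) : PPT :=
  let m (w : List Bool) : ℕ := ((readUnary w).getD (0, [])).1
  let query (w : List Bool) : List Bool :=
    withSecurity (m w + r) (unary (m w + r) ++ ((readUnary w).getD (0, [])).2)
  have hm : PF m := ((PF.readUnary PF.id').getD (PF.const _)).fst'
  have hm' : PF fun w => ((readUnary w).getD (0, [])).2 :=
    ((PF.readUnary PF.id').getD (PF.const _)).snd'
  have hquery : PF query := by fun_prop
  -- The query writes `m + r` in unary twice, so it is at most `2r` longer than twice the input.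
  .ofPF (B.coins.comp (2 * .X + .C (2 * r)))
    (fun p => (B.run (query p.1, p.2.take (B.coins.eval (query p.1).length))).take (m p.1)) (by
      have h₁ : PF fun p : List Bool × List Bool => query p.1 := hquery.comp PF.fst
      have h₂ : PF fun p : List Bool × List Bool => B.coins.eval (query p.1).length :=
        PF.eval _ (by fun_prop)
      have h₃ : PF fun p : List Bool × List Bool => m p.1 := hm.comp PF.fst
      exact PF.take h₃ (B.pf.comp (by fun_prop)))

variable {B}

/-- The unary prefix of the image forces an answer of `B` to have the right length, so its
truncation is a preimage in the domain of the family. -/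
theorem invProb_ktSingle_le {r n : ℕ} (hn : ktIndex (ktLength 1 n + r) = n) :
    invProb (ktSingle t) B (ktLength 1 n + r) ≤ avg (ktLength 1 n) fun x =>
      (truncatedInverter B r).prob (withSecurity (ktLength 1 n) (ktFun t 1 n x))
        {x' | x'.length = ktLength 1 n ∧ ktFun t 1 n x' = ktFun t 1 n x} := by
  rw [invProb, ← avg_take (a := ktLength 1 n) (n := ktLength 1 n + r) (Nat.le_add_right _ r)]
  refine avg_mono fun x hx => PPT.prob_le_prob ?_ fun R hR => ?_
  · simp only [truncatedInverter, PPT.ofPF, Polynomial.eval_comp]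
    refine eval_mono _ ?_
    simp [length_withSecurity, ktSingle, hx, hn, unary]
    omega
  · simp only [ktSingle, hx, hn, Set.mem_preimage, Set.mem_singleton_iff] at hR
    simp only [truncatedInverter, PPT.ofPF, withSecurity, readUnary_unary, Option.getD_some]
    simp only [withSecurity] at hR
    generalize B.run _ = z at hR ⊢
    have h := congrArg readUnary hR
    rw [readUnary_unary, readUnary_unary] at h
    simp only [Option.some.injEq, Prod.mk.injEq] at h
    obtain ⟨h₁, h₂⟩ := h
    rw [h₁, hn] at h₂
    exact ⟨by simp [h₁], h₂⟩

theorem isWeakOWF_ktSingle (ht : PF t) (h : IsWeakOWFFamily (ktLength 1) (ktFun t 1)) :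
    IsWeakOWF (ktSingle t) := by
  obtain ⟨-, s, hs, h⟩ := h
  refine ⟨(pf_ktSingle ht).polyTime, s, hs, fun B => ?_⟩
  obtain ⟨n₀, h₀⟩ := Filter.eventually_atTop.1
    ((h (truncatedInverter B 0)).and (h (truncatedInverter B 1)))
  filter_upwards [Filter.eventually_ge_atTop (ktLength 1 n₀), Filter.eventually_ge_atTop 1]
    with N hN hN₁
  obtain ⟨r, hr, hNr⟩ := exists_eq_ktLength_add hN₁
  have hn : n₀ ≤ ktIndex N := le_ktIndex hN
  have h₁ : avg (ktLength 1 (ktIndex N)) (fun x => (truncatedInverter B r).prob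
      (withSecurity (ktLength 1 (ktIndex N)) (ktFun t 1 (ktIndex N) x))
        {x' | x'.length = ktLength 1 (ktIndex N) ∧
          ktFun t 1 (ktIndex N) x' = ktFun t 1 (ktIndex N) x}) <
      1 - 1 / ((s.eval (ktIndex N) : ℕ) : ℝ) := by
    interval_cases r
    exacts [(h₀ _ hn).1, (h₀ _ hn).2]
  have h₂ := invProb_ktSingle_le (t := t) (B := B) (r := r) (n := ktIndex N) (by rw [← hNr])
  rw [← hNr] at h₂
  -- The index is at most `N`, so the polynomial `s` of the family also serves the single function.
  have h₃ : ((s.eval (ktIndex N) : ℕ) : ℝ) ≤ (s.eval N : ℕ) :=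
    Nat.cast_le.2 (eval_mono s ((self_le_ktLength _).trans (by omega)))
  have h₄ : (0 : ℝ) < (s.eval (ktIndex N) : ℕ) := Nat.cast_pos.2 (hs _)
  have h₅ := one_div_le_one_div_of_le h₄ h₃
  linarith

end Single

end KOWF

namespace KOWF

open Finset

/-! ### Blocks of bit strings -/

/-- The `i`-th block of length `n`. -/
def block (n i : ℕ) (X : List Bool) : List Bool := (X.drop (i * n)).take n

/-- Replace the `i`-th block of length `n`. -/
def setBlock (n i : ℕ) (x X : List Bool) : List Bool :=
  X.take (i * n) ++ (x ++ X.drop ((i + 1) * n))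

theorem mul_le_of_lt {n m i N : ℕ} (h : n * m ≤ N) (hi : i < m) : (i + 1) * n ≤ N :=
  (Nat.mul_le_mul_right n hi).trans (by rwa [mul_comm])

theorem length_setBlock {n m i N : ℕ} (h : n * m ≤ N) (hi : i < m) {x X : List Bool}
    (hx : x.length = n) (hX : X.length = N) : (setBlock n i x X).length = N := by
  have := mul_le_of_lt h hi
  rw [add_mul] at this
  simp [setBlock, hX, hx, add_mul]
  omega

theorem block_setBlock {n m i j N : ℕ} (h : n * m ≤ N) (hi : i < m) {x X : List Bool}
    (hx : x.length = n) (hX : X.length = N) :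
    block n j (setBlock n i x X) = if j = i then x else block n j X := by
  have h₁ := mul_le_of_lt h hi
  have h₂ : (X.take (i * n)).length = i * n := by
    rw [add_mul] at h₁
    rw [List.length_take, hX]
    omega
  split_ifs with hji
  · subst hji
    rw [block, setBlock, List.drop_left' h₂, List.take_left' hx]
  · rcases lt_or_gt_of_ne hji with hlt | hgt
    · have h₃ : j * n + n ≤ i * n := by
        simpa [add_mul] using Nat.mul_le_mul_right n (Nat.succ_le_of_lt hlt)
      rw [block, setBlock, List.drop_append_of_le_length (by omega),
        List.take_append_of_le_length (by rw [List.length_drop]; omega), block, List.drop_take,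
        List.take_take, min_eq_left (by omega)]
    · have h₃ : i * n + n ≤ j * n := by
        simpa [add_mul] using Nat.mul_le_mul_right n (Nat.succ_le_of_lt hgt)
      rw [block, setBlock, block, List.drop_append, List.drop_append, h₂, hx,
        List.drop_eq_nil_of_le (by omega), List.drop_eq_nil_of_le (by omega), List.drop_drop]
      simp only [List.nil_append]
      congr 2
      rw [add_mul]
      omega

/-- Fubini: one block of a uniform string is uniform and independent of the rest. -/
theorem avg_mul_block {n m i N : ℕ} (h : n * m ≤ N) (hi : i < m) (g b : List Bool → ℝ) :
    avg N (fun X => g (block n i X) * b X) =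
      avg n fun x => g x * avg N fun X => b (setBlock n i x X) := by
  obtain ⟨r, rfl⟩ := Nat.exists_eq_add_of_le (mul_le_of_lt h hi)
  have hN : (i + 1) * n + r = i * n + (n + r) := by ring
  have key : ∀ u x y v : List Bool, u.length = i * n → x.length = n → y.length = n →
      block n i (u ++ (y ++ v)) = y ∧ setBlock n i x (u ++ (y ++ v)) = u ++ (x ++ v) := by
    intro u x y v hu hx hy
    refine ⟨by rw [block, List.drop_left' hu, List.take_left' hy], ?_⟩
    rw [setBlock, List.take_left' hu, add_mul, one_mul, ← List.drop_drop, List.drop_left' hu,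
      List.drop_left' hy]
  have h₁ : avg ((i + 1) * n + r) (fun X => g (block n i X) * b X) =
      avg (i * n) fun u => avg n fun x => g x * avg r fun v => b (u ++ (x ++ v)) := by
    rw [hN, avg_append]
    refine avg_congr fun u hu => ?_
    rw [avg_append]
    refine avg_congr fun x hx => ?_
    rw [← avg_mul_left]
    exact avg_congr fun v _ => by rw [(key u x x v hu hx hx).1]
  rw [h₁, avg_comm]
  refine avg_congr fun x hx => ?_
  rw [avg_mul_left]
  congr 1
  rw [hN, avg_append]
  refine avg_congr fun u hu => ?_
  rw [avg_append]
  -- `setBlock` forgets the old block, so an average over it can be inserted.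
  rw [← avg_const n (avg r fun v => b (u ++ (x ++ v)))]
  refine avg_congr fun y hy => ?_
  exact avg_congr fun v _ => by rw [(key u x y v hu hx hy).2]

/-- Disjoint blocks are independent. This serves both the blocks of the input and the fresh random
bits of repeated attempts. -/
theorem avg_prod_block {n m N : ℕ} (h : n * m ≤ N) (g : List Bool → ℝ) :
    avg N (fun X => ∏ i ∈ range m, g (block n i X)) = avg n g ^ m := by
  induction m generalizing N with
  | zero => simp [avg_const]
  | succ m ih =>
    obtain ⟨r, rfl⟩ := Nat.exists_eq_add_of_le (show n ≤ N by nlinarith)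
    have hr : n * m ≤ r := by rw [mul_add] at h; omega
    rw [avg_append, pow_succ, mul_comm, ← ih hr, mul_comm, ← avg_mul_left]
    refine avg_congr fun x hx => ?_
    rw [mul_comm, ← avg_mul_left]
    refine avg_congr fun y _ => ?_
    rw [prod_range_succ', mul_comm]
    congr 1
    · simp [block, List.take_left' hx]
    · refine prod_congr rfl fun i _ => ?_
      rw [block, add_mul, one_mul, add_comm, ← List.drop_drop, List.drop_left' hx, block]

open Classical in
/-- If the average of `b` is substantial, then for most `x` there is a block position at which
fixing `x` leaves a substantial average. -/
theorem avg_le_of_blocks {n m N : ℕ} (h : n * m ≤ N) {b : List Bool → ℝ} (hb₀ : ∀ X, 0 ≤ b X)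
    (hb₁ : ∀ X, b X ≤ 1) {δ : ℝ} (hδ : 0 ≤ δ) :
    avg N b ≤ m * δ + (1 - avg n fun x =>
      if ∀ i < m, avg N (fun X => b (setBlock n i x X)) < δ then 1 else 0) ^ m := by
  set bad : List Bool → ℝ := fun x =>
    if ∀ i < m, avg N (fun X => b (setBlock n i x X)) < δ then 1 else 0 with hbad
  have hbad₀ : ∀ x, bad x = 0 ∨ bad x = 1 := fun x => by
    simp only [hbad]
    split_ifs <;> simp
  -- If some block is bad, its summand is already `b X`; if none is, the product is `1`. Each
  -- summand averages to at most `δ`.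
  have hpt : ∀ X, b X ≤ (∑ i ∈ range m, bad (block n i X) * b X) +
      ∏ i ∈ range m, (1 - bad (block n i X)) := by
    intro X
    by_cases hX : ∃ i ∈ range m, bad (block n i X) = 1
    · obtain ⟨i, hi, h₁⟩ := hX
      have h₂ : b X ≤ ∑ i ∈ range m, bad (block n i X) * b X := by
        refine le_trans (by rw [h₁, one_mul]) (single_le_sum (f := fun i => bad (block n i X) * b X)
          (fun j _ => mul_nonneg ?_ (hb₀ X)) hi)
        rcases hbad₀ (block n j X) with h | h <;> simp [h]
      have h₃ : 0 ≤ ∏ i ∈ range m, (1 - bad (block n i X)) := prod_nonneg fun j _ => by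
        rcases hbad₀ (block n j X) with h | h <;> simp [h]
      linarith
    · push Not at hX
      have h₁ : ∀ i ∈ range m, bad (block n i X) = 0 := fun i hi =>
        (hbad₀ _).resolve_right (hX i hi)
      rw [sum_eq_zero fun i hi => by rw [h₁ i hi, zero_mul],
        prod_congr rfl fun i hi => by rw [h₁ i hi, sub_zero], prod_const_one, zero_add]
      exact hb₁ X
  refine (avg_mono fun X _ => hpt X).trans ?_
  rw [avg_add, avg_sum, avg_prod_block h (fun x => 1 - bad x), avg_one_sub]
  gcongr
  refine (sum_le_sum (g := fun _ => δ) fun i hi => ?_).trans (by simp)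
  rw [avg_mul_block h (mem_range.1 hi)]
  refine (avg_mono fun x _ => ?_).trans (avg_const n δ).le
  simp only [hbad]
  split_ifs with h'
  · rw [one_mul]
    exact (h' i (mem_range.1 hi)).le
  · rwa [zero_mul]

end KOWF

namespace KOWF

open Finset

/-! ### Hardness amplification -/

section Amplification

variable (f : List Bool → List Bool) (s : Polynomial ℕ) (B : PPT)

/-- The number of blocks. -/
noncomputable def blockCount : Polynomial ℕ := 2 * .X * s

/-- The block length for inputs of length `N`. -/
noncomputable def blockLength (N : ℕ) : ℕ :=
  Nat.findGreatest (fun n => n * (blockCount s).eval n ≤ N) N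

/-- The values of `f` at all blocks, together with the length of the input. -/
noncomputable def product (X : List Bool) : List Bool :=
  code (X.length, (List.range ((blockCount s).eval (blockLength s X.length))).map fun j =>
    f (block (blockLength s X.length) j X))

/-- The value of `product` with the entry `i` replaced by `y`. -/
noncomputable def planted (n : ℕ) (y : List Bool) (N i : ℕ) (X : List Bool) : List Bool :=
  code (N, (List.range ((blockCount s).eval n)).map fun j => if j = i then y else f (block n j X))

/-- The preimage of `y` that `B` yields when `y` is planted at `i`. -/
noncomputable def attempt (n : ℕ) (y R : List Bool) (N i : ℕ) : List Bool :=
  let v := withSecurity N (planted f s n y N i (R.take N))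
  block n i (B.run (v, (R.drop N).take (B.coins.eval v.length)))

/-- An inverter of `f`, that makes `T(n)` attempts with `S(n)` random bits each for every length
below `L(n)` and every position. -/
noncomputable def blockInverterRun (T S L : Polynomial ℕ) (p : List Bool × List Bool) : List Bool :=
  let n := ((readUnary p.1).getD (0, [])).1
  let y := ((readUnary p.1).getD (0, [])).2
  (((List.range (T.eval n)).flatMap fun j => (List.range (L.eval n)).flatMap fun N =>
    (List.range ((blockCount s).eval n)).map fun i =>
      attempt f s B n y (block (S.eval n) j p.2) N i).find? fun x => decide (f x = y)).getD []

variable {f s B}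

/-! ### Polynomial time of the product and of its inverter -/

section PF

variable {α : Type} [Code α]

@[fun_prop]
theorem PF.block {n i : α → ℕ} {X : α → List Bool} (hn : PF n) (hi : PF i) (hX : PF X) :
    PF fun a => block (n a) (i a) (X a) := by
  unfold KOWF.block
  fun_prop

theorem pf_blockLength {N : α → ℕ} (hN : PF N) : PF fun a => blockLength s (N a) := by
  have : PF fun p : α × ℕ => (blockCount s).eval p.2 := PF.eval _ (by fun_prop)
  exact PF.findGreatest hN (by fun_prop)

theorem pf_product (hf : PF f) : PF (product f s) := by
  have h : PF fun X : List Bool => blockLength s X.length := pf_blockLength (by fun_prop)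
  refine PF.codeWord (PF.prodMk (by fun_prop) (PF.map (PF.range (PF.eval _ h)) (hf.comp ?_)))
  exact PF.block (h.comp PF.fst) (by fun_prop) (by fun_prop)

theorem pf_attempt (hf : PF f) {n N i : α → ℕ} {y R : α → List Bool} (hn : PF n) (hy : PF y)
    (hR : PF R) (hN : PF N) (hi : PF i) :
    PF fun a => attempt f s B (n a) (y a) (R a) (N a) (i a) := by
  have hv : PF fun a => withSecurity (N a)
      (planted f s (n a) (y a) (N a) (i a) ((R a).take (N a))) := by
    refine PF.withSecurity hN (PF.codeWord (PF.prodMk hN (PF.map (PF.range (PF.eval _ hn)) ?_)))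
    exact PF.ite (by fun_prop) (by fun_prop) (hf.comp (by fun_prop))
  refine PF.block hn hi (B.pf.comp (hv.prodMk (PF.take (PF.eval _ ?_) ?_))) <;> fun_prop

theorem pf_blockInverterRun (hf : PF f) (T S L : Polynomial ℕ) :
    PF (blockInverterRun f s B T S L) := by
  refine PF.getD (PF.find? (PF.flatMap (PF.range (PF.eval _ (by fun_prop)))
    (PF.flatMap (PF.range (PF.eval _ ?_)) (PF.map (PF.range (PF.eval _ ?_))
      (pf_attempt hf ?_ ?_ (PF.block (PF.eval _ ?_) ?_ ?_) ?_ ?_))))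
    (PF.decide_eq (hf.comp PF.snd) ?_)) (PF.const _)
  all_goals fun_prop

end PF

end Amplification

end KOWF

namespace KOWF

open Finset

/-! ### Success probability of planting a challenge -/

section AmplificationAnalysis

variable {f : List Bool → List Bool} {s : Polynomial ℕ} {B : PPT}

theorem blockLength_spec (N : ℕ) :
    blockLength s N * (blockCount s).eval (blockLength s N) ≤ N :=
  Nat.findGreatest_spec (P := fun n => n * (blockCount s).eval n ≤ N) (Nat.zero_le N) (by simp)

theorem le_blockLength (hs : ∀ n, 0 < s.eval n) {n N : ℕ} (h : n * (blockCount s).eval n ≤ N) :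
    n ≤ blockLength s N := by
  refine Nat.le_findGreatest (P := fun n => n * (blockCount s).eval n ≤ N) (le_trans ?_ h) h
  have := hs n
  rcases Nat.eq_zero_or_pos n with rfl | hn
  · simp
  · refine Nat.le_mul_of_pos_right n ?_
    simp [blockCount]
    omega

/-- An inverter of `f` knows `n` but not the length `N` at which `B` is good; since `N` is
polynomially bounded in `n`, it can try all candidates. -/
theorem lt_of_blockLength (hs : ∀ n, 0 < s.eval n) (N : ℕ) :
    N < (blockLength s N + 1) * (blockCount s).eval (blockLength s N + 1) := by
  by_contra h
  have := le_blockLength hs (not_lt.1 h)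
  omega

/-- Planting needs only `f x`, yet gives `B` a genuine image under the product. -/
theorem planted_eq {N i : ℕ} (hi : i < (blockCount s).eval (blockLength s N)) {x X : List Bool}
    (hx : x.length = blockLength s N) (hX : X.length = N) :
    planted f s (blockLength s N) (f x) N i X = product f s (setBlock (blockLength s N) i x X) := by
  have h := length_setBlock (blockLength_spec N) hi hx hX
  rw [planted, product, h]
  congr 2
  refine List.map_congr_left fun j _ => ?_
  rw [block_setBlock (blockLength_spec N) hi hx hX, apply_ite f]

/-- The recorded length makes both strings split into blocks in the same way. -/
theorem block_of_product_eq {X X' : List Bool} (h : product f s X = product f s X') {i : ℕ}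
    (hi : i < (blockCount s).eval (blockLength s X.length)) :
    f (block (blockLength s X.length) i X) = f (block (blockLength s X.length) i X') := by
  have h := code_injective h
  simp only [Prod.mk.injEq] at h
  obtain ⟨h₁, h₂⟩ := h
  rw [← h₁] at h₂
  exact List.map_inj_left.1 h₂ i (List.mem_range.2 hi)

theorem f_attempt {N i : ℕ} (hi : i < (blockCount s).eval (blockLength s N)) {x R : List Bool}
    (hx : x.length = blockLength s N) (hR : N ≤ R.length)
    (h : let v := withSecurity N (product f s (setBlock (blockLength s N) i x (R.take N)))
      product f s (B.run (v, (R.drop N).take (B.coins.eval v.length))) =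
        product f s (setBlock (blockLength s N) i x (R.take N))) :
    f (attempt f s B (blockLength s N) (f x) R N i) = f x := by
  have hX : (R.take N).length = N := by simpa using hR
  have h₁ := length_setBlock (blockLength_spec N) hi hx hX
  have h₂ := block_of_product_eq h.symm (i := i) (by rwa [h₁])
  rw [h₁, block_setBlock (blockLength_spec N) hi hx hX, if_pos rfl] at h₂
  simp only [attempt, planted_eq hi hx hX]
  exact h₂.symm

-- The tape of an attempt supplies the `N` bits of filler and then the coins of `B`.
open Classical in
theorem avg_setBlock_le {N i S : ℕ} (hi : i < (blockCount s).eval (blockLength s N))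
    (hS : ∀ X : List Bool, X.length = N →
      N + B.coins.eval (withSecurity N (product f s X)).length ≤ S) {x : List Bool}
    (hx : x.length = blockLength s N) :
    avg N (fun X => B.prob (withSecurity N (product f s (setBlock (blockLength s N) i x X)))
      (product f s ⁻¹' {product f s (setBlock (blockLength s N) i x X)})) ≤
    avg S fun R => if f (attempt f s B (blockLength s N) (f x) R N i) = f x then 1 else 0 := by
  obtain ⟨r, rfl⟩ := Nat.exists_eq_add_of_le
    ((Nat.le_add_right N _).trans (hS (List.replicate N false) List.length_replicate))
  rw [avg_append]
  refine avg_mono fun X hX => ?_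
  have h₁ := length_setBlock (blockLength_spec N) hi hx hX
  rw [PPT.prob, ← avg_take (Nat.le_of_add_le_add_left (hS _ h₁))]
  refine avg_mono fun R _ => ?_
  split_ifs with h₂ h₃
  · exact le_rfl
  · refine absurd (f_attempt hi hx (by simp [hX]) ?_) h₃
    simp only [List.take_left' hX, List.drop_left' hX]
    exact h₂
  · norm_num
  · exact le_rfl

/-- Candidates are checked, so one good attempt suffices and wrong guesses of `N` and `i` are
harmless. -/
theorem f_blockInverterRun {T S L : Polynomial ℕ} {n : ℕ} {y R : List Bool} {j N i : ℕ}
    (hj : j < T.eval n) (hN : N < L.eval n) (hi : i < (blockCount s).eval n)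
    (h : f (attempt f s B n y (block (S.eval n) j R) N i) = y) :
    f (blockInverterRun f s B T S L (withSecurity n y, R)) = y := by
  simp only [blockInverterRun, withSecurity, readUnary_unary, Option.getD_some]
  generalize hl : List.flatMap _ _ = l
  have hmem : attempt f s B n y (block (S.eval n) j R) N i ∈ l := by
    rw [← hl]
    refine List.mem_flatMap.2 ⟨j, List.mem_range.2 hj, List.mem_flatMap.2 ⟨N, List.mem_range.2 hN,
      List.mem_map.2 ⟨i, List.mem_range.2 hi, rfl⟩⟩⟩
  rcases ho : l.find? fun x => decide (f x = y) with _ | z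
  · rw [List.find?_eq_none] at ho
    simpa [h] using ho _ hmem
  · simpa using List.find?_some ho

/-- The inverter of `f` as a probabilistic algorithm. -/
noncomputable def blockInverter (hf : PF f) (s : Polynomial ℕ) (B : PPT) (T S L : Polynomial ℕ) :
    PPT :=
  .ofPF (S * T) (blockInverterRun f s B T S L) (pf_blockInverterRun hf T S L)

/-- Only attempts at the given `N` and `i` are counted; they use disjoint blocks of the tape, so the
chance that all fail is at most the power. -/
theorem le_prob_blockInverter (hf : PF f) {T S L : Polynomial ℕ} {N i : ℕ}
    (hN : N < L.eval (blockLength s N)) (hi : i < (blockCount s).eval (blockLength s N))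
    (hS : ∀ X : List Bool, X.length = N →
      N + B.coins.eval (withSecurity N (product f s X)).length ≤ S.eval (blockLength s N))
    {x : List Bool} (hx : x.length = blockLength s N) :
    1 - (1 - avg N fun X =>
      B.prob (withSecurity N (product f s (setBlock (blockLength s N) i x X)))
        (product f s ⁻¹' {product f s (setBlock (blockLength s N) i x X)})) ^
          T.eval (blockLength s N) ≤
    (blockInverter hf s B T S L).prob (withSecurity (blockLength s N) (f x)) (f ⁻¹' {f x}) := by
  classical
  have h₁ := avg_setBlock_le hi hS hx
  set n := blockLength s N
  set q := avg N fun X => B.prob (withSecurity N (product f s (setBlock n i x X)))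
        (product f s ⁻¹' {product f s (setBlock n i x X)})
  set pass : List Bool → ℝ := fun R => if f (attempt f s B n (f x) R N i) = f x then 1 else 0
    with hpass
  have hle : S.eval n * T.eval n ≤
      (blockInverter hf s B T S L).coins.eval (withSecurity n (f x)).length := by
    simp only [blockInverter, PPT.ofPF, Polynomial.eval_mul, length_withSecurity]
    have hn : n ≤ n + 1 + (f x).length := by omega
    exact Nat.mul_le_mul (eval_mono S hn) (eval_mono T hn)
  have h₂ : avg (S.eval n) (fun R => 1 - pass R) ^ T.eval n ≤ (1 - q) ^ T.eval n := by
    refine pow_le_pow_left₀ (avg_nonneg fun R _ => ?_) ?_ _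
    · simp only [hpass]
      split_ifs <;> norm_num
    · rw [avg_one_sub]
      linarith
  rw [← avg_prod_block hle] at h₂
  rw [PPT.prob]
  refine (sub_le_sub_left h₂ 1).trans ?_
  rw [← avg_one_sub]
  refine avg_mono fun R _ => ?_
  split_ifs with h₃
  · have : 0 ≤ ∏ j ∈ range (T.eval n), (1 - pass (block (S.eval n) j R)) :=
      prod_nonneg fun j _ => by
        simp only [hpass]
        split_ifs <;> norm_num
    linarith
  · rw [prod_eq_one fun j hj => ?_, sub_self]
    rw [hpass]
    dsimp only
    rw [if_neg fun h => h₃ (f_blockInverterRun (mem_range.1 hj) hN hi h), sub_zero]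

end AmplificationAnalysis

end KOWF

namespace KOWF

/-! ### Choice of the parameters in the amplification -/

open Finset Filter Topology

theorem length_le_of_pf {g : List Bool → List Bool} (hg : PF g) :
    ∃ P : Polynomial ℕ, ∀ X, (g X).length ≤ P.eval X.length := by
  obtain ⟨P, hP⟩ := hg.size_le
  refine ⟨P.comp (4 * .X + 1), fun X => ((length_lt_size _).le.trans (hP X)).trans ?_⟩
  rw [Polynomial.eval_comp]
  refine eval_mono P ((size_bits_le X).trans (by simp))

theorem one_sub_pow_le_exp {a : ℝ} (ha : a ≤ 1) (m : ℕ) : (1 - a) ^ m ≤ Real.exp (-(m * a)) := by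
  have := pow_le_pow_left₀ (sub_nonneg.2 ha) (Real.one_sub_le_exp_neg a) m
  rwa [← Real.exp_nat_mul, mul_neg] at this

section AmplificationBounds

variable {f : List Bool → List Bool} {s : Polynomial ℕ} {B : PPT}

/-- Suppose the probability exceeds `ε = 1/N^k`, and let `δ = ε/(2m)`. A density of bad `x` above
`1/(2s)` would give `(1 - 1/(2s))^m ≤ e^(-n) < ε/2`, as `m = 2ns`. For a good `x`, `Tδ ≥ 2s`
attempts are expected to succeed, so all fail with probability at most `e^(-2s) ≤ 1/(2s)`. The two
losses add up to `1/s`, against `hweak`. -/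
theorem invProb_product_le (hf : PF f) (hs : ∀ n, 0 < s.eval n) {T S L : Polynomial ℕ} {N k : ℕ}
    (hn : 0 < blockLength s N) (hN : N < L.eval (blockLength s N))
    (hS : ∀ X : List Bool, X.length = N →
      N + B.coins.eval (withSecurity N (product f s X)).length ≤ S.eval (blockLength s N))
    (hT : T = 4 * blockCount s * s * L ^ k)
    (hL : 2 * ((L.eval (blockLength s N) : ℕ) : ℝ) ^ k < Real.exp (blockLength s N))
    (hweak : invProb f (blockInverter hf s B T S L) (blockLength s N) <
      1 - 1 / ((s.eval (blockLength s N) : ℕ) : ℝ)) :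
    invProb (product f s) B N ≤ 1 / (N : ℝ) ^ k := by
  classical
  have hspec := blockLength_spec (s := s) N
  have hM : (blockCount s).eval (blockLength s N) = 2 * blockLength s N * s.eval (blockLength s N) := by
    simp [blockCount]
  have hprob := fun i (hi : i < (blockCount s).eval (blockLength s N)) x hx =>
    le_prob_blockInverter hf (T := T) hN hi hS (x := x) hx
  have hTn : T.eval (blockLength s N) = 4 * (blockCount s).eval (blockLength s N) *
      s.eval (blockLength s N) * L.eval (blockLength s N) ^ k := by
    simp [hT]
  have hsn := hs (blockLength s N)
  set n := blockLength s N
  set m := (blockCount s).eval n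
  have hm : 0 < m := by rw [hM]; positivity
  have hN₀ : 0 < N := lt_of_lt_of_le (Nat.mul_pos hn hm) hspec
  have hsR : (0 : ℝ) < s.eval n := Nat.cast_pos.2 hsn
  have hmR : (0 : ℝ) < m := Nat.cast_pos.2 hm
  have hMR : (m : ℝ) = 2 * n * s.eval n := by rw [hM]; push_cast; ring
  have hNk : (0 : ℝ) < (N : ℝ) ^ k := pow_pos (Nat.cast_pos.2 hN₀) k
  have hNL : (N : ℝ) ^ k ≤ ((L.eval n : ℕ) : ℝ) ^ k := by
    gcongr
  have hLk := hNk.trans_le hNL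
  by_contra hε
  rw [not_le] at hε
  set δ : ℝ := 1 / (N : ℝ) ^ k / (2 * m) with hδ
  have hδ₀ : 0 ≤ δ := by positivity
  set b : List Bool → ℝ := fun X => B.prob (withSecurity N (product f s X))
    (product f s ⁻¹' {product f s X})
  have hb₀ : ∀ X, 0 ≤ b X := fun X => PPT.prob_nonneg _ _ _
  have hb₁ : ∀ X, b X ≤ 1 := fun X => PPT.prob_le_one _ _ _
  have h₁ := avg_le_of_blocks hspec hb₀ hb₁ hδ₀
  set bad : List Bool → ℝ := fun x =>
    if ∀ i < m, avg N (fun X => b (setBlock n i x X)) < δ then 1 else 0 with hbad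
  have hmδ : m * δ = 1 / (N : ℝ) ^ k / 2 := by
    rw [hδ]
    field_simp
  have hbad₁ : avg n bad ≤ 1 := avg_le_one fun x _ => by
    simp only [hbad]
    split_ifs <;> norm_num
  have h₂ : 1 / (N : ℝ) ^ k / 2 < (1 - avg n bad) ^ m := by
    have : 1 / (N : ℝ) ^ k < avg N b := hε
    linarith
  have h₃ : avg n bad ≤ 1 / (2 * (s.eval n : ℕ)) := by
    by_contra h₃
    rw [not_le] at h₃
    have h₄ := one_sub_pow_le_exp hbad₁ m
    have h₅ : Real.exp (-(m * avg n bad)) ≤ Real.exp (-n) := by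
      rw [Real.exp_le_exp, neg_le_neg_iff]
      calc (n : ℝ) = m * (1 / (2 * (s.eval n : ℕ))) := by rw [hMR]; field_simp
        _ ≤ m * avg n bad := by gcongr
    have h₆ : Real.exp (-n) < 1 / (N : ℝ) ^ k / 2 := by
      rw [Real.exp_neg, div_div, ← one_div]
      refine one_div_lt_one_div_of_lt (by positivity) ?_
      linarith
    linarith
  have h₄ : 1 - avg n bad - 1 / (2 * (s.eval n : ℕ)) ≤ invProb f (blockInverter hf s B T S L) n := by
    rw [← avg_one_sub, ← avg_const n (1 / (2 * ((s.eval n : ℕ) : ℝ))), ← avg_sub]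
    refine avg_mono fun x hx => ?_
    have hpos : 0 < 1 / (2 * ((s.eval n : ℕ) : ℝ)) := by positivity
    simp only [hbad]
    split_ifs with hx'
    · have := (blockInverter hf s B T S L).prob_nonneg (withSecurity n (f x)) (f ⁻¹' {f x})
      linarith
    · push Not at hx'
      obtain ⟨i, hi, hq⟩ := hx'
      have h₅ := hprob i hi x hx
      have hq₁ : avg N (fun X => b (setBlock n i x X)) ≤ 1 := avg_le_one fun X _ => hb₁ _
      have h₆ : (1 - avg N (fun X => b (setBlock n i x X))) ^ T.eval n ≤ 1 / (2 * (s.eval n : ℕ)) := by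
        refine (one_sub_pow_le_exp hq₁ _).trans ?_
        have h₇ : 2 * ((s.eval n : ℕ) : ℝ) ≤ T.eval n * avg N (fun X => b (setBlock n i x X)) := by
          calc 2 * ((s.eval n : ℕ) : ℝ) ≤ 2 * s.eval n * (((L.eval n : ℕ) : ℝ) ^ k / (N : ℝ) ^ k) :=
                le_mul_of_one_le_right (by positivity) ((one_le_div hNk).2 hNL)
            _ = T.eval n * δ := by
                rw [hTn, hδ]
                push_cast
                field_simp
                ring
            _ ≤ _ := by gcongr
        rw [Real.exp_neg, ← one_div]
        refine one_div_le_one_div_of_le (by positivity) ?_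
        have := Real.add_one_le_exp (((T.eval n : ℕ) : ℝ) * avg N (fun X => b (setBlock n i x X)))
        linarith
      have h₇ : 1 - (1 - avg N (fun X => b (setBlock n i x X))) ^ T.eval n ≤
        (blockInverter hf s B T S L).prob (withSecurity n (f x)) (f ⁻¹' {f x}) := h₅
      linarith
  have h₅ : (1 : ℝ) / (s.eval n : ℕ) = 1 / (2 * (s.eval n : ℕ)) + 1 / (2 * (s.eval n : ℕ)) := by
    field_simp
    norm_num
  linarith

theorem tendsto_blockLength (hs : ∀ n, 0 < s.eval n) : Tendsto (blockLength s) atTop atTop :=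
  tendsto_atTop.2 fun n => (eventually_ge_atTop (n * (blockCount s).eval n)).mono fun _ h =>
    le_blockLength hs h

theorem eventually_invProb_product_le (hf : PF f) (hs : ∀ n, 0 < s.eval n)
    (hweak : ∀ A : PPT, ∀ᶠ n in atTop, invProb f A n < 1 - 1 / ((s.eval n : ℕ) : ℝ)) (B : PPT)
    (k : ℕ) : ∀ᶠ N in atTop, invProb (product f s) B N ≤ 1 / (N : ℝ) ^ k := by
  obtain ⟨P, hP⟩ := length_le_of_pf (g := fun X => withSecurity X.length (product f s X))
    (PF.withSecurity (by fun_prop) (pf_product hf))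
  -- The bound of `lt_of_blockLength`; then `S` below leaves room for the filler and for the coins
  -- of `B` on the longest possible query.
  set L : Polynomial ℕ := (.X + 1) * (blockCount s).comp (.X + 1) with hL
  have hLev : ∀ n, L.eval n = (n + 1) * (blockCount s).eval (n + 1) := fun n => by simp [hL]
  have hexp : ∀ᶠ n : ℕ in atTop, 2 * ((L.eval n : ℕ) : ℝ) ^ k < Real.exp n := by
    have h := (Polynomial.tendsto_div_exp_atTop
      ((2 * L ^ k).map (Nat.castRingHom ℝ))).comp tendsto_natCast_atTop_atTop
    filter_upwards [h.eventually (gt_mem_nhds one_pos)] with n hn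
    rw [Function.comp_apply, div_lt_one (Real.exp_pos _)] at hn
    simpa [Polynomial.eval_natCast_map] using hn
  filter_upwards [(tendsto_blockLength hs).eventually (hweak (blockInverter hf s B
      (4 * blockCount s * s * L ^ k) (L + B.coins.comp (P.comp L)) L)),
    (tendsto_blockLength hs).eventually hexp,
    (tendsto_blockLength hs).eventually (eventually_gt_atTop 0)] with N h₁ h₂ h₃
  have hN : N < L.eval (blockLength s N) := by
    rw [hLev]
    exact lt_of_blockLength hs N
  refine invProb_product_le hf hs h₃ hN ?_ rfl h₂ h₁
  rintro X rfl
  simp only [Polynomial.eval_add, Polynomial.eval_comp]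
  exact add_le_add hN.le (eval_mono _ ((hP X).trans (eval_mono P hN.le)))

/-- The direct product of a weak one-way function is a one-way function. -/
theorem IsWeakOWF.exists_isOWF (h : IsWeakOWF f) : ∃ g : List Bool → List Bool, IsOWF g := by
  obtain ⟨hf, s, hs, hweak⟩ := h
  refine ⟨product f s, (pf_product hf.pf).polyTime, fun B => ⟨invProb (product f s) B, ?_,
    fun _ => le_rfl⟩⟩
  intro k
  refine squeeze_zero' (.of_forall fun N => mul_nonneg (by positivity)
    (avg_nonneg fun x _ => B.prob_nonneg _ _)) ?_ tendsto_one_div_atTop_nhds_zero_nat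
  -- One power more than needed leaves the factor `1/N`, which tends to zero.
  filter_upwards [eventually_invProb_product_le hf.pf hs hweak B (k + 1), eventually_gt_atTop 0]
    with N hN hN₀
  calc (N : ℝ) ^ k * invProb (product f s) B N ≤ (N : ℝ) ^ k * (1 / (N : ℝ) ^ (k + 1)) := by gcongr
    _ = 1 / N := by rw [pow_succ]; field_simp

end AmplificationBounds

end KOWF

theorem mainTheorem2 (t : ℕ → ℕ) (T p : Polynomial ℝ)
    (hT : ∀ n : ℕ, 1 ≤ n → (t n : ℝ) = T.eval (n : ℝ))
    (ht : ∀ n : ℕ, 1 ≤ n → 0 < t n)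
    (hp : ∀ n : ℕ, 1 ≤ n → 0 < p.eval (n : ℝ))
    (hard : IsHardOnAverage (fun n => 1 / p.eval (n : ℝ))
      (fun x => Computability.encodeNat (Kt t x))) :
    (∀ c : ℕ, (∀ x : List Bool, Kt t x ≤ x.length + c) →
      IsWeakOWFFamily (ktLength c) (ktFun t c)) ∧
    (∃ f : List Bool → List Bool, IsWeakOWF f) ∧
    (∃ f : List Bool → List Bool, IsOWF f) := by
  have htPF := pf_of_polynomial t T hT
  have hfam : ∀ c : ℕ, (∀ x : List Bool, Kt t x ≤ x.length + c) →
      IsWeakOWFFamily (ktLength c) (ktFun t c) :=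
    fun c hc => isWeakOWFFamily_ktFun htPF hp hard hc
  -- The constant `c = 1` is available because the machine with the empty table prints its input.
  have hweak := isWeakOWF_ktSingle htPF (hfam 1 (Kt_le t))
  exact ⟨hfam, ⟨_, hweak⟩, hweak.exists_isOWF⟩
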